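/- Let $\mathbf{SU}(2)$ be the group of $2\times 2$ complex unitary matrices of determinant $1$, with normalized Haar measure $\mu$. Let $X$, $Y$ be the left-invariant vector fields $Xf(g)=\frac{d}{ds}\big|_{s=0}f(g\,e^{sX})$, $Yf(g)=\frac{d}{ds}\big|_{s=0}f(g\,e^{sY})$ given by the matrices $$X=\begin{pmatrix}0&1\\-1&0\end{pmatrix},\qquad Y=\begin{pmatrix}0&i\\ i&0\end{pmatrix},$$ and let $\mathcal L=X^2+Y^2$ and $\Gamma(f,h)=\frac12\big(\mathcal L(fh)-f\mathcal Lh-h\mathcal Lf\big)$, so that $\Gamma(f,f)=(Xf)^2+(Yf)^2$ for smooth $f$. For every smooth $f:\mathbf{SU}(2)\to\mathbb R$ the Cauchy problem $\partial_t u=\mathcal L u$ ($t>0$), $u(0,\cdot)=f$, has exactly one solution that is continuous on $[0,\infty)\times \mathbf{SU}(2)$ and smooth on $\mathbf{SU}(2)$ for each $t>0$; write $P_tf=e^{t\mathcal L}f=u(t,\cdot)$. For every $t>0$ there is exactly one smooth function $p_t:\mathbf{SU}(2)\to\mathbb R$, the heat kernel issued from the identity element $e$, with $P_tf(e)=\int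 p_t f\,d\mu$ for all smooth $f$. The function $t\mapsto\int_{\mathbf{SU}(2)}p_t^2\,d\mu$ is differentiable on $(0,\infty)$; put $$A(t)=-\frac14\,\frac{\partial}{\partial t}\int_{\mathbf{SU}(2)}p_t^2\,d\mu ,\qquad t>0 .$$ Then, for every smooth $f:\mathbf{SU}(2)\to\mathbb R$, every $t>0$ and every $g\in\mathbf{SU}(2)$, $$\Gamma(P_tf,P_tf)(g)\le A(t)\left(\int_{\mathbf{SU}(2)}f^2\,d\mu-\Big(\int_{\mathbf{SU}(2)}f\,d\mu\Big)^2\right).$$ Moreover, $A$ is (strictly) decreasing on $(0,\infty)$, and $$A(t)\sim\frac{\pi^2}{128\,t^3}\quad(t\to0^+),\qquad A(t)\sim 4e^{-4t}\quad(t\to+\infty).$$ -/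

import Mathlib

open MeasureTheory Filter Topology Asymptotics

namespace SubellipticSU2

/-- The compact Lie group `SU(2)` of unitary `2 × 2` complex matrices of determinant `1`. -/
abbrev SU2 : Type := Matrix.specialUnitaryGroup (Fin 2) ℂ

/-- The Pauli matrix `X`. -/
def pauliX : Matrix (Fin 2) (Fin 2) ℂ := !![0, 1; -1, 0]

/-- The Pauli matrix `Y`. -/
def pauliY : Matrix (Fin 2) (Fin 2) ℂ := !![0, Complex.I; Complex.I, 0]

theorem pauliX_sq : pauliX * pauliX = -1 := by
  ext i j; fin_cases i <;> fin_cases j <;> simp [pauliX]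

theorem pauliY_sq : pauliY * pauliY = -1 := by
  ext i j; fin_cases i <;> fin_cases j <;> simp [pauliY]

theorem exp_smul_of_sq (J : Matrix (Fin 2) (Fin 2) ℂ) (hJ : J * J = -1) (s : ℝ) :
    NormedSpace.exp (s • J) = Real.cos s • (1 : Matrix (Fin 2) (Fin 2) ℂ) + Real.sin s • J := by
  let _ : NormedRing (Matrix (Fin 2) (Fin 2) ℂ) := Matrix.linftyOpNormedRing
  let _ : NormedAlgebra ℝ (Matrix (Fin 2) (Fin 2) ℂ) := Matrix.linftyOpNormedAlgebra
  have hc : Continuous (Complex.lift ⟨J, hJ⟩) :=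
    (Complex.lift ⟨J, hJ⟩).toLinearMap.continuous_of_finiteDimensional
  have h := NormedSpace.map_exp (Complex.lift ⟨J, hJ⟩) hc (s * Complex.I)
  have h1 : Complex.lift ⟨J, hJ⟩ (s * Complex.I) = s • J := by
    simp [Complex.liftAux_apply]
  have h2 : NormedSpace.exp ((s : ℂ) * Complex.I) = Complex.exp (s * Complex.I) := by
    rw [Complex.exp_eq_exp_ℂ]
  rw [h1, h2] at h
  refine Eq.trans h.symm ?_
  simp [Complex.liftAux_apply, Complex.exp_ofReal_mul_I_re, Complex.exp_ofReal_mul_I_im,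
    Algebra.algebraMap_eq_smul_one]

theorem exp_smul_pauliX (s : ℝ) : NormedSpace.exp (s • pauliX) =
    !![(Real.cos s : ℂ), (Real.sin s : ℂ); -(Real.sin s : ℂ), (Real.cos s : ℂ)] := by
  rw [exp_smul_of_sq _ pauliX_sq]
  ext i j; fin_cases i <;> fin_cases j <;> simp [pauliX]

theorem exp_smul_pauliY (s : ℝ) : NormedSpace.exp (s • pauliY) =
    !![(Real.cos s : ℂ), (Real.sin s : ℂ) * Complex.I;
      (Real.sin s : ℂ) * Complex.I, (Real.cos s : ℂ)] := by
  rw [exp_smul_of_sq _ pauliY_sq]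
  ext i j; fin_cases i <;> fin_cases j <;> simp [pauliY]

theorem exp_smul_pauliX_mem (s : ℝ) :
    NormedSpace.exp (s • pauliX) ∈ Matrix.specialUnitaryGroup (Fin 2) ℂ := by
  have h := Complex.sin_sq_add_cos_sq (s : ℂ)
  rw [exp_smul_pauliX, Matrix.mem_specialUnitaryGroup_iff, Matrix.mem_unitaryGroup_iff]
  constructor
  · ext i j; fin_cases i <;> fin_cases j <;>
      simp [Matrix.mul_apply, Matrix.star_apply, ← Complex.cos_conj, ← Complex.sin_conj] <;>
      first | ring1 | linear_combination h
  · simp [Matrix.det_fin_two]; linear_combination h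

theorem exp_smul_pauliY_mem (s : ℝ) :
    NormedSpace.exp (s • pauliY) ∈ Matrix.specialUnitaryGroup (Fin 2) ℂ := by
  have h := Complex.sin_sq_add_cos_sq (s : ℂ)
  have hI := Complex.I_sq
  rw [exp_smul_pauliY, Matrix.mem_specialUnitaryGroup_iff, Matrix.mem_unitaryGroup_iff]
  constructor
  · ext i j; fin_cases i <;> fin_cases j <;>
      simp [Matrix.mul_apply, Matrix.star_apply, ← Complex.cos_conj, ← Complex.sin_conj] <;>
      first | ring1 | linear_combination h - Complex.sin s ^ 2 * hI
  · simp [Matrix.det_fin_two]; linear_combination h - Complex.sin s ^ 2 * hI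

/-- The one-parameter subgroup `s ↦ exp (s X)` of `SU(2)`. -/
noncomputable def expX (s : ℝ) : SU2 := ⟨NormedSpace.exp (s • pauliX), exp_smul_pauliX_mem s⟩

/-- The one-parameter subgroup `s ↦ exp (s Y)` of `SU(2)`. -/
noncomputable def expY (s : ℝ) : SU2 := ⟨NormedSpace.exp (s • pauliY), exp_smul_pauliY_mem s⟩

/-- Smooth functions on `SU(2)`, a closed embedded submanifold of the space of `2 × 2` complex
matrices: the restrictions of smooth functions on that space. -/
def IsSmooth (f : SU2 → ℝ) : Prop :=
  ∃ F : (Fin 2 → Fin 2 → ℂ) → ℝ, ContDiff ℝ (⊤ : ℕ∞) F ∧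
    ∀ g : SU2, f g = F (fun i j => (g : Matrix (Fin 2) (Fin 2) ℂ) i j)

/-- The left-invariant vector field `X`. -/
noncomputable def fieldX (f : SU2 → ℝ) (g : SU2) : ℝ := deriv (fun s : ℝ => f (g * expX s)) 0

/-- The left-invariant vector field `Y`. -/
noncomputable def fieldY (f : SU2 → ℝ) (g : SU2) : ℝ := deriv (fun s : ℝ => f (g * expY s)) 0

/-- The sublaplacian `ℒ = X² + Y²`. -/
noncomputable def sublaplacian (f : SU2 → ℝ) (g : SU2) : ℝ :=
  fieldX (fieldX f) g + fieldY (fieldY f) g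

/-- The carré du champ `Γ(f, h) = (ℒ(f h) - f ℒ h - h ℒ f) / 2`. -/
noncomputable def carreDuChamp (f h : SU2 → ℝ) (g : SU2) : ℝ :=
  (sublaplacian (fun x => f x * h x) g - f g * sublaplacian h g - h g * sublaplacian f g) / 2

instance instContinuousInvSU2 : ContinuousInv SU2 where
  continuous_inv := by
    have h : Continuous fun g : SU2 => star (g : Matrix (Fin 2) (Fin 2) ℂ) :=
      continuous_star.comp continuous_subtype_val
    exact h.subtype_mk _

instance instIsTopologicalGroupSU2 : IsTopologicalGroup SU2 where

theorem norm_coe_apply_le_one (g : SU2) (i j : Fin 2) :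
    ‖(g : Matrix (Fin 2) (Fin 2) ℂ) i j‖ ≤ 1 :=
  entry_norm_bound_of_unitary (Matrix.specialUnitaryGroup_le_unitaryGroup g.2) i j

theorem isClosed_SU2 :
    IsClosed (Matrix.specialUnitaryGroup (Fin 2) ℂ : Set (Matrix (Fin 2) (Fin 2) ℂ)) := by
  have h : (Matrix.specialUnitaryGroup (Fin 2) ℂ : Set (Matrix (Fin 2) (Fin 2) ℂ)) =
      {A | A * star A = 1} ∩ {A | A.det = 1} := by
    ext A
    simp [Matrix.mem_specialUnitaryGroup_iff, Matrix.mem_unitaryGroup_iff]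
  rw [h]
  exact (isClosed_eq (continuous_id.mul continuous_star) continuous_const).inter
    (isClosed_eq (Continuous.matrix_det continuous_id) continuous_const)

instance instCompactSpaceSU2 : CompactSpace SU2 := by
  have hK : IsCompact (Set.univ.pi fun _ : Fin 2 => Set.univ.pi fun _ : Fin 2 =>
      Metric.closedBall (0 : ℂ) 1) :=
    isCompact_univ_pi fun _ => isCompact_univ_pi fun _ => isCompact_closedBall 0 1
  refine isCompact_iff_compactSpace.mp (IsCompact.of_isClosed_subset hK isClosed_SU2 ?_)
  intro A hA i _ j _
  simpa using norm_coe_apply_le_one ⟨A, hA⟩ i j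

noncomputable instance instMeasurableSpaceSU2 : MeasurableSpace SU2 := borel SU2

instance instBorelSpaceSU2 : BorelSpace SU2 := ⟨rfl⟩

/-- The normalized Haar measure `μ` of the compact group `SU(2)`, with `μ (SU(2)) = 1`. -/
noncomputable def haar : Measure SU2 := Measure.haarMeasure ⊤

/-- `u` is the solution of the Cauchy problem `∂ₜ u = ℒ u`, `u(0, ·) = f`: it is continuous on
`[0, ∞) × SU(2)`, smooth in space for each `t > 0`, and satisfies the equation for `t > 0`. -/
def IsHeatSolution (f : SU2 → ℝ) (u : ℝ → SU2 → ℝ) : Prop :=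
  u 0 = f ∧
  ContinuousOn (fun q : ℝ × SU2 => u q.1 q.2) (Set.Ici 0 ×ˢ Set.univ) ∧
  (∀ t : ℝ, 0 < t → IsSmooth (u t)) ∧
  ∀ t : ℝ, 0 < t → ∀ g : SU2, HasDerivAt (fun s : ℝ => u s g) (sublaplacian (u t) g) t

/-- The heat semigroup `Pₜ f = exp (t ℒ) f` on smooth functions `f`: the value at time `t` of the
solution of the Cauchy problem with initial datum `f` (it exists and is unique for `t ≥ 0`). -/
noncomputable def heatSemigroup (t : ℝ) (f : SU2 → ℝ) : SU2 → ℝ :=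
  Classical.epsilon (IsHeatSolution f) t

/-- `p` is the smooth density, with respect to Haar measure, of the heat kernel measure at time `t`
issued from the identity. -/
def IsHeatKernel (t : ℝ) (p : SU2 → ℝ) : Prop :=
  IsSmooth p ∧ ∀ f : SU2 → ℝ, IsSmooth f → heatSemigroup t f 1 = ∫ h, p h * f h ∂haar

/-- The heat kernel `pₜ` issued from the identity (it exists and is unique for `t > 0`). -/
noncomputable def heatKernel (t : ℝ) : SU2 → ℝ := Classical.epsilon (IsHeatKernel t)

/-- `A(t) = -(1/4) ∂ₜ ∫ pₜ² dμ`. -/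
noncomputable def gradConst (t : ℝ) : ℝ :=
  -(1 / 4) * deriv (fun s : ℝ => ∫ g, heatKernel s g ^ 2 ∂haar) t

end SubellipticSU2

namespace SubellipticSU2

/-! ### Haar measure on `SU(2)` -/

/-! The heat kernel is explicit. Write a matrix as rows `(a, b)`, `(c, d)`. The coherent functions
`(x a + y c) ^ p (x b + y d) ^ s` (`wave`) are eigenfunctions of `ℒ` with eigenvalue `-(2 (p + s) +
4 p s)`, and so are the diagonal matrix coefficients `diagCoeff p s`, which are discrete Fourier
averages of them. The candidate `kernel t` is the sum over `(p, s)` of `dimension * exp (-t *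
eigenvalue) * diagCoeff`. All series extend holomorphically to a neighbourhood of the group, where
Cauchy estimates (`LocallyNormallySummable.fderiv`) permit termwise differentiation. The bound that
makes them converge is `RowBound.norm_diagCoeff_le`.

Convolution with `kernel t` multiplies each coherent function by its exponential factor
(`integral_kernel_mul_wave`, a form of Schur orthogonality computed by hand). Coherent functions
span a dense space by Stone-Weierstrass (`exists_mem_waveSpan_near`). The maximum principle
(`IsHeatSolution.le_of_le`) gives uniqueness of the flow, and also the sup-norm contraction
(`abs_conv_le`) needed to pass from the span to every continuous datum, so positivity of the kernel
is never used. Hence `heatSemigroup` is convolution with `kernel` and `heatKernel = kernel`.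

For the gradient bound, `X Pₜf (g)` is the pairing of the translated function `X pₜ` with `f` minus
its mean, because `X pₜ` has integral zero; likewise for `Y`. Conjugation by `diag (exp (iπ/4), exp
(-iπ/4))` preserves `pₜ` and rotates `X` to `Y` and `Y` to `-X`, so `X pₜ` and `Y pₜ` are orthogonal
in `L²` with equal norms. Bessel's inequality bounds `Γ` by `‖X pₜ‖²` times the variance, and `‖X
pₜ‖²` is half the Dirichlet energy of `pₜ`, that is `A(t)`.

Finally `2 A(t)` is the sum of `eigenvalue * dimension * exp (-2 t eigenvalue)`, which is visibly
decreasing. At infinity the two terms of eigenvalue 2 dominate. At zero, `eigenvalue + 1 = (2 p + 1)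
(2 s + 1)` lets one index be summed in closed form with hyperbolic functions; the limit of the rest
is governed by the sum of `1 / (2 s + 1) ^ 2`, equal to `π² / 8`. -/

instance instIsHaarMeasureHaar : haar.IsHaarMeasure := by
  unfold haar; infer_instance

instance instIsProbabilityMeasureHaar : IsProbabilityMeasure haar where
  measure_univ := by
    have h := Measure.haarMeasure_self (G := SU2) (K₀ := ⊤)
    simpa [haar] using h

/-- A right translate of Haar measure is again a left Haar probability measure, and there is only
one. -/
instance instIsMulRightInvariantHaar : haar.IsMulRightInvariant where
  map_mul_right_eq_self g := by
    have : IsProbabilityMeasure (Measure.map (fun x => x * g) haar) :=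
      Measure.isProbabilityMeasure_map (continuous_mul_const g).aemeasurable
    exact Measure.isHaarMeasure_eq_of_isProbabilityMeasure _ _

/-- Right invariance makes the inverted measure left invariant, so uniqueness applies again. -/
instance instIsInvInvariantHaar : haar.IsInvInvariant where
  inv_eq_self := by
    have h0 : IsProbabilityMeasure haar.inv :=
      Measure.isProbabilityMeasure_map continuous_inv.aemeasurable
    have : haar.inv.IsHaarMeasure :=
      { (inferInstance : haar.inv.IsMulLeftInvariant) with
        lt_top_of_isCompact := fun K _ => measure_lt_top _ _
        open_pos := (inferInstance : haar.inv.IsOpenPosMeasure).open_pos }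
    exact Measure.isHaarMeasure_eq_of_isProbabilityMeasure _ _

theorem integrable_of_continuous {F : Type*} [NormedAddCommGroup F] {f : SU2 → F}
    (hf : Continuous f) : Integrable f haar := 
  hf.integrable_of_hasCompactSupport (HasCompactSupport.of_compactSpace f)

/-! ### The ambient space -/

/-- The ambient space of `2 × 2` complex matrices. -/
abbrev Mat : Type := Fin 2 → Fin 2 → ℂ

/-- The inclusion of `SU(2)` in the ambient space. -/
def emb (g : SU2) : Mat := fun i j => (g : Matrix (Fin 2) (Fin 2) ℂ) i j

theorem continuous_emb : Continuous emb := continuous_subtype_val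

theorem emb_injective : Function.Injective emb := Subtype.val_injective

theorem continuous_emb_apply (i j : Fin 2) : Continuous fun g => emb g i j := 
  (continuous_apply_apply i j).comp continuous_emb

theorem emb_one (i j : Fin 2) : emb 1 i j = if i = j then 1 else 0 :=
  Matrix.one_apply (i := i) (j := j)

theorem emb_mul (g h : SU2) (i j : Fin 2) :
    emb (g * h) i j = emb g i 0 * emb h 0 j + emb g i 1 * emb h 1 j := by
  simp [emb, Matrix.mul_apply]

theorem emb_inv (g : SU2) (i j : Fin 2) : emb g⁻¹ i j = star (emb g j i) := rfl

theorem emb_det (g : SU2) : emb g 0 0 * emb g 1 1 - emb g 0 1 * emb g 1 0 = 1 := by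
  have := (Matrix.mem_specialUnitaryGroup_iff.1 g.2).2
  rwa [Matrix.det_fin_two] at this

theorem emb_row_mul_star (g : SU2) (i j : Fin 2) :
    emb g i 0 * star (emb g j 0) + emb g i 1 * star (emb g j 1) = if i = j then 1 else 0 := by
  have := congrArg emb (mul_inv_cancel g)
  have h := congrFun (congrFun this i) j
  rw [emb_mul, emb_inv, emb_inv] at h
  rw [h, emb_one]

theorem emb_one_one (g : SU2) : emb g 1 1 = star (emb g 0 0) := by
  have h1 := emb_det g
  have h2 := emb_row_mul_star g 0 0
  have h3 := emb_row_mul_star g 1 0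
  simp only [if_true, one_ne_zero, if_false] at h2 h3
  linear_combination (-emb g 1 1) * h2 + (star (emb g 0 0)) * h1 + emb g 0 1 * h3

theorem emb_one_zero (g : SU2) : emb g 1 0 = -star (emb g 0 1) := by
  have h1 := emb_det g
  have h2 := emb_row_mul_star g 0 0
  have h3 := emb_row_mul_star g 1 0
  simp only [if_true, one_ne_zero, if_false] at h2 h3
  linear_combination (-emb g 1 0) * h2 - (star (emb g 0 1)) * h1 + emb g 0 0 * h3

theorem normSq_emb_row (g : SU2) :
    Complex.normSq (emb g 0 0) + Complex.normSq (emb g 0 1) = 1 := by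
  have h := emb_row_mul_star g 0 0
  simp only [if_true] at h
  have h' : ((Complex.normSq (emb g 0 0) + Complex.normSq (emb g 0 1) : ℝ) : ℂ) = 1 := by
    push_cast
    rw [← Complex.mul_conj, ← Complex.mul_conj]
    exact h
  exact_mod_cast h'

/-- The element of `SU(2)` with first row `(a, b)`. -/
def mk (a b : ℂ) (h : Complex.normSq a + Complex.normSq b = 1) : SU2 :=
  ⟨!![a, b; -star b, star a], by
    have h' : a * star a + b * star b = 1 := by
      have : ((Complex.normSq a + Complex.normSq b : ℝ) : ℂ) = 1 := by rw [h]; simp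
      push_cast at this
      rwa [← Complex.mul_conj, ← Complex.mul_conj] at this
    rw [Matrix.mem_specialUnitaryGroup_iff, Matrix.mem_unitaryGroup_iff]
    simp only [Complex.star_def] at h' ⊢
    constructor
    · ext i j; fin_cases i <;> fin_cases j <;>
        simp [Matrix.mul_apply, Matrix.star_apply] <;> first | ring1 | linear_combination h'
    · simp [Matrix.det_fin_two]; linear_combination h'⟩

theorem emb_mk (a b : ℂ) (h) : emb (mk a b h) = ![![a, b], ![-star b, star a]] := rfl

/-- Left multiplication by a matrix. -/
noncomputable def leftMul (g : SU2) : Mat →L[ℂ] Mat :=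
  LinearMap.toContinuousLinearMap
    { toFun := fun A i j => emb g i 0 * A 0 j + emb g i 1 * A 1 j
      map_add' := fun A B => by ext i j; simp only [Pi.add_apply]; ring
      map_smul' := fun c A => by ext i j; simp only [Pi.smul_apply, smul_eq_mul, RingHom.id_apply]; ring }

theorem leftMul_apply (g : SU2) (A : Mat) (i j : Fin 2) :
    leftMul g A i j = emb g i 0 * A 0 j + emb g i 1 * A 1 j := rfl

theorem leftMul_emb (g h : SU2) : leftMul g (emb h) = emb (g * h) := by
  ext i j; rw [leftMul_apply, emb_mul]

theorem continuous_leftMul : Continuous leftMul := by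
  rw [continuous_clm_apply]
  intro A
  refine continuous_pi fun i => continuous_pi fun j => ?_
  simp only [leftMul_apply]
  have := continuous_emb_apply
  fun_prop

/-- Right multiplication by `X` in the ambient space. -/
noncomputable def rightX : Mat →L[ℂ] Mat :=
  LinearMap.toContinuousLinearMap
    { toFun := fun A i => ![-A i 1, A i 0]
      map_add' := fun A B => by ext i j; fin_cases j <;> simp [add_comm]
      map_smul' := fun c A => by ext i j; fin_cases j <;> simp }

/-- Right multiplication by `Y` in the ambient space. -/
noncomputable def rightY : Mat →L[ℂ] Mat :=
  LinearMap.toContinuousLinearMap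
    { toFun := fun A i => ![Complex.I * A i 1, Complex.I * A i 0]
      map_add' := fun A B => by ext i j; fin_cases j <;> simp [mul_add]
      map_smul' := fun c A => by ext i j; fin_cases j <;> simp [mul_left_comm] }

@[simp] theorem rightX_zero (A : Mat) (i : Fin 2) : rightX A i 0 = -A i 1 := rfl
@[simp] theorem rightX_one (A : Mat) (i : Fin 2) : rightX A i 1 = A i 0 := rfl
@[simp] theorem rightY_zero (A : Mat) (i : Fin 2) : rightY A i 0 = Complex.I * A i 1 := rfl
@[simp] theorem rightY_one (A : Mat) (i : Fin 2) : rightY A i 1 = Complex.I * A i 0 := rfl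

/-- `γ` is the one-parameter subgroup generated by a matrix with square `-1` whose right
multiplication is `R`. -/
structure IsDirection (γ : ℝ → SU2) (R : Mat →L[ℂ] Mat) : Prop where
  emb_mul_eq : ∀ g s, emb (g * γ s) = (Real.cos s : ℂ) • emb g + (Real.sin s : ℂ) • R (emb g)
  sq_eq : ∀ A, R (R A) = -A

theorem isDirection_expX : IsDirection expX rightX where
  emb_mul_eq g s := by
    have : emb (expX s) = ![![(Real.cos s : ℂ), (Real.sin s : ℂ)],
        ![-(Real.sin s : ℂ), (Real.cos s : ℂ)]] := exp_smul_pauliX s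
    ext i j
    rw [emb_mul, this]
    fin_cases j <;> simp <;> ring
  sq_eq A := by ext i j; fin_cases j <;> simp

theorem isDirection_expY : IsDirection expY rightY where
  emb_mul_eq g s := by
    have : emb (expY s) = ![![(Real.cos s : ℂ), (Real.sin s : ℂ) * Complex.I],
        ![(Real.sin s : ℂ) * Complex.I, (Real.cos s : ℂ)]] := exp_smul_pauliY s
    ext i j
    rw [emb_mul, this]
    fin_cases j <;> simp <;> ring
  sq_eq A := by ext i j; fin_cases j <;> simp [← mul_assoc]

variable {γ : ℝ → SU2} {R : Mat →L[ℂ] Mat}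

theorem IsDirection.apply_zero (h : IsDirection γ R) : γ 0 = 1 := by
  apply emb_injective
  have := h.emb_mul_eq 1 0
  simpa using this

theorem IsDirection.hasDerivAt (h : IsDirection γ R) (g : SU2) (s : ℝ) :
    HasDerivAt (fun s => emb (g * γ s)) (R (emb (g * γ s))) s := by
  have e : (fun s => emb (g * γ s)) =
      fun s : ℝ => (Real.cos s : ℂ) • emb g + (Real.sin s : ℂ) • R (emb g) :=
    funext fun s => h.emb_mul_eq g s
  rw [e, h.emb_mul_eq]
  have h1 := ((Real.hasDerivAt_cos s).ofReal_comp).smul_const (emb g)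
  have h2 := ((Real.hasDerivAt_sin s).ofReal_comp).smul_const (R (emb g))
  refine (h1.add h2).congr_deriv ?_
  simp only [map_add, map_smul, h.sq_eq]
  push_cast
  module

theorem IsDirection.continuous (h : IsDirection γ R) : Continuous γ := by
  have : Continuous fun s => emb (1 * γ s) :=
    continuous_iff_continuousAt.2 fun s => (h.hasDerivAt 1 s).continuousAt
  simp only [one_mul] at this
  exact continuous_induced_rng.2 this

/-! ### Smooth functions and left-invariant fields -/

/-- The derivative along a one-parameter subgroup acting on the right. -/
noncomputable def fieldAlong (γ : ℝ → SU2) (f : SU2 → ℝ) (g : SU2) : ℝ :=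
  deriv (fun s : ℝ => f (g * γ s)) 0

theorem IsSmooth.continuous {f : SU2 → ℝ} (hf : IsSmooth f) : Continuous f := by
  obtain ⟨F, hF, h⟩ := hf
  rw [funext h]
  exact hF.continuous.comp continuous_emb

theorem isSmooth_const (c : ℝ) : IsSmooth fun _ => c := ⟨fun _ => c, contDiff_const, fun _ => rfl⟩

theorem IsSmooth.add {f h : SU2 → ℝ} (hf : IsSmooth f) (hh : IsSmooth h) :
    IsSmooth fun g => f g + h g := by
  obtain ⟨F, hF, hf⟩ := hf
  obtain ⟨H, hH, hh⟩ := hh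
  exact ⟨fun A => F A + H A, hF.add hH, fun g => congrArg₂ _ (hf g) (hh g)⟩

theorem IsSmooth.mul {f h : SU2 → ℝ} (hf : IsSmooth f) (hh : IsSmooth h) :
    IsSmooth fun g => f g * h g := by
  obtain ⟨F, hF, hf⟩ := hf
  obtain ⟨H, hH, hh⟩ := hh
  exact ⟨fun A => F A * H A, hF.mul hH, fun g => congrArg₂ _ (hf g) (hh g)⟩

theorem IsSmooth.const_mul {f : SU2 → ℝ} (hf : IsSmooth f) (c : ℝ) :
    IsSmooth fun g => c * f g := (isSmooth_const c).mul hf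

theorem IsSmooth.neg {f : SU2 → ℝ} (hf : IsSmooth f) : IsSmooth fun g => -f g := by
  simpa using hf.const_mul (-1)

theorem IsSmooth.sub {f h : SU2 → ℝ} (hf : IsSmooth f) (hh : IsSmooth h) :
    IsSmooth fun g => f g - h g := by
  simpa [sub_eq_add_neg] using hf.add hh.neg

theorem IsDirection.hasDerivAt_comp (hd : IsDirection γ R) {F : Mat → ℝ} {F' : Mat →L[ℝ] ℝ}
    {g : SU2} {s : ℝ} (hF : HasFDerivAt F F' (emb (g * γ s))) :
    HasDerivAt (fun s => F (emb (g * γ s))) (F' (R (emb (g * γ s)))) s :=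
  hF.comp_hasDerivAt s (hd.hasDerivAt g s)

/-- The field acts on an ambient extension `F` by `A ↦ DF(A) (R A)`, which is again smooth on the
whole ambient space. The second part extends the derivative from `0` to the whole curve. -/
theorem IsSmooth.fieldAlong (hd : IsDirection γ R) {f : SU2 → ℝ} (hf : IsSmooth f) :
    IsSmooth (fieldAlong γ f) ∧
      ∀ g s, HasDerivAt (fun s => f (g * γ s)) (fieldAlong γ f (g * γ s)) s := by
  obtain ⟨F, hF, hf⟩ := hf
  have hF' : Differentiable ℝ F := hF.differentiable (by simp)
  have key : ∀ g s, HasDerivAt (fun s => f (g * γ s))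
      (fderiv ℝ F (emb (g * γ s)) (R (emb (g * γ s)))) s := by
    intro g s
    have : (fun s => f (g * γ s)) = fun s => F (emb (g * γ s)) := funext fun s => hf _
    rw [this]
    exact hd.hasDerivAt_comp (hF' _).hasFDerivAt
  have e : ∀ g, SubellipticSU2.fieldAlong γ f g = fderiv ℝ F (emb g) (R (emb g)) := by
    intro g
    have := (key g 0).deriv
    rwa [hd.apply_zero, mul_one] at this
  refine ⟨⟨fun A => fderiv ℝ F A (R A), ?_, fun g => e g⟩, fun g s => ?_⟩
  · have h1 : ContDiff ℝ (⊤ : ℕ∞) (fderiv ℝ F) := hF.fderiv_right (by simp)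
    exact h1.clm_apply (R.restrictScalars ℝ).contDiff
  · rw [e]; exact key g s

theorem fieldX_eq : fieldX = fieldAlong expX := rfl
theorem fieldY_eq : fieldY = fieldAlong expY := rfl

theorem IsSmooth.fieldX {f : SU2 → ℝ} (hf : IsSmooth f) : IsSmooth (fieldX f) :=
  (hf.fieldAlong isDirection_expX).1

theorem IsSmooth.fieldY {f : SU2 → ℝ} (hf : IsSmooth f) : IsSmooth (fieldY f) :=
  (hf.fieldAlong isDirection_expY).1

theorem IsSmooth.sublaplacian {f : SU2 → ℝ} (hf : IsSmooth f) : IsSmooth (sublaplacian f) :=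
  hf.fieldX.fieldX.add hf.fieldY.fieldY

theorem IsSmooth.hasDerivAt_zero (hd : IsDirection γ R) {f : SU2 → ℝ} (hf : IsSmooth f) (g : SU2) :
    HasDerivAt (fun s => f (g * γ s)) (SubellipticSU2.fieldAlong γ f g) 0 := by
  have := (hf.fieldAlong hd).2 g 0
  rwa [hd.apply_zero, mul_one] at this

theorem fieldAlong_add (hd : IsDirection γ R) {f h : SU2 → ℝ} (hf : IsSmooth f)
    (hh : IsSmooth h) :
    fieldAlong γ (fun g => f g + h g) = fun g => fieldAlong γ f g + fieldAlong γ h g :=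
  funext fun g => ((hf.hasDerivAt_zero hd g).add (hh.hasDerivAt_zero hd g)).deriv

theorem fieldAlong_const_mul (hd : IsDirection γ R) {f : SU2 → ℝ} (hf : IsSmooth f) (c : ℝ) :
    fieldAlong γ (fun g => c * f g) = fun g => c * fieldAlong γ f g :=
  funext fun g => ((hf.hasDerivAt_zero hd g).const_mul c).deriv

theorem fieldAlong_mul (hd : IsDirection γ R) {f h : SU2 → ℝ} (hf : IsSmooth f)
    (hh : IsSmooth h) :
    fieldAlong γ (fun g => f g * h g) = fun g => fieldAlong γ f g * h g + f g * fieldAlong γ h g := by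
  funext g
  have := ((hf.hasDerivAt_zero hd g).fun_mul (hh.hasDerivAt_zero hd g)).deriv
  simpa [fieldAlong, hd.apply_zero] using this

theorem sublaplacian_add {f h : SU2 → ℝ} (hf : IsSmooth f) (hh : IsSmooth h) (g : SU2) :
    sublaplacian (fun g => f g + h g) g = sublaplacian f g + sublaplacian h g := by
  have hfX : IsSmooth (fieldAlong expX f) := hf.fieldX
  have hfY : IsSmooth (fieldAlong expY f) := hf.fieldY
  have hhX : IsSmooth (fieldAlong expX h) := hh.fieldX
  have hhY : IsSmooth (fieldAlong expY h) := hh.fieldY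
  simp only [sublaplacian, fieldX_eq, fieldY_eq]
  rw [fieldAlong_add isDirection_expX hf hh, fieldAlong_add isDirection_expY hf hh,
    fieldAlong_add isDirection_expX hfX hhX,
    fieldAlong_add isDirection_expY hfY hhY]
  ring

theorem sublaplacian_const_mul {f : SU2 → ℝ} (hf : IsSmooth f) (c : ℝ) (g : SU2) :
    sublaplacian (fun g => c * f g) g = c * sublaplacian f g := by
  have hfX : IsSmooth (fieldAlong expX f) := hf.fieldX
  have hfY : IsSmooth (fieldAlong expY f) := hf.fieldY
  simp only [sublaplacian, fieldX_eq, fieldY_eq]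
  rw [fieldAlong_const_mul isDirection_expX hf, fieldAlong_const_mul isDirection_expY hf,
    fieldAlong_const_mul isDirection_expX hfX,
    fieldAlong_const_mul isDirection_expY hfY]
  ring

theorem sublaplacian_sub {f h : SU2 → ℝ} (hf : IsSmooth f) (hh : IsSmooth h) (g : SU2) :
    sublaplacian (fun g => f g - h g) g = sublaplacian f g - sublaplacian h g := by
  have := sublaplacian_add hf (hh.const_mul (-1)) g
  rw [sublaplacian_const_mul hh] at this
  simpa [sub_eq_add_neg] using this

theorem sublaplacian_mul {f h : SU2 → ℝ} (hf : IsSmooth f) (hh : IsSmooth h) (g : SU2) :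
    sublaplacian (fun g => f g * h g) g = f g * sublaplacian h g + h g * sublaplacian f g
      + 2 * (fieldX f g * fieldX h g + fieldY f g * fieldY h g) := by
  have hfX : IsSmooth (fieldAlong expX f) := hf.fieldX
  have hfY : IsSmooth (fieldAlong expY f) := hf.fieldY
  have hhX : IsSmooth (fieldAlong expX h) := hh.fieldX
  have hhY : IsSmooth (fieldAlong expY h) := hh.fieldY
  simp only [sublaplacian, fieldX_eq, fieldY_eq]
  rw [fieldAlong_mul isDirection_expX hf hh, fieldAlong_mul isDirection_expY hf hh,
    fieldAlong_add isDirection_expX (hfX.mul hh) (hf.mul hhX),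
    fieldAlong_add isDirection_expY (hfY.mul hh) (hf.mul hhY),
    fieldAlong_mul isDirection_expX hfX hh, fieldAlong_mul isDirection_expX hf hhX,
    fieldAlong_mul isDirection_expY hfY hh, fieldAlong_mul isDirection_expY hf hhY]
  ring

theorem carreDuChamp_self {f : SU2 → ℝ} (hf : IsSmooth f) (g : SU2) :
    carreDuChamp f f g = fieldX f g ^ 2 + fieldY f g ^ 2 := by
  rw [carreDuChamp, sublaplacian_mul hf hf]; ring

/-! ### Convolution with a continuous function -/

instance instSecondCountableTopologySU2 : SecondCountableTopology SU2 :=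
  (Topology.IsInducing.mk rfl : Topology.IsInducing emb).secondCountableTopology

/-- The derivative in `A` of the integrand has the same shape, with `fderiv ℝ P` for `P` and a new
linear factor `M'`. The induction on `n` therefore has to range over all `F`, `G`, `P` and `M`. -/
theorem contDiff_integral_comp {K E : Type} [TopologicalSpace K] [CompactSpace K]
    [SecondCountableTopology K] [MeasurableSpace K] [BorelSpace K] (μ : Measure K)
    [IsFiniteMeasure μ] [NormedAddCommGroup E] [NormedSpace ℝ E] [FiniteDimensional ℝ E]
    (T : K → E →L[ℝ] E) (hT : Continuous T) (n : ℕ) :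
    ∀ (F G : Type) [NormedAddCommGroup F] [NormedSpace ℝ F] [NormedAddCommGroup G]
      [NormedSpace ℝ G] [CompleteSpace G] (P : E → F) (_ : ContDiff ℝ n P) (M : K → F →L[ℝ] G)
      (_ : Continuous M), ContDiff ℝ n (fun A => ∫ k, M k (P (T k A)) ∂μ) := by
  have : ProperSpace E := FiniteDimensional.proper_real E
  induction n with
  | zero =>
    intro F G _ _ _ _ _ P hP M hM
    have hP := hP.continuous
    refine contDiff_zero.2 ?_
    have h := continuous_parametric_integral_of_continuous (μ := μ)
      (f := fun A k => M k (P (T k A))) (by unfold Function.uncurry; fun_prop) isCompact_univ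
    simpa using h
  | succ n ih =>
    intro F G _ _ _ _ _ P hP M hM
    have hPd : Differentiable ℝ P := hP.differentiable (by simp)
    have hP' : ContDiff ℝ n (fderiv ℝ P) := hP.fderiv_right (by simp)
    let M' : K → (E →L[ℝ] F) →L[ℝ] (E →L[ℝ] G) := fun k =>
      (ContinuousLinearMap.compL ℝ E F G (M k)).comp
        ((ContinuousLinearMap.compL ℝ E E F).flip (T k))
    have hM' : Continuous M' := by fun_prop
    have hc : Continuous (fun q : E × K => M' q.2 (fderiv ℝ P (T q.2 q.1))) := by
      have := hP'.continuous
      fun_prop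
    have hPc := hP.continuous
    push_cast
    refine (contDiff_succ_iff_hasFDerivAt).2 ⟨fun A => ∫ k, M' k (fderiv ℝ P (T k A)) ∂μ,
      ih _ _ _ hP' M' hM', fun A => ?_⟩
    obtain ⟨C, hC⟩ := ((isCompact_closedBall A 1).prod isCompact_univ).exists_bound_of_continuousOn
      hc.continuousOn
    refine hasFDerivAt_integral_of_dominated_of_fderiv_le (bound := fun _ => C)
      (F' := fun A k => M' k (fderiv ℝ P (T k A)))
      (Metric.closedBall_mem_nhds A one_pos) (Eventually.of_forall fun B => ?_) ?_ ?_
      (Eventually.of_forall fun k B hB => hC (B, k) ⟨hB, trivial⟩) (integrable_const C) ?_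
    · exact Continuous.aestronglyMeasurable (by fun_prop)
    · exact Continuous.integrable_of_hasCompactSupport (by fun_prop)
        (HasCompactSupport.of_compactSpace _)
    · exact Continuous.aestronglyMeasurable (by fun_prop)
    · refine Eventually.of_forall fun k B _ => ?_
      have h1 : HasFDerivAt P (fderiv ℝ P (T k B)) (T k B) := (hPd _).hasFDerivAt
      exact (M k).hasFDerivAt.comp B (h1.comp B (T k).hasFDerivAt)

/-- Left translation extends to a linear map of the ambient space, so all the smoothness comes from
`p` and continuity of `f` suffices. -/
theorem IsSmooth.convolution {p : SU2 → ℝ} (hp : IsSmooth p) {f : SU2 → ℝ} (hf : Continuous f) :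
    IsSmooth fun g => ∫ h, p (h⁻¹ * g) * f h ∂haar := by
  obtain ⟨P, hP, hp⟩ := hp
  refine ⟨fun A => ∫ h, P ((leftMul h⁻¹).restrictScalars ℝ A) * f h ∂haar, ?_, fun g => ?_⟩
  · refine contDiff_infty.2 fun n => ?_
    have h := contDiff_integral_comp haar (fun h => (leftMul h⁻¹).restrictScalars ℝ)
      (by
        have := continuous_leftMul.comp (continuous_inv (G := SU2))
        exact (ContinuousLinearMap.continuous_restrictScalars ℝ).comp this)
      n ℝ ℝ P (hP.of_le (by exact_mod_cast le_top))
      (fun h => f h • ContinuousLinearMap.id ℝ ℝ) (by fun_prop)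
    simpa [mul_comm] using h
  · refine integral_congr_ae (Eventually.of_forall fun h => ?_)
    simp only [hp]
    congr 2
    exact (leftMul_emb h⁻¹ g).symm

theorem fieldAlong_convolution (hd : IsDirection γ R) {p : SU2 → ℝ} (hp : IsSmooth p)
    {f : SU2 → ℝ} (hf : Continuous f) (g : SU2) :
    fieldAlong γ (fun g => ∫ h, p (h⁻¹ * g) * f h ∂haar) g =
      ∫ h, fieldAlong γ p (h⁻¹ * g) * f h ∂haar := by
  obtain ⟨hs, hder⟩ := hp.fieldAlong hd
  have hpc := hp.continuous
  have hsc := hs.continuous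
  have hγ := hd.continuous
  obtain ⟨C, hC⟩ := isCompact_univ.exists_bound_of_continuousOn hsc.continuousOn
  have m1 : ∀ s, Continuous fun h => p (h⁻¹ * (g * γ s)) * f h := fun s =>
    (hpc.comp (continuous_inv.mul continuous_const)).mul hf
  have m2 : ∀ s, Continuous fun h => fieldAlong γ p (h⁻¹ * (g * γ s)) * f h := fun s =>
    (hsc.comp (continuous_inv.mul continuous_const)).mul hf
  have hb : ∀ h, ∀ s : ℝ, ‖fieldAlong γ p (h⁻¹ * (g * γ s)) * f h‖ ≤ C * ‖f h‖ := fun h s => by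
    rw [norm_mul]
    exact mul_le_mul_of_nonneg_right (hC _ trivial) (norm_nonneg _)
  have hdiff : ∀ h, ∀ s : ℝ, HasDerivAt (fun s => p (h⁻¹ * (g * γ s)) * f h)
      (fieldAlong γ p (h⁻¹ * (g * γ s)) * f h) s := fun h s => by
    have := (hder (h⁻¹ * g) s).mul_const (f h)
    simpa only [mul_assoc] using this
  have hbi : Integrable (fun h => C * ‖f h‖) haar :=
    integrable_of_continuous (continuous_const.mul hf.norm)
  have key := hasDerivAt_integral_of_dominated_loc_of_deriv_le (μ := haar) (x₀ := (0 : ℝ))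
    (F := fun s h => p (h⁻¹ * (g * γ s)) * f h)
    (F' := fun s h => fieldAlong γ p (h⁻¹ * (g * γ s)) * f h) (bound := fun h => C * ‖f h‖)
    univ_mem (Eventually.of_forall fun s => (m1 s).aestronglyMeasurable)
    (integrable_of_continuous (m1 0)) (m2 0).aestronglyMeasurable
    (Eventually.of_forall fun h s _ => hb h s) hbi (Eventually.of_forall fun h s _ => hdiff h s)
  have h2 := key.2.deriv
  rw [hd.apply_zero, mul_one] at h2
  exact h2

theorem sublaplacian_convolution {p : SU2 → ℝ} (hp : IsSmooth p)
    {f : SU2 → ℝ} (hf : Continuous f) (g : SU2) :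
    sublaplacian (fun g => ∫ h, p (h⁻¹ * g) * f h ∂haar) g =
      ∫ h, sublaplacian p (h⁻¹ * g) * f h ∂haar := by
  have hpX : IsSmooth (fieldAlong expX p) := hp.fieldX
  have hpY : IsSmooth (fieldAlong expY p) := hp.fieldY
  have h1 := (hpX.fieldAlong isDirection_expX).1.continuous
  have h2 := (hpY.fieldAlong isDirection_expY).1.continuous
  simp only [sublaplacian, fieldX_eq, fieldY_eq]
  rw [funext (fieldAlong_convolution isDirection_expX hp hf),
    funext (fieldAlong_convolution isDirection_expY hp hf),
    fieldAlong_convolution isDirection_expX hpX hf,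
    fieldAlong_convolution isDirection_expY hpY hf, ← integral_add]
  · simp only [add_mul]
  · exact integrable_of_continuous (by fun_prop)
  · exact integrable_of_continuous (by fun_prop)

/-! ### Integration by parts on the group. -/

theorem integral_fieldAlong (hd : IsDirection γ R) {f : SU2 → ℝ} (hf : IsSmooth f) :
    ∫ g, fieldAlong γ f g ∂haar = 0 := by
  have h := fieldAlong_convolution hd hf (continuous_const (y := (1 : ℝ))) 1
  simp only [mul_one] at h
  rw [integral_inv_eq_self (fieldAlong γ f) haar] at h
  rw [← h, fieldAlong]
  -- Convolution of `f` with the constant `1` does not move along `γ`, by right invariance.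
  have : (fun s => ∫ h, f (h⁻¹ * (1 * γ s)) ∂haar) = fun _ => ∫ h, f h ∂haar := by
    funext s
    rw [integral_inv_eq_self (fun h => f (h * (1 * γ s))) haar, integral_mul_right_eq_self]
  rw [this]; simp

theorem integral_mul_sublaplacian_self {f : SU2 → ℝ} (hf : IsSmooth f) :
    ∫ g, (fieldX f g ^ 2 + fieldY f g ^ 2) ∂haar = -∫ g, f g * sublaplacian f g ∂haar := by
  have c0 := hf.continuous
  have c1 := hf.fieldX.continuous
  have c2 := hf.fieldY.continuous
  have c3 := hf.sublaplacian.continuous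
  have h1 := integral_fieldAlong isDirection_expX (hf.mul hf.fieldX)
  have h2 := integral_fieldAlong isDirection_expY (hf.mul hf.fieldY)
  rw [fieldAlong_mul isDirection_expX hf hf.fieldX] at h1
  rw [fieldAlong_mul isDirection_expY hf hf.fieldY] at h2
  have i1 := integrable_of_continuous (((hf.fieldX.mul hf.fieldX).add
    (hf.mul hf.fieldX.fieldX)).continuous)
  have i2 := integrable_of_continuous (((hf.fieldY.mul hf.fieldY).add
    (hf.mul hf.fieldY.fieldY)).continuous)
  have h3 := integral_add i1 i2
  have e1 : ∫ g, (fieldX f g * fieldX f g + f g * fieldX (fieldX f) g) ∂haar = 0 := h1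
  have e2 : ∫ g, (fieldY f g * fieldY f g + f g * fieldY (fieldY f) g) ∂haar = 0 := h2
  rw [e1, e2, add_zero] at h3
  rw [eq_neg_iff_add_eq_zero, ← integral_add (integrable_of_continuous (by fun_prop))
    (integrable_of_continuous (by fun_prop)), ← h3]
  refine integral_congr_ae (Eventually.of_forall fun g => ?_)
  simp only [SubellipticSU2.sublaplacian]
  ring

end SubellipticSU2

namespace SubellipticSU2

/-! ### The maximum principle -/

/-- A positive second derivative at a maximum would make it a local minimum as well, so the function
would be locally constant along the curve and that derivative would vanish. -/
theorem fieldAlong_fieldAlong_nonpos {γ : ℝ → SU2} {R : Mat →L[ℂ] Mat} (hd : IsDirection γ R)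
    {f : SU2 → ℝ} (hf : IsSmooth f) {g : SU2} (hg : ∀ h, f h ≤ f g) :
    fieldAlong γ (fieldAlong γ f) g ≤ 0 := by
  set φ : ℝ → ℝ := fun s => f (g * γ s) with hφ
  have hφ0 : φ 0 = f g := by simp [hφ, hd.apply_zero]
  have h1 : deriv φ = fun s => fieldAlong γ f (g * γ s) :=
    funext fun s => ((hf.fieldAlong hd).2 g s).deriv
  have h2 : deriv (deriv φ) 0 = fieldAlong γ (fieldAlong γ f) g := by rw [h1]; rfl
  have hmax : IsLocalMax φ 0 := Eventually.of_forall fun s => by rw [hφ0]; exact hg _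
  by_contra! hpos
  rw [← h2] at hpos
  have hmin := isLocalMin_of_deriv_deriv_pos hpos hmax.deriv_eq_zero
    ((hf.fieldAlong hd).2 g 0).continuousAt
  have hconst : φ =ᶠ[𝓝 0] fun _ => φ 0 := by
    filter_upwards [hmax, hmin] with s h h' using le_antisymm h h'
  have := hconst.deriv.deriv_eq
  simp at this
  exact absurd this hpos.ne'

theorem sublaplacian_nonpos {f : SU2 → ℝ} (hf : IsSmooth f) {g : SU2} (hg : ∀ h, f h ≤ f g) :
    sublaplacian f g ≤ 0 :=
  add_nonpos (fieldAlong_fieldAlong_nonpos isDirection_expX hf hg)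
    (fieldAlong_fieldAlong_nonpos isDirection_expY hf hg)

theorem deriv_nonneg_of_left_max {w : ℝ → ℝ} {w' t : ℝ} (hw : HasDerivAt w w' t) (ht : 0 < t)
    (hmax : ∀ s, 0 ≤ s → s ≤ t → w s ≤ w t) : 0 ≤ w' := by
  have h := (hasDerivWithinAt_iff_tendsto_slope' (s := Set.Iio t) (by simp)).1
    hw.hasDerivWithinAt
  refine ge_of_tendsto h ?_
  filter_upwards [Ioo_mem_nhdsLT ht] with s hs
  rw [slope_def_field]
  exact div_nonneg_of_nonpos (sub_nonpos.2 (hmax s hs.1.le hs.2.le)) (sub_nonpos.2 hs.2.le)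

/-- Weak maximum principle. Subtracting `ε * s` makes the time derivative strictly negative wherever
`ℒ u ≤ 0`, so a maximum over `[0, t] × SU(2)` can only be attained at time zero. -/
theorem IsHeatSolution.le_of_le {f : SU2 → ℝ} {u : ℝ → SU2 → ℝ} (hu : IsHeatSolution f u) {M : ℝ}
    (h0 : ∀ g, f g ≤ M) {t : ℝ} (ht : 0 ≤ t) (g : SU2) : u t g ≤ M := by
  obtain ⟨hu0, hc, hs, hder⟩ := hu
  have key : ∀ ε > 0, u t g - ε * t ≤ M := by
    intro ε hε
    have hK : IsCompact (Set.Icc 0 t ×ˢ (Set.univ : Set SU2)) := isCompact_Icc.prod isCompact_univ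
    have hcw : ContinuousOn (fun q : ℝ × SU2 => u q.1 q.2 - ε * q.1)
        (Set.Icc 0 t ×ˢ Set.univ) :=
      (hc.mono (Set.prod_mono Set.Icc_subset_Ici_self subset_rfl)).sub (by fun_prop)
    obtain ⟨⟨t₀, g₀⟩, ⟨ht₀, -⟩, hmax⟩ := hK.exists_isMaxOn ⟨(0, g), ⟨le_rfl, ht⟩, trivial⟩ hcw
    have hmax : ∀ s ∈ Set.Icc 0 t, ∀ h, u s h - ε * s ≤ u t₀ g₀ - ε * t₀ :=
      fun s hs h => hmax (show (s, h) ∈ Set.Icc 0 t ×ˢ (Set.univ : Set SU2) from ⟨hs, trivial⟩)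
    refine (hmax t ⟨ht, le_rfl⟩ g).trans ?_
    rcases ht₀.1.eq_or_lt with h | hpos
    · subst h; simpa [hu0] using h0 g₀
    exfalso
    have h1 : sublaplacian (u t₀) g₀ ≤ 0 := sublaplacian_nonpos (hs t₀ hpos) fun h => by
      have := hmax t₀ ht₀ h; linarith
    have h2 : HasDerivAt (fun s => u s g₀ - ε * s) (sublaplacian (u t₀) g₀ - ε * 1) t₀ :=
      (hder t₀ hpos g₀).sub ((hasDerivAt_id t₀).const_mul ε)
    have h3 := deriv_nonneg_of_left_max h2 hpos fun s hs hst => hmax s ⟨hs, hst.trans ht₀.2⟩ g₀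
    linarith
  by_contra! hlt
  -- With this `ε` the correction `ε * t` is at most half the supposed excess, including when `t =
  -- 0`.
  have := key ((u t g - M) / (2 * (t + 1))) (by apply div_pos <;> linarith)
  have h2 : (u t g - M) / (2 * (t + 1)) * t ≤ (u t g - M) / 2 := by
    rw [div_mul_eq_mul_div, div_le_div_iff₀ (by linarith) two_pos]
    nlinarith
  linarith

theorem IsHeatSolution.neg {f : SU2 → ℝ} {u : ℝ → SU2 → ℝ} (hu : IsHeatSolution f u) :
    IsHeatSolution (fun g => -f g) (fun t g => -u t g) := by
  obtain ⟨hu0, hc, hs, hder⟩ := hu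
  refine ⟨by simp only [hu0], hc.neg, fun t ht => (hs t ht).neg, fun t ht g => ?_⟩
  have := sublaplacian_const_mul (hs t ht) (-1) g
  simp only [neg_mul, one_mul] at this
  rw [this]
  exact (hder t ht g).neg

theorem IsHeatSolution.abs_le {f : SU2 → ℝ} {u : ℝ → SU2 → ℝ} (hu : IsHeatSolution f u) {M : ℝ}
    (h0 : ∀ g, |f g| ≤ M) {t : ℝ} (ht : 0 ≤ t) (g : SU2) : |u t g| ≤ M := by
  have h1 := hu.le_of_le (fun g => (_root_.abs_le.1 (h0 g)).2) ht g
  have h2 := hu.neg.le_of_le (M := M) (fun g => by linarith [(_root_.abs_le.1 (h0 g)).1]) ht g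
  exact _root_.abs_le.2 ⟨by linarith, h1⟩

theorem IsHeatSolution.sub {f h : SU2 → ℝ} {u v : ℝ → SU2 → ℝ} (hu : IsHeatSolution f u)
    (hv : IsHeatSolution h v) : IsHeatSolution (fun g => f g - h g) (fun t g => u t g - v t g) := by
  refine ⟨by simp only [hu.1, hv.1], hu.2.1.sub hv.2.1,
    fun t ht => (hu.2.2.1 t ht).sub (hv.2.2.1 t ht), fun t ht g => ?_⟩
  rw [sublaplacian_sub (hu.2.2.1 t ht) (hv.2.2.1 t ht)]
  exact (hu.2.2.2 t ht g).sub (hv.2.2.2 t ht g)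

theorem IsHeatSolution.unique {f : SU2 → ℝ} {u v : ℝ → SU2 → ℝ} (hu : IsHeatSolution f u)
    (hv : IsHeatSolution f v) {t : ℝ} (ht : 0 ≤ t) : u t = v t := by
  funext g
  have := (hu.sub hv).abs_le (M := 0) (fun g => by simp) ht g
  exact sub_eq_zero.1 (abs_nonpos_iff.1 this)

/-! ### Series of holomorphic functions -/

/-- A family of functions that is normally summable near every point of `U`. -/
def LocallyNormallySummable {I E F : Type} [NormedAddCommGroup E] [NormedAddCommGroup F]
    (f : I → E → F) (U : Set E) : Prop :=
  ∀ x ∈ U, ∃ r > 0, ∃ B : I → ℝ, Summable B ∧ ∀ i, ∀ y ∈ Metric.ball x r, ‖f i y‖ ≤ B i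

/-- Cauchy's estimate on the complex line `z ↦ x + z • v`, over the circle of radius `r / ‖v‖`. -/
theorem norm_fderiv_le_of_ball {E F : Type} [NormedAddCommGroup E] [NormedSpace ℂ E]
    [NormedAddCommGroup F] [NormedSpace ℂ F] {f : E → F} (hf : Differentiable ℂ f)
    {x : E} {r C : ℝ} (hr : 0 < r) (hC : ∀ y ∈ Metric.ball x (2 * r), ‖f y‖ ≤ C) :
    ‖fderiv ℂ f x‖ ≤ C / r := by
  have hC0 : 0 ≤ C := (norm_nonneg _).trans (hC x (Metric.mem_ball_self (by linarith)))
  refine ContinuousLinearMap.opNorm_le_bound _ (div_nonneg hC0 hr.le) fun v => ?_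
  rcases eq_or_ne v 0 with rfl | hv
  · simp
  have hv0 : 0 < ‖v‖ := norm_pos_iff.2 hv
  have hl : ∀ z : ℂ, HasDerivAt (fun z : ℂ => x + z • v) v z := fun z => by
    simpa using ((hasDerivAt_id z).smul_const v).const_add x
  have hφ : ∀ z : ℂ, HasDerivAt (fun z : ℂ => f (x + z • v)) (fderiv ℂ f (x + z • v) v) z :=
    fun z => (hf _).hasFDerivAt.comp_hasDerivAt z (hl z)
  have h := Complex.norm_deriv_le_of_forall_mem_sphere_norm_le (c := 0) (R := r / ‖v‖) (C := C)
    (f := fun z : ℂ => f (x + z • v)) (by positivity)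
    (Differentiable.diffContOnCl fun z => (hφ z).differentiableAt) fun z hz => hC _ ?_
  · rw [(hφ 0).deriv] at h
    simpa [div_div_eq_mul_div, div_mul_eq_mul_div] using h
  · have hz : ‖z‖ = r / ‖v‖ := by simpa using hz
    rw [Metric.mem_ball, dist_eq_norm, add_sub_cancel_left, norm_smul, hz,
      div_mul_cancel₀ _ hv0.ne']
    linarith

theorem LocallyNormallySummable.fderiv {I E F : Type} [NormedAddCommGroup E] [NormedSpace ℂ E]
    [NormedAddCommGroup F] [NormedSpace ℂ F] {f : I → E → F} {U : Set E}
    (h : LocallyNormallySummable f U) (hf : ∀ i, Differentiable ℂ (f i)) :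
    LocallyNormallySummable (fun i => fderiv ℂ (f i)) U := by
  intro x hx
  obtain ⟨r, hr, B, hB, hfB⟩ := h x hx
  -- For `y` in the ball of radius `r / 2` about `x`, the ball of radius `2 * (r / 4)` about `y`
  -- stays in the original ball.
  refine ⟨r / 2, by positivity, fun i => B i / (r / 4), hB.div_const _, fun i y hy => ?_⟩
  refine norm_fderiv_le_of_ball (hf i) (by positivity) fun z hz => hfB i z ?_
  rw [Metric.mem_ball] at *
  have := dist_triangle z y x
  linarith

theorem LocallyNormallySummable.summable {I E F : Type} [NormedAddCommGroup E]
    [NormedAddCommGroup F] [CompleteSpace F] {f : I → E → F} {U : Set E}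
    (h : LocallyNormallySummable f U) {x : E} (hx : x ∈ U) : Summable fun i => f i x := by
  obtain ⟨r, hr, B, hB, hfB⟩ := h x hx
  exact Summable.of_norm_bounded hB fun i => hfB i x (Metric.mem_ball_self hr)

theorem LocallyNormallySummable.hasFDerivAt {I E F : Type} [NormedAddCommGroup E]
    [NormedSpace ℂ E] [NormedAddCommGroup F] [NormedSpace ℂ F] [CompleteSpace F]
    {f : I → E → F} {U : Set E} (h : LocallyNormallySummable f U)
    (hf : ∀ i, Differentiable ℂ (f i)) {x : E} (hx : x ∈ U) :
    HasFDerivAt (fun y => ∑' i, f i y) (∑' i, _root_.fderiv ℂ (f i) x) x := by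
  obtain ⟨r, hr, B, hB, hfB⟩ := h.fderiv hf x hx
  have : NormedSpace ℝ E := NormedSpace.restrictScalars ℝ ℂ E
  exact hasFDerivAt_tsum_of_isPreconnected hB Metric.isOpen_ball
    (convex_ball x r).isPreconnected (fun i y _ => (hf i y).hasFDerivAt) hfB
    (Metric.mem_ball_self hr) (h.summable hx) (Metric.mem_ball_self hr)

/-- Normal summability passes to the derivatives, so one termwise differentiation can be iterated;
the target space `F` changes at each stage of the induction. -/
theorem LocallyNormallySummable.contDiffOn {I E : Type} [NormedAddCommGroup E]
    [NormedSpace ℂ E] {U : Set E} (hU : IsOpen U) (n : ℕ) :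
    ∀ (F : Type) [NormedAddCommGroup F] [NormedSpace ℂ F] [CompleteSpace F] (f : I → E → F)
      (_ : LocallyNormallySummable f U) (_ : ∀ i, ContDiff ℂ (⊤ : ℕ∞) (f i)),
      ContDiffOn ℂ n (fun y => ∑' i, f i y) U := by
  induction n with
  | zero =>
    intro F _ _ _ f h hf
    exact contDiffOn_zero.2 fun x hx =>
      (h.hasFDerivAt (fun i => (hf i).differentiable (by simp)) hx).continuousAt.continuousWithinAt
  | succ n ih =>
    intro F _ _ _ f h hf
    have hd : ∀ i, Differentiable ℂ (f i) := fun i => (hf i).differentiable (by simp)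
    push_cast
    refine (contDiffOn_succ_iff_fderiv_of_isOpen hU).2 ⟨fun x hx =>
      (h.hasFDerivAt hd hx).differentiableAt.differentiableWithinAt, by simp, ?_⟩
    refine (ih _ (fun i => _root_.fderiv ℂ (f i)) (h.fderiv hd)
      fun i => (hf i).fderiv_right (by simp)).congr fun x hx => ?_
    exact (h.hasFDerivAt hd hx).fderiv

end SubellipticSU2

namespace SubellipticSU2

/-! ### Holomorphic extensions of functions on `SU(2)` -/

/-- The derivative of a function of matrices along the linear field `R`. -/
noncomputable def lieDeriv (R : Mat →L[ℂ] Mat) (F : Mat → ℂ) (A : Mat) : ℂ := fderiv ℂ F A (R A)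

/-- The holomorphic extension of the sublaplacian. -/
noncomputable def complexLaplacian (F : Mat → ℂ) (A : Mat) : ℂ :=
  lieDeriv rightX (lieDeriv rightX F) A + lieDeriv rightY (lieDeriv rightY F) A

/-- The matrices whose transpose is a contraction of the Hermitian space `ℂ²`, up to the
factor `M`. -/
def RowBound (M : ℝ) (A : Mat) : Prop :=
  ∀ x y : ℂ, ‖x * A 0 0 + y * A 1 0‖ ^ 2 + ‖x * A 0 1 + y * A 1 1‖ ^ 2 ≤
    M ^ 2 * (‖x‖ ^ 2 + ‖y‖ ^ 2)

/-- The matrix with rows `(α, β)`, `(-β̄, ᾱ)` is a scalar multiple of a unitary matrix. -/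
theorem norm_row_quaternion (x y α β : ℂ) :
    ‖x * α + y * -star β‖ ^ 2 + ‖x * β + y * star α‖ ^ 2 =
      (‖α‖ ^ 2 + ‖β‖ ^ 2) * (‖x‖ ^ 2 + ‖y‖ ^ 2) := by
  simp only [← Complex.normSq_eq_norm_sq, Complex.normSq_apply, Complex.add_re, Complex.add_im,
    Complex.mul_re, Complex.mul_im, Complex.neg_re, Complex.neg_im, Complex.star_def,
    Complex.conj_re, Complex.conj_im]
  ring

theorem rowBound_emb (g : SU2) : RowBound 1 (emb g) := by
  intro x y
  have h := normSq_emb_row g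
  rw [emb_one_one, emb_one_zero, norm_row_quaternion, ← Complex.normSq_eq_norm_sq,
    ← Complex.normSq_eq_norm_sq (emb g 0 1), h]
  simp

theorem RowBound.of_dist_lt {A B : Mat} {r : ℝ} (hB : RowBound 1 B) (hr : dist A B < r) :
    RowBound (1 + 2 * r) A := by
  intro x y
  have hr0 : 0 < r := dist_nonneg.trans_lt hr
  have hd : ∀ i j, ‖A i j - B i j‖ ≤ r := fun i j => by
    rw [dist_eq_norm] at hr
    exact ((norm_le_pi_norm ((A - B) i) j).trans (norm_le_pi_norm (A - B) i)).trans hr.le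
  set σ := √(‖x‖ ^ 2 + ‖y‖ ^ 2) with hσ
  have hσ2 : σ ^ 2 = ‖x‖ ^ 2 + ‖y‖ ^ 2 := Real.sq_sqrt (by positivity)
  have hσ0 : 0 ≤ σ := Real.sqrt_nonneg _
  have hxy : (‖x‖ + ‖y‖) ≤ √2 * σ := by
    rw [hσ, ← Real.sqrt_mul (by norm_num)]
    exact Real.le_sqrt_of_sq_le (by nlinarith [sq_nonneg (‖x‖ - ‖y‖)])
  have hs2 : √2 ^ 2 = 2 := Real.sq_sqrt (by norm_num)
  -- By Cauchy-Schwarz each column moves by at most `√2 r σ`; the two columns together move by at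
  -- most `2 r σ`.
  have step : ∀ j, ‖x * A 0 j + y * A 1 j‖ ≤ ‖x * B 0 j + y * B 1 j‖ + r * (√2 * σ) := by
    intro j
    have e : x * A 0 j + y * A 1 j = (x * B 0 j + y * B 1 j) +
        (x * (A 0 j - B 0 j) + y * (A 1 j - B 1 j)) := by ring
    rw [e]
    refine (norm_add_le _ _).trans (add_le_add le_rfl ?_)
    refine (norm_add_le _ _).trans ?_
    rw [norm_mul, norm_mul]
    have h1 := mul_le_mul_of_nonneg_left (hd 0 j) (norm_nonneg x)
    have h2 := mul_le_mul_of_nonneg_left (hd 1 j) (norm_nonneg y)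
    have h3 := mul_le_mul_of_nonneg_left hxy hr0.le
    nlinarith
  have hb := hB x y
  rw [one_pow, one_mul, ← hσ2] at hb
  rw [← hσ2]
  set P := ‖x * B 0 0 + y * B 1 0‖
  set Q := ‖x * B 0 1 + y * B 1 1‖
  have hP : 0 ≤ P := norm_nonneg _
  have hQ : 0 ≤ Q := norm_nonneg _
  have hPQ : P + Q ≤ √2 * σ := abs_le_of_sq_le_sq' (by
    rw [mul_pow, hs2]; nlinarith [sq_nonneg (P - Q)]) (by positivity) |>.2
  have h0 := pow_le_pow_left₀ (norm_nonneg _) (step 0) 2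
  have h1 := pow_le_pow_left₀ (norm_nonneg _) (step 1) 2
  have h2 : r * (√2 * σ) * (P + Q) ≤ r * (√2 * σ) * (√2 * σ) :=
    mul_le_mul_of_nonneg_left hPQ (by positivity)
  have h3 : r * (√2 * σ) * (√2 * σ) = 2 * r * σ ^ 2 := by
    calc _ = r * (√2 ^ 2) * σ ^ 2 := by ring
      _ = _ := by rw [hs2]; ring
  have h4 : (r * (√2 * σ)) ^ 2 = 2 * r ^ 2 * σ ^ 2 := by
    calc _ = r ^ 2 * (√2 ^ 2) * σ ^ 2 := by ring
      _ = _ := by rw [hs2]; ring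
  nlinarith

/-- The neighbourhood of width `r` of the contractions. -/
def contractionNhd (r : ℝ) : Set Mat := Metric.thickening r {A | RowBound 1 A}

theorem isOpen_contractionNhd (r : ℝ) : IsOpen (contractionNhd r) := Metric.isOpen_thickening

theorem mem_contractionNhd {r : ℝ} (hr : 0 < r) {A : Mat} (hA : RowBound 1 A) :
    A ∈ contractionNhd r := Metric.self_subset_thickening hr _ hA

theorem RowBound.of_mem {r : ℝ} {A : Mat} (hA : A ∈ contractionNhd r) :
    RowBound (1 + 2 * r) A := by
  obtain ⟨B, hB, h⟩ := Metric.mem_thickening_iff.1 hA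
  exact RowBound.of_dist_lt hB h

/-- A smooth map from the ambient space to the contractions that fixes `SU(2)`. -/
noncomputable def contract (A : Mat) : Mat :=
  let κ : ℝ := 2 / (1 + (Complex.normSq (A 0 0) + Complex.normSq (A 0 1)))
  ![![κ * A 0 0, κ * A 0 1], ![-star (κ * A 0 1), star (κ * A 0 0)]]

theorem contract_emb (g : SU2) : contract (emb g) = emb g := by
  have h : (2 / (1 + (Complex.normSq (emb g 0 0) + Complex.normSq (emb g 0 1))) : ℝ) = 1 := by
    rw [normSq_emb_row]; norm_num
  ext i j
  fin_cases i <;> fin_cases j <;> simp [contract, h, emb_one_one, emb_one_zero]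

/-- With `N` the squared length of the first row, the squared length after scaling is `4 N / (1 + N)
^ 2`, which is at most `1` because `(N - 1) ^ 2 ≥ 0`. -/
theorem rowBound_contract (A : Mat) : RowBound 1 (contract A) := by
  intro x y
  have h := norm_row_quaternion x y (contract A 0 0) (contract A 0 1)
  have e0 : contract A 1 0 = -star (contract A 0 1) := rfl
  have e1 : contract A 1 1 = star (contract A 0 0) := rfl
  rw [e0, e1, h, one_pow]
  refine mul_le_mul_of_nonneg_right ?_ (by positivity)
  set N := Complex.normSq (A 0 0) + Complex.normSq (A 0 1) with hN
  have hN0 : 0 ≤ N := add_nonneg (Complex.normSq_nonneg _) (Complex.normSq_nonneg _)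
  have e2 : contract A 0 0 = ((2 / (1 + N) : ℝ) : ℂ) * A 0 0 := rfl
  have e3 : contract A 0 1 = ((2 / (1 + N) : ℝ) : ℂ) * A 0 1 := rfl
  rw [e2, e3, norm_mul, norm_mul, Complex.norm_real, mul_pow, mul_pow, ← mul_add,
    ← Complex.normSq_eq_norm_sq, ← Complex.normSq_eq_norm_sq, ← hN, Real.norm_eq_abs, sq_abs,
    div_pow, div_mul_eq_mul_div, div_le_one (by positivity)]
  nlinarith [sq_nonneg (N - 1)]

theorem contDiff_contract : ContDiff ℝ (⊤ : ℕ∞) contract := by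
  have hap : ∀ i j, ContDiff ℝ (⊤ : ℕ∞) fun A : Mat => A i j := fun i j =>
    contDiff_apply_apply ℝ ℂ i j
  have hn : ∀ j, ContDiff ℝ (⊤ : ℕ∞) fun A : Mat => Complex.normSq (A 0 j) := fun j => by
    simp only [Complex.normSq_eq_norm_sq]
    exact (hap 0 j).norm_sq ℝ
  have hκ : ContDiff ℝ (⊤ : ℕ∞) fun A : Mat =>
      (((2 / (1 + (Complex.normSq (A 0 0) + Complex.normSq (A 0 1))) : ℝ)) : ℂ) := by
    refine Complex.ofRealCLM.contDiff.comp (ContDiff.div contDiff_const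
      (contDiff_const.add ((hn 0).add (hn 1))) fun A => ?_)
    have h0 := Complex.normSq_nonneg (A 0 0)
    have h1 := Complex.normSq_nonneg (A 0 1)
    positivity
  have hs : ∀ {F : Mat → ℂ}, ContDiff ℝ (⊤ : ℕ∞) F → ContDiff ℝ (⊤ : ℕ∞) fun A => star (F A) :=
    fun hF => (Complex.conjCLE.contDiff (n := (⊤ : ℕ∞))).comp hF
  refine contDiff_pi.2 fun i => contDiff_pi.2 fun j => ?_
  fin_cases i <;> fin_cases j
  · exact hκ.mul (hap 0 0)
  · exact hκ.mul (hap 0 1)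
  · exact (hs (hκ.mul (hap 0 1))).neg
  · exact hs (hκ.mul (hap 0 0))

/-- `IsSmooth` asks for an extension to the whole ambient space, but the holomorphic series are
controlled only near the contractions. Composition with `contract` supplies the extension without
changing values on the group. -/
theorem isSmooth_re {r : ℝ} (hr : 0 < r) {G : Mat → ℂ}
    (hG : ∀ n : ℕ, ContDiffOn ℂ n G (contractionNhd r)) : IsSmooth fun g => (G (emb g)).re := by
  refine ⟨fun A => (G (contract A)).re, contDiff_infty.2 fun n => ?_, fun g => ?_⟩
  · refine Complex.reCLM.contDiff.comp ?_
    exact ((hG n).restrict_scalars ℝ).comp_contDiff (contDiff_contract.of_le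
      (by exact_mod_cast le_top)) fun A => mem_contractionNhd hr (rowBound_contract A)
  · have : contract (fun i j => (g : Matrix (Fin 2) (Fin 2) ℂ) i j) = emb g := contract_emb g
    simp only [this]

theorem fieldAlong_re {γ : ℝ → SU2} {R : Mat →L[ℂ] Mat} (hd : IsDirection γ R) {G : Mat → ℂ}
    {g : SU2} (hG : DifferentiableAt ℂ G (emb g)) :
    fieldAlong γ (fun g => (G (emb g)).re) g = (lieDeriv R G (emb g)).re := by
  have h1 : HasFDerivAt (fun A => (G A).re)
      (Complex.reCLM.comp ((fderiv ℂ G (emb g)).restrictScalars ℝ)) (emb (g * γ 0)) := by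
    rw [hd.apply_zero, mul_one]
    exact Complex.reCLM.hasFDerivAt.comp _ (hG.hasFDerivAt.restrictScalars ℝ)
  have := (hd.hasDerivAt_comp h1).deriv
  rw [hd.apply_zero, mul_one] at this
  exact this

theorem contDiffOn_lieDeriv {r : ℝ} {G : Mat → ℂ}
    (hG : ∀ n : ℕ, ContDiffOn ℂ n G (contractionNhd r)) (R : Mat →L[ℂ] Mat) (n : ℕ) :
    ContDiffOn ℂ n (lieDeriv R G) (contractionNhd r) := by
  have h := (hG (n + 1))
  push_cast at h
  have := ((contDiffOn_succ_iff_fderiv_of_isOpen (isOpen_contractionNhd r)).1 h).2.2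
  exact this.clm_apply R.contDiff.contDiffOn

theorem sublaplacian_re {r : ℝ} (hr : 0 < r) {G : Mat → ℂ}
    (hG : ∀ n : ℕ, ContDiffOn ℂ n G (contractionNhd r)) (g : SU2) :
    sublaplacian (fun g => (G (emb g)).re) g = (complexLaplacian G (emb g)).re := by
  have hdiff : ∀ {F : Mat → ℂ}, (∀ n : ℕ, ContDiffOn ℂ n F (contractionNhd r)) → ∀ g,
      DifferentiableAt ℂ F (emb g) := fun hF g =>
    ((hF 1).differentiableOn (by simp)).differentiableAt
      ((isOpen_contractionNhd r).mem_nhds (mem_contractionNhd hr (rowBound_emb g)))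
  have hX : fieldAlong expX (fun g => (G (emb g)).re) = fun g => (lieDeriv rightX G (emb g)).re :=
    funext fun g => fieldAlong_re isDirection_expX (hdiff hG g)
  have hY : fieldAlong expY (fun g => (G (emb g)).re) = fun g => (lieDeriv rightY G (emb g)).re :=
    funext fun g => fieldAlong_re isDirection_expY (hdiff hG g)
  rw [sublaplacian, fieldX_eq, fieldY_eq, hX, hY,
    fieldAlong_re isDirection_expX (hdiff (contDiffOn_lieDeriv hG _) g),
    fieldAlong_re isDirection_expY (hdiff (contDiffOn_lieDeriv hG _) g)]
  simp [complexLaplacian]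

/-! ### Eigenfunctions -/

/-- A linear form in a column of a matrix. -/
noncomputable def columnForm (x y : ℂ) (j : Fin 2) : Mat →L[ℂ] ℂ :=
  LinearMap.toContinuousLinearMap
    { toFun := fun A => x * A 0 j + y * A 1 j
      map_add' := fun A B => by simp only [Pi.add_apply]; ring
      map_smul' := fun c A => by
        simp only [Pi.smul_apply, smul_eq_mul, RingHom.id_apply]; ring }

theorem columnForm_apply (x y : ℂ) (j : Fin 2) (A : Mat) :
    columnForm x y j A = x * A 0 j + y * A 1 j := rfl

/-- The function `(x a + y c) ^ p (x b + y d) ^ s` of the matrix with rows `(a, b)`, `(c, d)`. -/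
noncomputable def wave (x y : ℂ) (p s : ℕ) (A : Mat) : ℂ :=
  columnForm x y 0 A ^ p * columnForm x y 1 A ^ s

/-- The eigenvalues of `-ℒ`. -/
def eigenvalue (i : ℕ × ℕ) : ℝ := 2 * (i.1 + i.2) + 4 * (i.1 * i.2)

theorem contDiff_wave (x y : ℂ) (p s : ℕ) : ContDiff ℂ (⊤ : ℕ∞) (wave x y p s) :=
  ((columnForm x y 0).contDiff.pow p).mul ((columnForm x y 1).contDiff.pow s)

theorem lieDeriv_wave (R : Mat →L[ℂ] Mat) (x y : ℂ) (p s : ℕ) (A : Mat) :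
    lieDeriv R (wave x y p s) A =
      p * columnForm x y 0 A ^ (p - 1) * columnForm x y 0 (R A) * columnForm x y 1 A ^ s +
      s * columnForm x y 0 A ^ p * columnForm x y 1 A ^ (s - 1) * columnForm x y 1 (R A) := by
  have h := (((columnForm x y 0).hasFDerivAt (x := A)).pow p).mul
    (((columnForm x y 1).hasFDerivAt (x := A)).pow s)
  have e := congrArg (fun L : Mat →L[ℂ] ℂ => L (R A)) h.fderiv
  refine Eq.trans e ?_
  simp
  ring

theorem lieDeriv_add {F G : Mat → ℂ} (hF : Differentiable ℂ F) (hG : Differentiable ℂ G)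
    (R : Mat →L[ℂ] Mat) : lieDeriv R (fun A => F A + G A) = fun A => lieDeriv R F A + lieDeriv R G A := by
  funext A
  simp only [lieDeriv]
  rw [fderiv_fun_add (hF A) (hG A)]; rfl

theorem lieDeriv_const_mul {F : Mat → ℂ} (hF : Differentiable ℂ F) (c : ℂ)
    (R : Mat →L[ℂ] Mat) : lieDeriv R (fun A => c * F A) = fun A => c * lieDeriv R F A := by
  funext A
  simp only [lieDeriv]
  rw [fderiv_const_mul (hF A)]; rfl

theorem contDiff_lieDeriv {F : Mat → ℂ} (hF : ContDiff ℂ (⊤ : ℕ∞) F) (R : Mat →L[ℂ] Mat) :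
    ContDiff ℂ (⊤ : ℕ∞) (lieDeriv R F) := 
  (hF.fderiv_right (m := (⊤ : ℕ∞)) (by simp)).clm_apply R.contDiff

/-- The field sends the two column forms `(u, v)` to `(-v, u)`, so it shifts the exponents by one
unit each way. The truncated `p - 1` and `s - 1` are harmless, since the factors `p` and `s` vanish
there. -/
theorem lieDeriv_rightX_wave (x y : ℂ) (p s : ℕ) :
    lieDeriv rightX (wave x y p s) = fun A =>
      -p * wave x y (p - 1) (s + 1) A + s * wave x y (p + 1) (s - 1) A := by
  funext A
  have h0 : columnForm x y 0 (rightX A) = -columnForm x y 1 A := by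
    simp [columnForm_apply]; ring
  have h1 : columnForm x y 1 (rightX A) = columnForm x y 0 A := by
    simp [columnForm_apply]
  rw [lieDeriv_wave, h0, h1, wave, wave]
  ring

theorem lieDeriv_rightY_wave (x y : ℂ) (p s : ℕ) :
    lieDeriv rightY (wave x y p s) = fun A =>
      (Complex.I * p) * wave x y (p - 1) (s + 1) A +
        (Complex.I * s) * wave x y (p + 1) (s - 1) A := by
  funext A
  have h0 : columnForm x y 0 (rightY A) = Complex.I * columnForm x y 1 A := by
    simp [columnForm_apply]; ring
  have h1 : columnForm x y 1 (rightY A) = Complex.I * columnForm x y 0 A := by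
    simp [columnForm_apply]; ring
  rw [lieDeriv_wave, h0, h1, wave, wave]
  ring

/-- `F` is the restriction of an entire eigenfunction of the sublaplacian, with
eigenvalue `-c`. -/
def IsEigenfunction (c : ℝ) (F : Mat → ℂ) : Prop :=
  ContDiff ℂ (⊤ : ℕ∞) F ∧ ∀ A, complexLaplacian F A = -c * F A

/-- In `X² + Y²` the terms that shift the exponents by two cancel, as `I² = -1`. The diagonal terms
of both squares agree and add up to `-2 (p (s + 1) + s (p + 1))`. -/
theorem isEigenfunction_wave (x y : ℂ) (p s : ℕ) :
    IsEigenfunction (eigenvalue (p, s)) (wave x y p s) := by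
  refine ⟨contDiff_wave x y p s, fun A => ?_⟩
  have hd : ∀ p s, Differentiable ℂ (wave x y p s) := fun p s =>
    (contDiff_wave x y p s).differentiable (by simp)
  have hm : ∀ p s (c : ℂ), Differentiable ℂ fun A => c * wave x y p s A := fun p s c =>
    (hd p s).const_mul c
  rw [complexLaplacian, lieDeriv_rightX_wave, lieDeriv_rightY_wave,
    lieDeriv_add (hm _ _ _) (hm _ _ _), lieDeriv_add (hm _ _ _) (hm _ _ _)]
  simp only [lieDeriv_const_mul (hd _ _), lieDeriv_rightX_wave, lieDeriv_rightY_wave]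
  have hI := Complex.I_sq
  rcases p with _ | p <;> rcases s with _ | s <;>
    simp only [eigenvalue, Nat.add_sub_cancel] <;> push_cast <;> ring_nf <;> rw [hI] <;> ring

theorem IsEigenfunction.add {c : ℝ} {F G : Mat → ℂ} (hF : IsEigenfunction c F)
    (hG : IsEigenfunction c G) : IsEigenfunction c fun A => F A + G A := by
  refine ⟨hF.1.add hG.1, fun A => ?_⟩
  have hd : ∀ {F : Mat → ℂ}, ContDiff ℂ (⊤ : ℕ∞) F → Differentiable ℂ F := fun h =>
    h.differentiable (by simp)
  have h1 := hF.2 A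
  have h2 := hG.2 A
  rw [complexLaplacian] at *
  rw [lieDeriv_add (hd hF.1) (hd hG.1), lieDeriv_add (hd hF.1) (hd hG.1),
    lieDeriv_add (hd (contDiff_lieDeriv hF.1 _)) (hd (contDiff_lieDeriv hG.1 _)),
    lieDeriv_add (hd (contDiff_lieDeriv hF.1 _)) (hd (contDiff_lieDeriv hG.1 _))]
  linear_combination h1 + h2

theorem IsEigenfunction.const_mul {c : ℝ} {F : Mat → ℂ} (hF : IsEigenfunction c F) (a : ℂ) :
    IsEigenfunction c fun A => a * F A := by
  refine ⟨contDiff_const.mul hF.1, fun A => ?_⟩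
  have hd : ∀ {F : Mat → ℂ}, ContDiff ℂ (⊤ : ℕ∞) F → Differentiable ℂ F := fun h =>
    h.differentiable (by simp)
  have h1 := hF.2 A
  rw [complexLaplacian] at *
  rw [lieDeriv_const_mul (hd hF.1), lieDeriv_const_mul (hd hF.1),
    lieDeriv_const_mul (hd (contDiff_lieDeriv hF.1 _)),
    lieDeriv_const_mul (hd (contDiff_lieDeriv hF.1 _))]
  linear_combination a * h1

theorem isEigenfunction_zero (c : ℝ) : IsEigenfunction c fun _ => 0 := by
  have := (isEigenfunction_wave 0 0 0 0).const_mul 0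
  simp only [zero_mul] at this
  refine ⟨contDiff_const, fun A => ?_⟩
  rw [this.2 A]; simp

theorem IsEigenfunction.sum {c : ℝ} {ι : Type} (t : Finset ι) {F : ι → Mat → ℂ}
    (hF : ∀ i ∈ t, IsEigenfunction c (F i)) : IsEigenfunction c fun A => ∑ i ∈ t, F i A := by
  classical
  induction t using Finset.induction_on with
  | empty => simpa using isEigenfunction_zero c
  | insert i t hi ih =>
    simp only [Finset.sum_insert hi]
    exact (hF i (Finset.mem_insert_self i t)).add
      (ih fun j hj => hF j (Finset.mem_insert_of_mem hj))

end SubellipticSU2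

namespace SubellipticSU2

/-! ### Averages over roots of unity -/

/-- A primitive root of unity of order `N`. -/
noncomputable def rootOfUnity (N : ℕ) : ℂ := Complex.exp (2 * Real.pi * Complex.I / N)

theorem isPrimitiveRoot_rootOfUnity {N : ℕ} (hN : N ≠ 0) : IsPrimitiveRoot (rootOfUnity N) N :=
  Complex.isPrimitiveRoot_exp N hN

theorem norm_rootOfUnity {N : ℕ} (hN : N ≠ 0) : ‖rootOfUnity N‖ = 1 :=
  (isPrimitiveRoot_rootOfUnity hN).norm'_eq_one hN

/-- Orthogonality of characters of `ℤ/N`. The exponent `N - k` stands for `-k`; as `0 < N - k + e <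
2 N`, it is a multiple of `N` together with `e` only when `e = k`. -/
theorem sum_rootOfUnity_pow {N : ℕ} (k e : ℕ) (hk : k < N) (he : e < N) :
    ∑ l ∈ Finset.range N, (rootOfUnity N ^ l) ^ (N - k) * (rootOfUnity N ^ l) ^ e =
      if e = k then (N : ℂ) else 0 := by
  have hN : N ≠ 0 := by omega
  have hζ := isPrimitiveRoot_rootOfUnity hN
  have h1 : ∀ l, (rootOfUnity N ^ l) ^ (N - k) * (rootOfUnity N ^ l) ^ e =
      (rootOfUnity N ^ (N - k + e)) ^ l := fun l => by
    rw [← pow_add, ← pow_mul, ← pow_mul, mul_comm]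
  simp only [h1]
  split_ifs with h
  · subst h
    rw [Nat.sub_add_cancel he.le, hζ.pow_eq_one]; simp
  · have hne : rootOfUnity N ^ (N - k + e) ≠ 1 := fun hh => by
      have hd := (hζ.pow_eq_one_iff_dvd _).1 hh
      obtain ⟨c, hc⟩ := hd
      have : c < 2 := by
        by_contra hc2
        have : N * 2 ≤ N * c := Nat.mul_le_mul_left _ (by omega)
        omega
      interval_cases c <;> omega
    rw [geom_sum_eq hne, ← pow_mul, mul_comm, pow_mul, hζ.pow_eq_one]; simp

/-- Discrete Fourier extraction of the coefficient of `z ^ k` in `(z a + c) ^ p (z b + d) ^ s`,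
exact because the degree `p + s` is below `N`. -/
theorem sum_rootOfUnity_wave (a b c d : ℂ) {p s k N : ℕ} (hN : p + s < N) (hk : k < N) :
    ∑ l ∈ Finset.range N, (rootOfUnity N ^ l) ^ (N - k) *
      ((rootOfUnity N ^ l * a + c) ^ p * (rootOfUnity N ^ l * b + d) ^ s) =
      N * ∑ i ∈ Finset.range (p + 1), ∑ j ∈ Finset.range (s + 1), if i + j = k then
        (p.choose i * s.choose j : ℂ) * (a ^ i * c ^ (p - i) * (b ^ j * d ^ (s - j))) else 0 := by
  have h1 : ∀ z : ℂ, (z * a + c) ^ p * (z * b + d) ^ s =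
      ∑ i ∈ Finset.range (p + 1), ∑ j ∈ Finset.range (s + 1), z ^ (i + j) *
        ((p.choose i * s.choose j : ℂ) * (a ^ i * c ^ (p - i) * (b ^ j * d ^ (s - j)))) := by
    intro z
    rw [add_pow, add_pow, Finset.sum_mul_sum]
    refine Finset.sum_congr rfl fun i _ => Finset.sum_congr rfl fun j _ => ?_
    rw [mul_pow, mul_pow, pow_add]; ring
  simp only [h1, Finset.mul_sum]
  rw [Finset.sum_comm]
  refine Finset.sum_congr rfl fun i hi => ?_
  rw [Finset.sum_comm]
  refine Finset.sum_congr rfl fun j hj => ?_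
  rw [Finset.mem_range] at hi hj
  simp only [← mul_assoc, ← Finset.sum_mul]
  rw [sum_rootOfUnity_pow k (i + j) hk (by omega)]
  split_ifs <;> ring

/-! ### The diagonal matrix coefficients -/

/-- The diagonal matrix coefficient of weight `(p, s)` of the symmetric power of degree `p + s`. -/
noncomputable def diagCoeff (p s : ℕ) (A : Mat) : ℂ :=
  ∑ j ∈ Finset.range (p + s + 1), (p.choose j * s.choose j : ℂ) *
    (A 0 0 ^ (p - j) * A 1 1 ^ (s - j) * (A 0 1 * A 1 0) ^ j)

/-- The constraint forces `i = p - j`. The range in `diagCoeff` is longer than necessary, with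
vanishing binomials, so that exchanging `p` and `s` is later a termwise identity. -/
theorem sum_antidiagonal_eq_diagCoeff (A : Mat) (p s : ℕ) :
    (∑ i ∈ Finset.range (p + 1), ∑ j ∈ Finset.range (s + 1), if i + j = p then
      (p.choose i * s.choose j : ℂ) *
        (A 0 0 ^ i * A 1 0 ^ (p - i) * (A 0 1 ^ j * A 1 1 ^ (s - j))) else 0) =
      diagCoeff p s A := by
  rw [Finset.sum_comm, diagCoeff]
  have hsub : Finset.range (s + 1) ⊆ Finset.range (p + s + 1) :=
    Finset.range_subset_range.2 (by omega)
  refine Eq.trans (b := ∑ j ∈ Finset.range (s + 1), (p.choose j * s.choose j : ℂ) *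
    (A 0 0 ^ (p - j) * A 1 1 ^ (s - j) * (A 0 1 * A 1 0) ^ j)) ?_ (Finset.sum_subset hsub ?_)
  · refine Finset.sum_congr rfl fun j hj => ?_
    by_cases hjp : j ≤ p
    · rw [Finset.sum_eq_single (p - j)]
      · rw [if_pos (by omega), Nat.choose_symm hjp, Nat.sub_sub_self hjp, mul_pow]; ring
      · intro i hi hne
        rw [if_neg]; omega
      · intro h
        exact absurd (Finset.mem_range.2 (by omega)) h
    · rw [Nat.choose_eq_zero_of_lt (by omega : p < j)]
      simp only [Nat.cast_zero, zero_mul]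
      exact Finset.sum_eq_zero fun i _ => if_neg (by omega)
  · intro j _ hj
    rw [Finset.mem_range] at hj
    rw [Nat.choose_eq_zero_of_lt (by omega : s < j)]; simp

/-- The free scale `ρ` drops out of the coefficient except for the factor `ρ ^ p`; it is tuned in
`RowBound.norm_diagCoeff_le`. -/
theorem diagCoeff_mul_pow (A : Mat) (p s : ℕ) {N : ℕ} (hN : p + s < N) (ρ : ℂ) :
    ∑ l ∈ Finset.range N, (rootOfUnity N ^ l) ^ (N - p) *
      wave (rootOfUnity N ^ l * ρ) 1 p s A = N * (ρ ^ p * diagCoeff p s A) := by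
  have h := sum_rootOfUnity_wave (ρ * A 0 0) (ρ * A 0 1) (A 1 0) (A 1 1) hN (k := p) (by omega)
  rw [← sum_antidiagonal_eq_diagCoeff, Finset.mul_sum]
  refine (Finset.sum_congr rfl fun l _ => ?_).trans (h.trans (congrArg (fun z => (N : ℂ) * z)
    (Finset.sum_congr rfl fun i _ => ?_)))
  · simp only [wave, columnForm_apply, one_mul, mul_assoc]
  · rw [Finset.mul_sum]
    refine Finset.sum_congr rfl fun j _ => ?_
    split_ifs with hij
    · rw [← hij, mul_pow, mul_pow, pow_add]; ring
    · simp

theorem diagCoeff_eq_sum (p s : ℕ) : diagCoeff p s = fun A => ((p + s + 1 : ℕ) : ℂ)⁻¹ *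
    ∑ l ∈ Finset.range (p + s + 1), (rootOfUnity (p + s + 1) ^ l) ^ (p + s + 1 - p) *
      wave (rootOfUnity (p + s + 1) ^ l) 1 p s A := by
  funext A
  have h := diagCoeff_mul_pow A p s (Nat.lt_succ_self (p + s)) 1
  simp only [mul_one, one_pow, one_mul] at h
  rw [Nat.succ_eq_add_one] at h
  rw [h, inv_mul_cancel_left₀]
  exact Nat.cast_ne_zero.2 (by omega)

theorem isEigenfunction_diagCoeff (p s : ℕ) :
    IsEigenfunction (eigenvalue (p, s)) (diagCoeff p s) := by
  rw [diagCoeff_eq_sum]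
  exact (IsEigenfunction.sum _ fun l _ => (isEigenfunction_wave _ _ p s).const_mul _).const_mul _

theorem diagCoeff_zero_left (s : ℕ) (A : Mat) : diagCoeff 0 s A = A 1 1 ^ s := by
  rw [diagCoeff, Finset.sum_eq_single 0]
  · simp
  · intro j _ hj
    rw [Nat.choose_eq_zero_of_lt (Nat.pos_of_ne_zero hj)]; simp
  · simp

theorem diagCoeff_zero_right (p : ℕ) (A : Mat) : diagCoeff p 0 A = A 0 0 ^ p := by
  rw [diagCoeff, Finset.sum_eq_single 0]
  · simp
  · intro j _ hj
    rw [Nat.choose_eq_zero_of_lt (Nat.pos_of_ne_zero hj)]; simp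
  · simp

/-- Weighted arithmetic-geometric mean inequality for `X / p` and `Y / s`, with weights `p / (p +
s)` and `s / (p + s)`. -/
theorem pow_mul_pow_le_of_add_le {p s : ℕ} (hp : p ≠ 0) (hs : s ≠ 0) {X Y C : ℝ} (hX : 0 ≤ X)
    (hY : 0 ≤ Y) (h : X + Y ≤ C * ((p + s) / s)) :
    X ^ p * Y ^ s ≤ C ^ (p + s) * (p / s) ^ p := by
  have hp' : (0 : ℝ) < p := by positivity
  have hs' : (0 : ℝ) < s := by positivity
  have hn : (0 : ℝ) < p + s := by positivity
  have h1 := Real.geom_mean_le_arith_mean2_weighted (w₁ := p / (p + s)) (w₂ := s / (p + s))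
    (p₁ := X / p) (p₂ := Y / s) (by positivity) (by positivity) (by positivity) (by positivity)
    (by field_simp)
  have h2 : (p / (p + s) * (X / p) + s / (p + s) * (Y / s) : ℝ) ≤ C / s := by
    have : (p / (p + s) * (X / p) + s / (p + s) * (Y / s) : ℝ) = (X + Y) / (p + s) := by
      field_simp
    rw [this, div_le_iff₀ hn]
    calc X + Y ≤ C * ((p + s) / s) := h
      _ = _ := by ring
  have h3 := pow_le_pow_left₀ (by positivity) (h1.trans h2) (p + s)
  rw [mul_pow, ← Real.rpow_mul_natCast (by positivity), ← Real.rpow_mul_natCast (by positivity)]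
    at h3
  push_cast at h3
  rw [div_mul_cancel₀ _ hn.ne', div_mul_cancel₀ _ hn.ne', Real.rpow_natCast, Real.rpow_natCast,
    div_pow, div_pow, div_pow] at h3
  have h4 : X ^ p * Y ^ s = (X ^ p / (p : ℝ) ^ p * (Y ^ s / (s : ℝ) ^ s)) *
      ((p : ℝ) ^ p * (s : ℝ) ^ s) := by
    field_simp
  rw [h4]
  refine (mul_le_mul_of_nonneg_right h3 (by positivity)).trans (le_of_eq ?_)
  rw [div_pow, pow_add (s : ℝ)]
  field_simp

/-- The coefficient is an average of waves at the vectors `(ζ ^ l ρ, 1)`. With `ρ² = p / s` the mean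
inequality bounds each wave by `M ^ (p + s) * ρ ^ p`, and `ρ ^ p` cancels. No factor growing with
the dimension appears, and the bound holds off the group, as holomorphic extension requires. If `p`
or `s` is zero the coefficient is a power of one entry. -/
theorem RowBound.norm_diagCoeff_le {M : ℝ} (hM : 0 ≤ M) {A : Mat} (hA : RowBound M A) (p s : ℕ) :
    ‖diagCoeff p s A‖ ≤ M ^ (p + s) := by
  rcases Nat.eq_zero_or_pos p with rfl | hp
  · rw [diagCoeff_zero_left, norm_pow, zero_add]
    refine pow_le_pow_left₀ (norm_nonneg _) (abs_le_of_sq_le_sq' ?_ hM).2 _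
    have := hA 0 1
    simp only [zero_mul, one_mul, zero_add, norm_zero, norm_one] at this
    nlinarith [sq_nonneg ‖A 1 0‖]
  rcases Nat.eq_zero_or_pos s with rfl | hs
  · rw [diagCoeff_zero_right, norm_pow, add_zero]
    refine pow_le_pow_left₀ (norm_nonneg _) (abs_le_of_sq_le_sq' ?_ hM).2 _
    have := hA 1 0
    simp only [zero_mul, one_mul, add_zero, norm_zero, norm_one] at this
    nlinarith [sq_nonneg ‖A 0 1‖]
  have hp' : (0 : ℝ) < p := by exact_mod_cast hp
  have hs' : (0 : ℝ) < s := by exact_mod_cast hs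
  set ρ : ℝ := √(p / s) with hρ
  have hρ2 : ρ ^ 2 = p / s := Real.sq_sqrt (by positivity)
  have hρ0 : 0 < ρ := Real.sqrt_pos.2 (by positivity)
  set N := p + s + 1
  have hN0 : N ≠ 0 := by omega
  have h := diagCoeff_mul_pow A p s (N := N) (by omega) ρ
  have hb : ∀ l ∈ Finset.range N, ‖(rootOfUnity N ^ l) ^ (N - p) *
      wave (rootOfUnity N ^ l * ρ) 1 p s A‖ ≤ M ^ (p + s) * ρ ^ p := by
    intro l _
    rw [norm_mul, norm_pow, norm_pow, norm_rootOfUnity hN0, one_pow, one_pow, one_mul]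
    refine (abs_le_of_sq_le_sq' ?_ (by positivity)).2
    have h1 := hA (rootOfUnity N ^ l * ρ) 1
    simp only [norm_mul, norm_pow, norm_rootOfUnity hN0, one_pow, one_mul, Complex.norm_real,
      norm_one, Real.norm_eq_abs, sq_abs, hρ2] at h1
    rw [show (p / s + 1 : ℝ) = (p + s) / s by field_simp] at h1
    have h2 := pow_mul_pow_le_of_add_le hp.ne' hs.ne' (sq_nonneg _) (sq_nonneg _) h1
    rw [wave, norm_mul, norm_pow, norm_pow, mul_pow, mul_pow, ← pow_mul, ← pow_mul, ← pow_mul,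
      ← pow_mul, mul_comm p, mul_comm s, mul_comm (p + s), pow_mul, pow_mul, pow_mul M, pow_mul ρ,
      hρ2]
    simpa only [columnForm_apply, one_mul] using h2
  have h3 := norm_sum_le_of_le _ hb
  rw [h] at h3
  simp only [Finset.sum_const, Finset.card_range, nsmul_eq_mul, norm_mul, norm_pow,
    Complex.norm_real, Complex.norm_natCast, Real.norm_eq_abs, abs_of_pos hρ0] at h3
  have h4 := le_of_mul_le_mul_left h3 (by positivity)
  rw [mul_comm] at h4
  exact le_of_mul_le_mul_right h4 (by positivity)

theorem norm_diagCoeff_emb_le (p s : ℕ) (g : SU2) : ‖diagCoeff p s (emb g)‖ ≤ 1 := by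
  simpa using (rowBound_emb g).norm_diagCoeff_le zero_le_one p s

theorem diagCoeff_emb_one (p s : ℕ) : diagCoeff p s (emb 1) = 1 := by
  rw [diagCoeff, Finset.sum_eq_single 0]
  · simp [emb_one]
  · intro j _ hj
    simp [emb_one, hj]
  · simp

theorem diagCoeff_swap {A B : Mat} (h0 : B 0 0 = A 1 1) (h1 : B 1 1 = A 0 0)
    (h2 : B 0 1 * B 1 0 = A 0 1 * A 1 0) (p s : ℕ) : diagCoeff p s B = diagCoeff s p A := by
  rw [diagCoeff, diagCoeff, h0, h1, h2, add_comm s p]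
  refine Finset.sum_congr rfl fun j _ => ?_
  ring

theorem diagCoeff_emb_inv (p s : ℕ) (g : SU2) :
    diagCoeff p s (emb g⁻¹) = diagCoeff s p (emb g) := by
  refine diagCoeff_swap ?_ ?_ ?_ p s
  · rw [emb_inv, emb_one_one]
  · rw [emb_inv, emb_one_one, star_star]
  · rw [emb_inv, emb_inv, emb_one_zero]; simp

theorem star_diagCoeff_emb (p s : ℕ) (g : SU2) :
    star (diagCoeff p s (emb g)) = diagCoeff s p (emb g) := by
  rw [← diagCoeff_swap (A := emb g) (B := fun i j => star (emb g i j)) (p := p) (s := s)]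
  · simp [diagCoeff]
  · rw [emb_one_one]
  · rw [emb_one_one, star_star]
  · rw [emb_one_zero]; simp [mul_comm]

end SubellipticSU2

namespace SubellipticSU2

/-! ### Termwise differentiation of holomorphic series -/

theorem LocallyNormallySummable.lieDeriv {I : Type} {f : I → Mat → ℂ} {U : Set Mat}
    (h : LocallyNormallySummable f U) (hf : ∀ i, Differentiable ℂ (f i)) (R : Mat →L[ℂ] Mat) :
    LocallyNormallySummable (fun i => SubellipticSU2.lieDeriv R (f i)) U := by
  intro x hx
  obtain ⟨r, hr, B, hB, hfB⟩ := h.fderiv hf x hx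
  refine ⟨r, hr, fun i => B i * (‖R‖ * (‖x‖ + r)), hB.mul_right _, fun i y hy => ?_⟩
  have hy' : ‖y‖ ≤ ‖x‖ + r := by
    rw [Metric.mem_ball, dist_eq_norm] at hy
    have := norm_le_norm_add_norm_sub' y x
    linarith
  calc ‖_root_.fderiv ℂ (f i) y (R y)‖ ≤ ‖_root_.fderiv ℂ (f i) y‖ * ‖R y‖ :=
        ContinuousLinearMap.le_opNorm _ _
    _ ≤ B i * (‖R‖ * (‖x‖ + r)) :=
        mul_le_mul (hfB i y hy) ((R.le_opNorm y).trans
          (mul_le_mul_of_nonneg_left hy' (norm_nonneg _))) (norm_nonneg _)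
          ((norm_nonneg _).trans (hfB i y hy))

theorem LocallyNormallySummable.lieDeriv_tsum {I : Type} {f : I → Mat → ℂ} {U : Set Mat}
    (h : LocallyNormallySummable f U) (hf : ∀ i, Differentiable ℂ (f i)) (R : Mat →L[ℂ] Mat)
    {x : Mat} (hx : x ∈ U) :
    SubellipticSU2.lieDeriv R (fun y => ∑' i, f i y) x =
      ∑' i, SubellipticSU2.lieDeriv R (f i) x := by
  have h1 := (h.hasFDerivAt hf hx).fderiv
  rw [SubellipticSU2.lieDeriv, h1]
  exact (ContinuousLinearMap.apply ℂ ℂ (R x)).map_tsum ((h.fderiv hf).summable hx)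

theorem LocallyNormallySummable.lieDeriv_lieDeriv_tsum {I : Type} {f : I → Mat → ℂ} {U : Set Mat}
    (hU : IsOpen U) (h : LocallyNormallySummable f U) (hf : ∀ i, ContDiff ℂ (⊤ : ℕ∞) (f i))
    (R : Mat →L[ℂ] Mat) {x : Mat} (hx : x ∈ U) :
    HasSum (fun i => SubellipticSU2.lieDeriv R (SubellipticSU2.lieDeriv R (f i)) x)
      (SubellipticSU2.lieDeriv R (SubellipticSU2.lieDeriv R (fun y => ∑' i, f i y)) x) := by
  have hd : ∀ i, Differentiable ℂ (f i) := fun i => (hf i).differentiable (by simp)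
  have hd' : ∀ i, Differentiable ℂ (SubellipticSU2.lieDeriv R (f i)) := fun i =>
    (contDiff_lieDeriv (hf i) R).differentiable (by simp)
  have e : SubellipticSU2.lieDeriv R (fun y => ∑' i, f i y) =ᶠ[𝓝 x]
      fun y => ∑' i, SubellipticSU2.lieDeriv R (f i) y := by
    filter_upwards [hU.mem_nhds hx] with y hy using h.lieDeriv_tsum hd R hy
  have e2 : SubellipticSU2.lieDeriv R (SubellipticSU2.lieDeriv R (fun y => ∑' i, f i y)) x =
      SubellipticSU2.lieDeriv R (fun y => ∑' i, SubellipticSU2.lieDeriv R (f i) y) x := by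
    rw [SubellipticSU2.lieDeriv, e.fderiv_eq]; rfl
  rw [e2, (h.lieDeriv hd R).lieDeriv_tsum hd' R hx]
  exact (((h.lieDeriv hd R).lieDeriv hd' R).summable hx).hasSum

/-! ### Series of diagonal coefficients -/

/-- The function on `SU(2)` with given coefficients along the diagonal coefficients. -/
noncomputable def diagSeries (c : ℕ × ℕ → ℝ) (g : SU2) : ℝ :=
  ∑' i, c i * (diagCoeff i.1 i.2 (emb g)).re

theorem abs_re_diagCoeff_le (i : ℕ × ℕ) (g : SU2) : |(diagCoeff i.1 i.2 (emb g)).re| ≤ 1 :=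
  (Complex.abs_re_le_norm _).trans (norm_diagCoeff_emb_le _ _ g)

theorem norm_mul_re_diagCoeff_le (c : ℝ) (i : ℕ × ℕ) (g : SU2) :
    ‖c * (diagCoeff i.1 i.2 (emb g)).re‖ ≤ |c| := by
  rw [norm_mul, Real.norm_eq_abs, Real.norm_eq_abs]
  exact mul_le_of_le_one_right (abs_nonneg _) (abs_re_diagCoeff_le i g)

theorem summable_diagSeries {c : ℕ × ℕ → ℝ} (hc : Summable fun i => |c i|) (g : SU2) :
    Summable fun i => c i * (diagCoeff i.1 i.2 (emb g)).re :=
  Summable.of_norm_bounded hc fun i => norm_mul_re_diagCoeff_le _ i g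

theorem summable_complex_diagSeries {c : ℕ × ℕ → ℝ} (hc : Summable fun i => |c i|) (g : SU2) :
    Summable fun i => (c i : ℂ) * diagCoeff i.1 i.2 (emb g) :=
  Summable.of_norm_bounded hc fun i => by
    rw [norm_mul, Complex.norm_real, Real.norm_eq_abs]
    exact mul_le_of_le_one_right (abs_nonneg _) (norm_diagCoeff_emb_le _ _ g)

theorem re_tsum_diagCoeff {c : ℕ × ℕ → ℝ} (hc : Summable fun i => |c i|) (g : SU2) :
    (∑' i, (c i : ℂ) * diagCoeff i.1 i.2 (emb g)).re = diagSeries c g := by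
  rw [Complex.re_tsum (summable_complex_diagSeries hc g)]
  simp [diagSeries]

/-- Conjugation exchanges the two weights, so a series with symmetric coefficients is already real.
-/
theorem ofReal_diagSeries {c : ℕ × ℕ → ℝ} (hc : Summable fun i => |c i|)
    (hsymm : ∀ i, c i.swap = c i) (g : SU2) :
    (diagSeries c g : ℂ) = ∑' i, (c i : ℂ) * diagCoeff i.1 i.2 (emb g) := by
  rw [← re_tsum_diagCoeff hc g]
  refine Complex.conj_eq_iff_re.1 ?_
  rw [Complex.conj_tsum]
  rw [← (Equiv.prodComm ℕ ℕ).tsum_eq]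
  refine tsum_congr fun i => ?_
  have h := star_diagCoeff_emb i.2 i.1 g
  have hs := hsymm i
  simp only [Equiv.prodComm_apply, Prod.fst_swap, Prod.snd_swap, map_mul, Complex.conj_ofReal, hs]
  congr 1

theorem diagSeries_inv (c : ℕ × ℕ → ℝ) (g : SU2) : diagSeries c g⁻¹ = diagSeries c g := by
  refine tsum_congr fun i => ?_
  rw [diagCoeff_emb_inv, ← star_diagCoeff_emb]
  simp

theorem diagSeries_congr_emb {g h : SU2} (h0 : emb g 0 0 = emb h 0 0)
    (h2 : emb g 0 1 * emb g 1 0 = emb h 0 1 * emb h 1 0) (c : ℕ × ℕ → ℝ) :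
    diagSeries c g = diagSeries c h := by
  have h1 : emb g 1 1 = emb h 1 1 := by rw [emb_one_one, emb_one_one, h0]
  refine tsum_congr fun i => ?_
  rw [diagCoeff, diagCoeff, h0, h1, h2]

section Smooth

variable {c : ℕ × ℕ → ℝ} {r : ℝ}

theorem summable_abs_of_summable_weight (hr : 0 < r)
    (hc : Summable fun i : ℕ × ℕ => |c i| * (1 + 2 * r) ^ (i.1 + i.2)) :
    Summable fun i => |c i| :=
  hc.of_nonneg_of_le (fun _ => abs_nonneg _) fun i =>
    le_mul_of_one_le_right (abs_nonneg _) (one_le_pow₀ (by linarith))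

theorem locallyNormallySummable_diagCoeff (hr : 0 < r)
    (hc : Summable fun i : ℕ × ℕ => |c i| * (1 + 2 * r) ^ (i.1 + i.2)) :
    LocallyNormallySummable (fun (i : ℕ × ℕ) A => (c i : ℂ) * diagCoeff i.1 i.2 A)
      (contractionNhd r) := by
  intro x hx
  obtain ⟨ε, hε, hb⟩ := Metric.isOpen_iff.1 (isOpen_contractionNhd r) x hx
  refine ⟨ε, hε, _, hc, fun i y hy => ?_⟩
  rw [norm_mul, Complex.norm_real, Real.norm_eq_abs]
  exact mul_le_mul_of_nonneg_left
    ((RowBound.of_mem (hb hy)).norm_diagCoeff_le (by linarith) _ _) (abs_nonneg _)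

theorem isSmooth_diagSeries (hr : 0 < r)
    (hc : Summable fun i : ℕ × ℕ => |c i| * (1 + 2 * r) ^ (i.1 + i.2)) :
    IsSmooth (diagSeries c) := by
  have h := locallyNormallySummable_diagCoeff hr hc
  have hf : ∀ i : ℕ × ℕ, ContDiff ℂ (⊤ : ℕ∞) fun A => (c i : ℂ) * diagCoeff i.1 i.2 A :=
    fun i => contDiff_const.mul (isEigenfunction_diagCoeff i.1 i.2).1
  have := isSmooth_re hr fun n => h.contDiffOn (isOpen_contractionNhd r) n _ _ hf
  simpa only [re_tsum_diagCoeff (summable_abs_of_summable_weight hr hc)] using this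

theorem sublaplacian_diagSeries (hr : 0 < r)
    (hc : Summable fun i : ℕ × ℕ => |c i| * (1 + 2 * r) ^ (i.1 + i.2)) (g : SU2) :
    sublaplacian (diagSeries c) g = diagSeries (fun i => -eigenvalue i * c i) g := by
  have h := locallyNormallySummable_diagCoeff hr hc
  have hf : ∀ i : ℕ × ℕ, IsEigenfunction (eigenvalue i)
      fun A => (c i : ℂ) * diagCoeff i.1 i.2 A :=
    fun i => (isEigenfunction_diagCoeff i.1 i.2).const_mul _
  have h1 := sublaplacian_re hr (fun n => h.contDiffOn (isOpen_contractionNhd r) n _ _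
    fun i => (hf i).1) g
  simp only [re_tsum_diagCoeff (summable_abs_of_summable_weight hr hc)] at h1
  have hx : emb g ∈ contractionNhd r := mem_contractionNhd hr (rowBound_emb g)
  have h2 := (h.lieDeriv_lieDeriv_tsum (isOpen_contractionNhd r) (fun i => (hf i).1) rightX hx).add
    (h.lieDeriv_lieDeriv_tsum (isOpen_contractionNhd r) (fun i => (hf i).1) rightY hx)
  have h3 : HasSum (fun i : ℕ × ℕ => -(eigenvalue i : ℂ) * ((c i : ℂ) * diagCoeff i.1 i.2 (emb g)))
      (complexLaplacian (fun A => ∑' i : ℕ × ℕ, (c i : ℂ) * diagCoeff i.1 i.2 A) (emb g)) := by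
    refine h2.congr_fun ?_
    intro i
    exact ((hf i).2 (emb g)).symm
  refine h1.trans ?_
  have h4 := (Complex.hasSum_re h3).tsum_eq
  rw [← h4]
  refine tsum_congr fun i => ?_
  simp [mul_assoc]

end Smooth

/-! ### Summability -/

/-- The dimension of the symmetric power of degree `p + s`. -/
def dimension (i : ℕ × ℕ) : ℝ := i.1 + i.2 + 1

theorem dimension_pos (i : ℕ × ℕ) : 0 < dimension i := by unfold dimension; positivity

theorem eigenvalue_nonneg (i : ℕ × ℕ) : 0 ≤ eigenvalue i := by unfold eigenvalue; positivity

theorem two_mul_le_eigenvalue (i : ℕ × ℕ) : 2 * (i.1 + i.2 : ℝ) ≤ eigenvalue i := by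
  unfold eigenvalue; nlinarith [mul_nonneg (Nat.cast_nonneg (α := ℝ) i.1) (Nat.cast_nonneg i.2)]

theorem eigenvalue_swap (i : ℕ × ℕ) : eigenvalue i.swap = eigenvalue i := by
  simp [eigenvalue]; ring

theorem dimension_swap (i : ℕ × ℕ) : dimension i.swap = dimension i := by
  simp [dimension]; ring

theorem summable_succ_pow_mul_exp (k : ℕ) {t : ℝ} (ht : 0 < t) :
    Summable fun n : ℕ => ((n : ℝ) + 1) ^ k * Real.exp (-(t * n)) := by
  have h := (summable_nat_add_iff 1).2 (Real.summable_pow_mul_exp_neg_nat_mul k ht)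
  refine (h.mul_left (Real.exp t)).congr fun n => ?_
  push_cast
  rw [mul_left_comm, ← Real.exp_add]
  ring_nf

/-- Since `eigenvalue ≥ 2 (p + s)` and the other factors are bounded by powers of `(p + 1) (s + 1)`,
the double series is dominated by a product of two simple ones. -/
theorem summable_heat (k : ℕ) {t : ℝ} (ht : 0 < t) :
    Summable fun i : ℕ × ℕ => dimension i * eigenvalue i ^ k * Real.exp (-(t * eigenvalue i)) := by
  have h := summable_succ_pow_mul_exp (k + 1) (t := 2 * t) (by linarith)
  have h2 := (h.mul_of_nonneg h (fun n => by positivity) fun n => by positivity).mul_left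
    ((4 : ℝ) ^ k)
  refine h2.of_nonneg_of_le (fun i => mul_nonneg (mul_nonneg (dimension_pos i).le
    (pow_nonneg (eigenvalue_nonneg i) _)) (Real.exp_pos _).le) fun i => ?_
  obtain ⟨p, s⟩ := i
  have hp : (0 : ℝ) ≤ p := Nat.cast_nonneg p
  have hs : (0 : ℝ) ≤ s := Nat.cast_nonneg s
  have h3 : dimension (p, s) ≤ (p + 1) * (s + 1) := by
    simp only [dimension]; nlinarith [mul_nonneg hp hs]
  have h4 : eigenvalue (p, s) ≤ 4 * ((p + 1) * (s + 1)) := by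
    simp only [eigenvalue]; nlinarith [mul_nonneg hp hs]
  have h5 : Real.exp (-(t * eigenvalue (p, s))) ≤
      Real.exp (-(2 * t * p)) * Real.exp (-(2 * t * s)) := by
    rw [← Real.exp_add]
    refine Real.exp_le_exp.2 ?_
    have := mul_le_mul_of_nonneg_left (two_mul_le_eigenvalue (p, s)) ht.le
    simp only at this
    linarith
  have h6 := pow_le_pow_left₀ (eigenvalue_nonneg (p, s)) h4 k
  calc dimension (p, s) * eigenvalue (p, s) ^ k * Real.exp (-(t * eigenvalue (p, s)))
      ≤ ((p + 1) * (s + 1)) * (4 * ((p + 1) * (s + 1))) ^ k *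
        (Real.exp (-(2 * t * p)) * Real.exp (-(2 * t * s))) :=
        mul_le_mul (mul_le_mul h3 h6 (pow_nonneg (eigenvalue_nonneg _) _) (by positivity)) h5
          (Real.exp_pos _).le (by positivity)
    _ = _ := by
        simp only [mul_pow]; ring

/-- The coefficients of the heat kernel along the diagonal coefficients. -/
noncomputable def heatCoeff (t : ℝ) (i : ℕ × ℕ) : ℝ :=
  dimension i * Real.exp (-(t * eigenvalue i))

theorem heatCoeff_pos (t : ℝ) (i : ℕ × ℕ) : 0 < heatCoeff t i :=
  mul_pos (dimension_pos i) (Real.exp_pos _)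

theorem heatCoeff_swap (t : ℝ) (i : ℕ × ℕ) : heatCoeff t i.swap = heatCoeff t i := by
  rw [heatCoeff, heatCoeff, dimension_swap, eigenvalue_swap]

theorem summable_heatCoeff {t : ℝ} (ht : 0 < t) : Summable (heatCoeff t) := by
  refine (summable_heat 0 ht).congr fun i => ?_
  rw [heatCoeff, pow_zero, mul_one]

theorem summable_abs_heatCoeff {t : ℝ} (ht : 0 < t) : Summable fun i => |heatCoeff t i| := by
  simpa only [abs_of_pos (heatCoeff_pos t _)] using summable_heatCoeff ht

theorem summable_eigenvalue_mul_heatCoeff {t : ℝ} (ht : 0 < t) :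
    Summable fun i => eigenvalue i * heatCoeff t i := by
  refine (summable_heat 1 ht).congr fun i => ?_
  rw [heatCoeff]; ring

/-- The width `t / 2` is chosen so that the weight `(1 + t) ^ (p + s)` is at most `exp (t (p + s))`,
which costs no more than half of the decay `exp (-t eigenvalue)`. -/
theorem summable_heatCoeff_weight {t : ℝ} (ht : 0 < t) :
    Summable fun i : ℕ × ℕ => |heatCoeff t i| * (1 + 2 * (t / 2)) ^ (i.1 + i.2) := by
  refine (summable_heatCoeff (half_pos ht)).of_nonneg_of_le (fun i => by positivity) fun i => ?_
  rw [abs_of_pos (heatCoeff_pos t i), heatCoeff, heatCoeff, mul_assoc]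
  refine mul_le_mul_of_nonneg_left ?_ (dimension_pos i).le
  have h1 : (1 + 2 * (t / 2)) ^ (i.1 + i.2) ≤ Real.exp (t * (i.1 + i.2)) := by
    have : t * (i.1 + i.2 : ℝ) = ((i.1 + i.2 : ℕ) : ℝ) * t := by push_cast; ring
    rw [this, Real.exp_nat_mul]
    exact pow_le_pow_left₀ (by linarith) (by linarith [Real.add_one_le_exp t]) _
  calc Real.exp (-(t * eigenvalue i)) * (1 + 2 * (t / 2)) ^ (i.1 + i.2)
      ≤ Real.exp (-(t * eigenvalue i)) * Real.exp (t * (i.1 + i.2)) :=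
        mul_le_mul_of_nonneg_left h1 (Real.exp_pos _).le
    _ ≤ _ := by
        rw [← Real.exp_add]
        refine Real.exp_le_exp.2 ?_
        have := mul_le_mul_of_nonneg_left (two_mul_le_eigenvalue i) (half_pos ht).le
        linarith

/-- The explicit heat kernel. -/
noncomputable def kernel (t : ℝ) : SU2 → ℝ := diagSeries (heatCoeff t)

theorem isSmooth_kernel {t : ℝ} (ht : 0 < t) : IsSmooth (kernel t) :=
  isSmooth_diagSeries (half_pos ht) (summable_heatCoeff_weight ht)

theorem sublaplacian_kernel {t : ℝ} (ht : 0 < t) (g : SU2) :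
    sublaplacian (kernel t) g = diagSeries (fun i => -eigenvalue i * heatCoeff t i) g :=
  sublaplacian_diagSeries (half_pos ht) (summable_heatCoeff_weight ht) g

theorem heatCoeff_anti {s t : ℝ} (h : s ≤ t) (i : ℕ × ℕ) : heatCoeff t i ≤ heatCoeff s i := by
  refine mul_le_mul_of_nonneg_left (Real.exp_le_exp.2 ?_) (dimension_pos i).le
  have := mul_le_mul_of_nonneg_right h (eigenvalue_nonneg i)
  linarith

theorem hasDerivAt_heatCoeff (t : ℝ) (i : ℕ × ℕ) :
    HasDerivAt (fun t => heatCoeff t i) (-eigenvalue i * heatCoeff t i) t := by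
  have h := ((((hasDerivAt_id t).mul_const (eigenvalue i)).fun_neg).exp).const_mul (dimension i)
  refine h.congr_deriv ?_
  simp only [heatCoeff, id]
  ring

theorem abs_neg_eigenvalue_mul_heatCoeff (t : ℝ) (i : ℕ × ℕ) :
    |-eigenvalue i * heatCoeff t i| = eigenvalue i * heatCoeff t i := by
  rw [abs_mul, abs_neg, abs_of_nonneg (eigenvalue_nonneg i), abs_of_pos (heatCoeff_pos t i)]

theorem hasDerivAt_kernel {t : ℝ} (ht : 0 < t) (g : SU2) :
    HasDerivAt (fun s => kernel s g) (sublaplacian (kernel t) g) t := by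
  rw [sublaplacian_kernel ht]
  refine hasDerivAt_tsum_of_isPreconnected
    (summable_eigenvalue_mul_heatCoeff (half_pos ht)) isOpen_Ioi isPreconnected_Ioi
    (g := fun i s => heatCoeff s i * (diagCoeff i.1 i.2 (emb g)).re)
    (g' := fun i s => -eigenvalue i * heatCoeff s i * (diagCoeff i.1 i.2 (emb g)).re)
    (fun i s _ => (hasDerivAt_heatCoeff s i).mul_const _) (fun i s hs => ?_)
    (Set.mem_Ioi.2 (half_lt_self ht)) (summable_diagSeries (summable_abs_heatCoeff ht) g)
    (Set.mem_Ioi.2 (half_lt_self ht))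
  refine (norm_mul_re_diagCoeff_le _ i g).trans ?_
  rw [abs_neg_eigenvalue_mul_heatCoeff]
  exact mul_le_mul_of_nonneg_left (heatCoeff_anti hs.le i) (eigenvalue_nonneg i)

theorem abs_kernel_le {s t : ℝ} (hs : 0 < s) (h : s ≤ t) (g : SU2) :
    |kernel t g| ≤ ∑' i, heatCoeff s i := by
  refine tsum_of_norm_bounded (summable_heatCoeff hs).hasSum fun i =>
    (norm_mul_re_diagCoeff_le _ i g).trans ?_
  rw [abs_of_pos (heatCoeff_pos t i)]
  exact heatCoeff_anti h i

theorem abs_sublaplacian_kernel_le {s t : ℝ} (hs : 0 < s) (h : s ≤ t) (g : SU2) :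
    |sublaplacian (kernel t) g| ≤ ∑' i, eigenvalue i * heatCoeff s i := by
  rw [sublaplacian_kernel (hs.trans_le h)]
  refine tsum_of_norm_bounded (summable_eigenvalue_mul_heatCoeff hs).hasSum fun i =>
    (norm_mul_re_diagCoeff_le _ i g).trans ?_
  rw [abs_neg_eigenvalue_mul_heatCoeff]
  exact mul_le_mul_of_nonneg_left (heatCoeff_anti h i) (eigenvalue_nonneg i)

theorem continuous_re_diagCoeff (i : ℕ × ℕ) :
    Continuous fun g => (diagCoeff i.1 i.2 (emb g)).re :=
  Complex.continuous_re.comp ((isEigenfunction_diagCoeff i.1 i.2).1.continuous.comp continuous_emb)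

theorem continuousOn_kernel :
    ContinuousOn (fun q : ℝ × SU2 => kernel q.1 q.2) (Set.Ioi 0 ×ˢ Set.univ) := by
  rintro ⟨t, g⟩ ⟨ht, -⟩
  have ht : 0 < t := ht
  have h : ContinuousOn (fun q : ℝ × SU2 => kernel q.1 q.2) (Set.Ioi (t / 2) ×ˢ Set.univ) := by
    refine continuousOn_tsum (fun i => ?_) (summable_heatCoeff (half_pos ht)) fun i q hq => ?_
    · have h1 : Continuous fun t => heatCoeff t i :=
        continuous_iff_continuousAt.2 fun t => (hasDerivAt_heatCoeff t i).continuousAt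
      have h2 := continuous_re_diagCoeff i
      exact ((h1.comp continuous_fst).mul (h2.comp continuous_snd)).continuousOn
    · refine (norm_mul_re_diagCoeff_le _ i _).trans ?_
      rw [abs_of_pos (heatCoeff_pos _ i)]
      exact heatCoeff_anti (le_of_lt hq.1) i
  have hm : (t, g) ∈ Set.Ioi (t / 2) ×ˢ (Set.univ : Set SU2) := ⟨half_lt_self ht, trivial⟩
  exact (h.continuousAt ((isOpen_Ioi.prod isOpen_univ).mem_nhds hm)).continuousWithinAt

end SubellipticSU2

namespace SubellipticSU2

/-! ### Integrals of monomials -/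

/-- The monomial `a ^ i b ^ j c ^ k d ^ l` in the entries. -/
noncomputable def monomial (i j k l : ℕ) (g : SU2) : ℂ :=
  emb g 0 0 ^ i * emb g 0 1 ^ j * (emb g 1 0 ^ k * emb g 1 1 ^ l)

theorem continuous_monomial (i j k l : ℕ) : Continuous (monomial i j k l) := by
  have := continuous_emb_apply
  unfold monomial
  fun_prop

/-- The diagonal element of `SU(2)` with upper left entry `τ`. -/
def diagonal (τ : ℂ) (h : ‖τ‖ = 1) : SU2 :=
  mk τ 0 (by rw [Complex.normSq_eq_norm_sq, h]; simp)

theorem emb_diagonal (τ : ℂ) (h) : emb (diagonal τ h) = ![![τ, 0], ![0, star τ]] := by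
  rw [diagonal, emb_mk]; simp

theorem star_mul_self_of_norm_eq_one {τ : ℂ} (h : ‖τ‖ = 1) : star τ * τ = 1 := by
  have := Complex.conj_mul' τ
  rw [h] at this
  simpa using this

theorem rootOfUnity_pow_injective {N m n : ℕ} (hm : m < N) (hn : n < N)
    (h : rootOfUnity N ^ m = rootOfUnity N ^ n) : m = n :=
  (isPrimitiveRoot_rootOfUnity (by omega)).pow_inj hm hn h

theorem eq_of_mul_pow_star_eq {m n : ℕ} {I : ℂ} (hI : I ≠ 0)
    (h : ∀ τ : ℂ, ‖τ‖ = 1 → I = τ ^ m * star τ ^ n * I) : m = n := by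
  -- A root of unity whose order exceeds both exponents separates the two powers.
  set N := m + n + 1
  have hN : N ≠ 0 := by omega
  have h1 := h (rootOfUnity N) (norm_rootOfUnity hN)
  have h2 := star_mul_self_of_norm_eq_one (norm_rootOfUnity hN)
  have h3 : (1 : ℂ) = rootOfUnity N ^ m * star (rootOfUnity N) ^ n :=
    mul_right_cancel₀ hI (by rw [one_mul]; exact h1)
  refine rootOfUnity_pow_injective (N := N) (by omega) (by omega) ?_
  calc rootOfUnity N ^ m = rootOfUnity N ^ m * (star (rootOfUnity N) * rootOfUnity N) ^ n := by
        rw [h2]; simp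
    _ = (rootOfUnity N ^ m * star (rootOfUnity N) ^ n) * rootOfUnity N ^ n := by
        rw [mul_pow]; ring
    _ = _ := by rw [← h3, one_mul]

/-- Multiplying by `diag (τ, τ̄)` on the left or on the right scales the monomial by `τ ^ (i + j) τ̄
^ (k + l)`, respectively `τ ^ (i + k) τ̄ ^ (j + l)`. Invariance of Haar measure kills the integral
unless both characters are trivial. -/
theorem integral_monomial_eq_zero {i j k l : ℕ} (h : ¬(i + j = k + l ∧ i + k = j + l)) :
    ∫ g, monomial i j k l g ∂haar = 0 := by
  by_contra hI
  refine h ⟨eq_of_mul_pow_star_eq hI fun τ hτ => ?_, eq_of_mul_pow_star_eq hI fun τ hτ => ?_⟩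
  · rw [← integral_const_mul]
    refine (integral_mul_left_eq_self (fun g => monomial i j k l g) (diagonal τ hτ)).symm.trans
      (integral_congr_ae (Eventually.of_forall fun g => ?_))
    simp only [monomial, emb_mul, emb_diagonal]
    simp only [Matrix.cons_val_zero, Matrix.cons_val_one, zero_mul, add_zero, zero_add, mul_pow,
      pow_add]
    ring
  · rw [← integral_const_mul]
    refine (integral_mul_right_eq_self (fun g => monomial i j k l g) (diagonal τ hτ)).symm.trans
      (integral_congr_ae (Eventually.of_forall fun g => ?_))
    simp only [monomial, emb_mul, emb_diagonal]
    simp only [Matrix.cons_val_zero, Matrix.cons_val_one, mul_zero, add_zero, zero_add, mul_pow,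
      pow_add]
    ring

/-! ### Recurrences for the moments of Haar measure. -/

theorem integral_lieDeriv {γ : ℝ → SU2} {R : Mat →L[ℂ] Mat} (hd : IsDirection γ R) {F : Mat → ℂ}
    (hF : ContDiff ℂ (⊤ : ℕ∞) F) : ∫ g, lieDeriv R F (emb g) ∂haar = 0 := by
  have key : ∀ {F : Mat → ℂ}, ContDiff ℂ (⊤ : ℕ∞) F →
      ∫ g, (lieDeriv R F (emb g)).re ∂haar = 0 := by
    intro F hF
    have h1 := isSmooth_re one_pos fun n =>
      (contDiff_infty.1 hF n).contDiffOn (s := contractionNhd 1)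
    have h2 := integral_fieldAlong hd h1
    rwa [integral_congr_ae (Eventually.of_forall fun g =>
      fieldAlong_re hd (hF.differentiable (by simp) (emb g)))] at h2
  have hc : Continuous fun g => lieDeriv R F (emb g) :=
    (contDiff_lieDeriv hF R).continuous.comp continuous_emb
  have hi := integrable_of_continuous hc
  refine Complex.ext ?_ ?_
  · have := integral_re hi
    exact this.symm.trans (key hF)
  · have h1 := integral_im hi
    refine h1.symm.trans ?_
    -- The imaginary part of `F` is the real part of `-I * F`.
    have h2 := key (F := fun A => (-Complex.I) * F A) (contDiff_const.mul hF)
    rw [lieDeriv_const_mul (hF.differentiable (by simp))] at h2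
    simpa using h2

theorem lieDeriv_mul {F G : Mat → ℂ} (hF : Differentiable ℂ F) (hG : Differentiable ℂ G)
    (R : Mat →L[ℂ] Mat) (A : Mat) :
    lieDeriv R (fun A => F A * G A) A = F A * lieDeriv R G A + G A * lieDeriv R F A := by
  simp only [lieDeriv]
  rw [fderiv_fun_mul (hF A) (hG A)]
  simp

theorem wave_one_zero (p s : ℕ) (g : SU2) :
    wave 1 0 p s (emb g) = emb g 0 0 ^ p * emb g 0 1 ^ s := by
  simp [wave, columnForm_apply]

theorem wave_zero_one (p s : ℕ) (g : SU2) :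
    wave 0 1 p s (emb g) = emb g 1 0 ^ p * emb g 1 1 ^ s := by
  simp [wave, columnForm_apply]

theorem continuous_wave (x y : ℂ) (p s : ℕ) : Continuous fun g => wave x y p s (emb g) :=
  (contDiff_wave x y p s).continuous.comp continuous_emb

/-- The integral of `(a d) ^ p (b c) ^ s`. -/
noncomputable def betaIntegral (p s : ℕ) : ℂ := ∫ g, monomial p s s p g ∂haar

/-- This is the relation `a d - b c = 1` multiplied by a monomial and integrated. -/
theorem betaIntegral_succ_sub (p s : ℕ) :
    betaIntegral (p + 1) s - betaIntegral p (s + 1) = betaIntegral p s := by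
  rw [betaIntegral, betaIntegral, betaIntegral,
    ← integral_sub (integrable_of_continuous (continuous_monomial _ _ _ _))
      (integrable_of_continuous (continuous_monomial _ _ _ _))]
  refine integral_congr_ae (Eventually.of_forall fun g => ?_)
  have h := emb_det g
  simp only [monomial]
  linear_combination
    (emb g 0 0 ^ p * emb g 0 1 ^ s * (emb g 1 0 ^ s * emb g 1 1 ^ p)) * h

/-- The operator `X - I Y` is twice the derivation sending `b` to `a` and `d` to `c` while killing
`a` and `c`. Applied to `a ^ p b ^ (s + 1) c ^ s d ^ (p + 1)` it produces both integrands, and its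
result integrates to zero. -/
theorem betaIntegral_add (p s : ℕ) :
    (s + 1) * betaIntegral (p + 1) s + (p + 1) * betaIntegral p (s + 1) = 0 := by
  set F : Mat → ℂ := fun A => wave 1 0 p (s + 1) A * wave 0 1 s (p + 1) A
  have hF : ContDiff ℂ (⊤ : ℕ∞) F := (contDiff_wave _ _ _ _).mul (contDiff_wave _ _ _ _)
  have hd : ∀ x y p s, Differentiable ℂ (wave x y p s) := fun x y p s =>
    (contDiff_wave x y p s).differentiable (by simp)
  have h1 := integral_lieDeriv isDirection_expX hF
  have h2 := integral_lieDeriv isDirection_expY hF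
  have c1 : Continuous fun g => lieDeriv rightX F (emb g) :=
    (contDiff_lieDeriv hF _).continuous.comp continuous_emb
  have c2 : Continuous fun g => lieDeriv rightY F (emb g) :=
    (contDiff_lieDeriv hF _).continuous.comp continuous_emb
  have h3 : ∫ g, (lieDeriv rightX F (emb g) + (-Complex.I) * lieDeriv rightY F (emb g)) ∂haar
      = 0 := by
    rw [integral_add (integrable_of_continuous c1)
      ((integrable_of_continuous c2).const_mul _), integral_const_mul, h1, h2]
    simp
  have h4 : ∀ g, lieDeriv rightX F (emb g) + (-Complex.I) * lieDeriv rightY F (emb g) =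
      (2 * (s + 1)) * monomial (p + 1) s s (p + 1) g +
        (2 * (p + 1)) * monomial p (s + 1) (s + 1) p g := by
    intro g
    simp only [F]
    rw [lieDeriv_mul (hd _ _ _ _) (hd _ _ _ _), lieDeriv_mul (hd _ _ _ _) (hd _ _ _ _),
      lieDeriv_rightX_wave, lieDeriv_rightX_wave, lieDeriv_rightY_wave, lieDeriv_rightY_wave]
    simp only [wave_one_zero, wave_zero_one, monomial, Nat.add_sub_cancel]
    push_cast
    have hI := Complex.I_sq
    ring_nf
    rw [hI]
    ring
  rw [integral_congr_ae (Eventually.of_forall h4),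
    integral_add ((integrable_of_continuous (continuous_monomial _ _ _ _)).const_mul _)
      ((integrable_of_continuous (continuous_monomial _ _ _ _)).const_mul _),
    integral_const_mul, integral_const_mul] at h3
  simp only [betaIntegral]
  linear_combination h3 / 2

theorem betaIntegral_succ_left (p s : ℕ) :
    (p + s + 2) * betaIntegral (p + 1) s = (p + 1) * betaIntegral p s := by
  linear_combination betaIntegral_add p s + (p + 1) * betaIntegral_succ_sub p s

theorem betaIntegral_succ_right (p s : ℕ) :
    (p + s + 2) * betaIntegral p (s + 1) = -(s + 1) * betaIntegral p s := by
  linear_combination betaIntegral_add p s - (s + 1) * betaIntegral_succ_sub p s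

theorem factorial_mul_betaIntegral (p s : ℕ) :
    ((p + s + 1).factorial : ℂ) * betaIntegral p s = (-1) ^ s * (p.factorial * s.factorial) := by
  induction s with
  | zero =>
    induction p with
    | zero => simp [betaIntegral, monomial]
    | succ p ih =>
      have h := betaIntegral_succ_left p 0
      rw [add_zero] at ih ⊢
      rw [Nat.factorial_succ (p + 1), Nat.factorial_succ p]
      rw [Nat.factorial_succ p] at ih
      push_cast at h ih ⊢
      linear_combination ((p + 1) * p.factorial : ℂ) * h + (p + 1) * ih
  | succ s ih =>
    have h := betaIntegral_succ_right p s
    rw [show p + (s + 1) + 1 = (p + s + 1) + 1 by ring, Nat.factorial_succ, Nat.factorial_succ s]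
    push_cast at h ih ⊢
    linear_combination ((p + s + 1).factorial : ℂ) * h - (s + 1) * ih

theorem dimension_mul_choose_mul_betaIntegral (p s : ℕ) :
    (dimension (p, s) : ℂ) * ((p + s).choose s * ((-1) ^ s * betaIntegral p s)) = 1 := by
  have h := factorial_mul_betaIntegral p s
  have hc := Nat.add_choose_mul_factorial_mul_factorial p s
  have hc' : ((p + s).choose s : ℂ) * p.factorial * s.factorial = (p + s).factorial := by
    exact_mod_cast hc
  rw [Nat.factorial_succ] at h
  have hne : (p.factorial * s.factorial : ℂ) ≠ 0 :=
    mul_ne_zero (Nat.cast_ne_zero.2 p.factorial_ne_zero) (Nat.cast_ne_zero.2 s.factorial_ne_zero)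
  have hs : ((-1 : ℂ) ^ s) * (-1) ^ s = 1 := by rw [← mul_pow]; simp
  refine mul_right_cancel₀ hne ?_
  simp only [dimension]
  push_cast at h ⊢
  linear_combination ((-1) ^ s) * h + ((p + s + 1) * ((-1) ^ s * betaIntegral p s)) * hc' +
    (p.factorial * s.factorial : ℂ) * hs

/-! ### Pairings of coherent functions -/

theorem columnForm_emb_mul (x y : ℂ) (j : Fin 2) (k h : SU2) :
    columnForm x y j (emb (k * h)) =
      columnForm (columnForm x y 0 (emb k)) (columnForm x y 1 (emb k)) j (emb h) := by
  simp only [columnForm_apply, emb_mul]; ring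

theorem wave_emb_mul (x y : ℂ) (p s : ℕ) (k h : SU2) :
    wave x y p s (emb (k * h)) =
      wave (columnForm x y 0 (emb k)) (columnForm x y 1 (emb k)) p s (emb h) := by
  simp only [wave, columnForm_emb_mul]

theorem columnForm_det (x y x' y' : ℂ) (k : SU2) :
    columnForm x y 0 (emb k) * columnForm x' y' 1 (emb k) -
      columnForm x' y' 0 (emb k) * columnForm x y 1 (emb k) = x * y' - x' * y := by
  simp only [columnForm_apply]
  linear_combination (x * y' - x' * y) * emb_det k

/-- After binomial expansion, the first torus condition together with `p' + s' ≤ p + s` forces `i =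
j = 0` and equal degrees; the second then forces `p' = s` and `s' = p`. A single moment survives. -/
theorem integral_wave_mul_wave_one_zero (x y : ℂ) {p' s' p s : ℕ} (hn : p' + s' ≤ p + s) :
    ∫ h, wave x y p' s' (emb h) * wave 1 0 p s (emb h) ∂haar =
      if p' = s ∧ s' = p then y ^ (p + s) * betaIntegral p s else 0 := by
  have h1 : ∀ h, wave x y p' s' (emb h) * wave 1 0 p s (emb h) =
      ∑ i ∈ Finset.range (p' + 1), ∑ j ∈ Finset.range (s' + 1),
        (x ^ i * y ^ (p' - i) * p'.choose i * (x ^ j * y ^ (s' - j) * s'.choose j)) *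
          monomial (i + p) (j + s) (p' - i) (s' - j) h := by
    intro h
    rw [wave_one_zero, wave, columnForm_apply, columnForm_apply, add_pow, add_pow,
      Finset.sum_mul_sum, Finset.sum_mul]
    refine Finset.sum_congr rfl fun i _ => ?_
    rw [Finset.sum_mul]
    refine Finset.sum_congr rfl fun j _ => ?_
    simp only [monomial, mul_pow, pow_add]
    ring
  have hint : ∀ (c : ℂ) i j k l, Integrable (fun h => c * monomial i j k l h) haar :=
    fun c i j k l => (integrable_of_continuous (continuous_monomial i j k l)).const_mul c
  rw [integral_congr_ae (Eventually.of_forall h1), integral_finsetSum _ fun i _ =>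
    integrable_finsetSum _ fun j _ => hint _ _ _ _ _]
  have h2 : ∀ i ∈ Finset.range (p' + 1), (∫ h, ∑ j ∈ Finset.range (s' + 1),
        (x ^ i * y ^ (p' - i) * p'.choose i * (x ^ j * y ^ (s' - j) * s'.choose j)) *
          monomial (i + p) (j + s) (p' - i) (s' - j) h ∂haar) =
      ∑ j ∈ Finset.range (s' + 1),
        (x ^ i * y ^ (p' - i) * p'.choose i * (x ^ j * y ^ (s' - j) * s'.choose j)) *
          ∫ h, monomial (i + p) (j + s) (p' - i) (s' - j) h ∂haar := by
    intro i _
    rw [integral_finsetSum _ fun j _ => hint _ _ _ _ _]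
    simp only [integral_const_mul]
  rw [Finset.sum_congr rfl h2]
  split_ifs with h
  · obtain ⟨rfl, rfl⟩ := h
    rw [Finset.sum_eq_single 0, Finset.sum_eq_single 0]
    · simp only [pow_zero, Nat.sub_zero, Nat.choose_zero_right, Nat.cast_one, zero_add,
        betaIntegral, pow_add]
      ring
    · intro j hj hj0
      rw [Finset.mem_range] at hj
      rw [integral_monomial_eq_zero (by omega), mul_zero]
    · simp
    · intro i hi hi0
      refine Finset.sum_eq_zero fun j hj => ?_
      rw [Finset.mem_range] at hi hj
      rw [integral_monomial_eq_zero (by omega), mul_zero]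
    · simp
  · refine Finset.sum_eq_zero fun i hi => Finset.sum_eq_zero fun j hj => ?_
    rw [Finset.mem_range] at hi hj
    rw [integral_monomial_eq_zero (by omega), mul_zero]

theorem exists_row_eq (x y : ℂ) : ∃ (r : ℝ) (k : SU2), x = r * emb k 0 0 ∧ y = r * emb k 0 1 := by
  by_cases h : x = 0 ∧ y = 0
  · exact ⟨0, 1, by simp [h.1], by simp [h.2]⟩
  have hpos : 0 < Complex.normSq x + Complex.normSq y := by
    by_cases hx : x = 0
    · have hy : y ≠ 0 := fun hy => h ⟨hx, hy⟩
      exact add_pos_of_nonneg_of_pos (Complex.normSq_nonneg _) (Complex.normSq_pos.2 hy)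
    · exact add_pos_of_pos_of_nonneg (Complex.normSq_pos.2 hx) (Complex.normSq_nonneg _)
  set r := √(Complex.normSq x + Complex.normSq y) with hr
  have hr0 : 0 < r := Real.sqrt_pos.2 hpos
  have hr2 : r * r = Complex.normSq x + Complex.normSq y := Real.mul_self_sqrt hpos.le
  have hrc : (r : ℂ) ≠ 0 := by exact_mod_cast hr0.ne'
  refine ⟨r, mk (x / r) (y / r) ?_, ?_, ?_⟩
  · rw [Complex.normSq_div, Complex.normSq_div, Complex.normSq_ofReal, ← add_div, ← hr2,
      div_self (mul_pos hr0 hr0).ne']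
  · rw [emb_mk]; simp [mul_div_cancel₀ _ hrc]
  · rw [emb_mk]; simp [mul_div_cancel₀ _ hrc]

/-- `SU(2)` acts transitively on directions, so a translation turns `(x, y)` into a multiple of `(1,
0)`. The determinant `x y' - x' y` is invariant under it, which dictates the form of the answer. -/
theorem integral_wave_mul_wave_of_le (x' y' x y : ℂ) {p' s' p s : ℕ} (hn : p' + s' ≤ p + s) :
    ∫ h, wave x' y' p' s' (emb h) * wave x y p s (emb h) ∂haar =
      if p' = s ∧ s' = p then (x * y' - x' * y) ^ (p + s) * betaIntegral p s else 0 := by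
  obtain ⟨r, k, hx, hy⟩ := exists_row_eq x y
  set u := columnForm x' y' 0 (emb k⁻¹)
  set v := columnForm x' y' 1 (emb k⁻¹)
  have h1 : ∀ h, wave x' y' p' s' (emb h) * wave x y p s (emb h) =
      (r : ℂ) ^ (p + s) * (wave u v p' s' (emb (k * h)) * wave 1 0 p s (emb (k * h))) := by
    intro h
    have e1 : wave u v p' s' (emb (k * h)) = wave x' y' p' s' (emb h) := by
      rw [← wave_emb_mul, inv_mul_cancel_left]
    have e2 : wave x y p s (emb h) = (r : ℂ) ^ (p + s) * wave 1 0 p s (emb (k * h)) := by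
      rw [wave_one_zero, wave, columnForm_apply, columnForm_apply, hx, hy, emb_mul, emb_mul,
        pow_add, mul_mul_mul_comm, ← mul_pow, ← mul_pow]
      ring
    rw [e1, e2]; ring
  rw [integral_congr_ae (Eventually.of_forall h1), integral_const_mul,
    integral_mul_left_eq_self (fun h => wave u v p' s' (emb h) * wave 1 0 p s (emb h)) k,
    integral_wave_mul_wave_one_zero u v hn]
  split_ifs with h
  · rw [← mul_assoc, ← mul_pow]
    congr 2
    have e3 : x' = columnForm u v 0 (emb k) := by
      rw [← columnForm_emb_mul, inv_mul_cancel]; simp [columnForm_apply, emb_one]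
    have e4 : y' = columnForm u v 1 (emb k) := by
      rw [← columnForm_emb_mul, inv_mul_cancel]; simp [columnForm_apply, emb_one]
    rw [hx, hy, e3, e4]
    simp only [columnForm_apply]
    linear_combination (-(r : ℂ) * v) * emb_det k
  · simp

theorem integral_wave_mul_wave (x' y' x y : ℂ) (p' s' p s : ℕ) :
    ∫ h, wave x' y' p' s' (emb h) * wave x y p s (emb h) ∂haar =
      if p' = s ∧ s' = p then (x * y' - x' * y) ^ (p + s) * betaIntegral p s else 0 := by
  rcases le_total (p' + s') (p + s) with hn | hn
  · exact integral_wave_mul_wave_of_le x' y' x y hn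
  by_cases h : p' = s ∧ s' = p
  · exact integral_wave_mul_wave_of_le x' y' x y (by omega)
  · simp only [mul_comm (wave x' y' p' s' _)]
    rw [if_neg h, integral_wave_mul_wave_of_le x y x' y' hn, if_neg (by tauto)]

/-- The reproducing property. The coefficient at `h⁻¹ * g` equals the one of exchanged weights at
`g⁻¹ * h`, hence an average of waves in `h`. Their pairings with the given wave are powers of `X - ζ
^ l Y`, where `X`, `Y` are the column forms at `g`; averaging extracts the term in `X ^ p Y ^ s`,
and `dimension` normalizes it to one. -/
theorem dimension_mul_integral_diagCoeff_mul_wave (x y : ℂ) (p' s' p s : ℕ) (g : SU2) :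
    (dimension (p', s') : ℂ) * ∫ h, diagCoeff p' s' (emb (h⁻¹ * g)) * wave x y p s (emb h) ∂haar =
      if (p', s') = (p, s) then wave x y p s (emb g) else 0 := by
  set N := s' + p' + 1 with hN
  have hN0 : (N : ℂ) ≠ 0 := Nat.cast_ne_zero.2 (by omega)
  set u : ℕ → ℂ := fun l => columnForm (rootOfUnity N ^ l) 1 0 (emb g⁻¹) with hu
  set v : ℕ → ℂ := fun l => columnForm (rootOfUnity N ^ l) 1 1 (emb g⁻¹) with hv
  have h1 : ∀ h, diagCoeff p' s' (emb (h⁻¹ * g)) * wave x y p s (emb h) =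
      ∑ l ∈ Finset.range N, ((N : ℂ)⁻¹ * (rootOfUnity N ^ l) ^ (N - s')) *
        (wave (u l) (v l) s' p' (emb h) * wave x y p s (emb h)) := by
    intro h
    have e : h⁻¹ * g = (g⁻¹ * h)⁻¹ := by group
    rw [e, diagCoeff_emb_inv, diagCoeff_eq_sum]
    simp only [wave_emb_mul]
    rw [Finset.mul_sum, Finset.sum_mul]
    refine Finset.sum_congr rfl fun l _ => ?_
    ring
  have hc : ∀ l, Continuous fun h => wave (u l) (v l) s' p' (emb h) * wave x y p s (emb h) :=
    fun l => (continuous_wave _ _ _ _).mul (continuous_wave _ _ _ _)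
  rw [integral_congr_ae (Eventually.of_forall h1), integral_finsetSum _ fun l _ =>
    (integrable_of_continuous (hc l)).const_mul _]
  simp only [integral_const_mul, integral_wave_mul_wave]
  by_cases h : (p', s') = (p, s)
  · obtain ⟨rfl, rfl⟩ := Prod.mk.inj h
    simp only [and_self, if_true]
    set X := columnForm x y 0 (emb g) with hX
    set Y := columnForm x y 1 (emb g) with hY
    have hdet : ∀ l, x * v l - u l * y = rootOfUnity N ^ l * (-Y) + X := by
      intro l
      have e3 : x = columnForm X Y 0 (emb g⁻¹) := by
        rw [hX, hY, ← columnForm_emb_mul, mul_inv_cancel]; simp [columnForm_apply, emb_one]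
      have e4 : y = columnForm X Y 1 (emb g⁻¹) := by
        rw [hX, hY, ← columnForm_emb_mul, mul_inv_cancel]; simp [columnForm_apply, emb_one]
      have := columnForm_det X Y (rootOfUnity N ^ l) 1 g⁻¹
      rw [← e3, ← e4] at this
      simp only [hu, hv]
      rw [this]; ring
    simp only [hdet]
    -- Taking the second exponent zero makes this a coefficient extraction from a single binomial
    -- power.
    have hs := sum_rootOfUnity_wave (-Y) 0 X 1 (p := p' + s') (s := 0) (k := s') (N := N)
      (by omega) (by omega)
    simp only [zero_add, Finset.sum_range_one, pow_zero, mul_one, add_zero, Nat.choose_zero_right,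
      Nat.cast_one, Nat.sub_zero] at hs
    rw [Finset.sum_eq_single s' (fun i _ hi => if_neg hi) (fun h => absurd (Finset.mem_range.2
      (by omega)) h), if_pos rfl, Nat.add_sub_cancel] at hs
    have h5 : ∑ l ∈ Finset.range N, (N : ℂ)⁻¹ * (rootOfUnity N ^ l) ^ (N - s') *
        ((rootOfUnity N ^ l * (-Y) + X) ^ (p' + s') * betaIntegral p' s') =
        (N : ℂ)⁻¹ * (∑ l ∈ Finset.range N, (rootOfUnity N ^ l) ^ (N - s') *
          (rootOfUnity N ^ l * (-Y) + X) ^ (p' + s')) * betaIntegral p' s' := by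
      rw [Finset.mul_sum, Finset.sum_mul]
      refine Finset.sum_congr rfl fun l _ => ?_
      ring
    rw [h5, hs, inv_mul_cancel_left₀ hN0, wave, ← hX, ← hY, neg_pow]
    linear_combination (X ^ p' * Y ^ s') * dimension_mul_choose_mul_betaIntegral p' s'
  · rw [if_neg h]
    have : ¬(s' = s ∧ p' = p) := fun hh => h (by rw [hh.1, hh.2])
    simp [this]

theorem integral_kernel_mul_wave {t : ℝ} (ht : 0 < t) (x y : ℂ) (p s : ℕ) (g : SU2) :
    ∫ h, (kernel t (h⁻¹ * g) : ℂ) * wave x y p s (emb h) ∂haar =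
      Real.exp (-(t * eigenvalue (p, s))) * wave x y p s (emb g) := by
  have hc := summable_abs_heatCoeff ht
  obtain ⟨C, hC⟩ := isCompact_univ.exists_bound_of_continuousOn
    (continuous_wave x y p s).continuousOn
  have h1 : ∀ h, (kernel t (h⁻¹ * g) : ℂ) * wave x y p s (emb h) = ∑' i : ℕ × ℕ,
      (heatCoeff t i : ℂ) * (diagCoeff i.1 i.2 (emb (h⁻¹ * g)) * wave x y p s (emb h)) := by
    intro h
    rw [kernel, ofReal_diagSeries hc (heatCoeff_swap t), ← tsum_mul_right]
    simp only [mul_assoc]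
  rw [integral_congr_ae (Eventually.of_forall h1)]
  have hcont : ∀ i : ℕ × ℕ, Continuous fun h => (heatCoeff t i : ℂ) *
      (diagCoeff i.1 i.2 (emb (h⁻¹ * g)) * wave x y p s (emb h)) := fun i => by
    have h2 := (isEigenfunction_diagCoeff i.1 i.2).1.continuous.comp continuous_emb
    have h3 := continuous_wave x y p s
    have h4 : Continuous fun h : SU2 => h⁻¹ * g := continuous_inv.mul continuous_const
    exact continuous_const.mul ((h2.comp h4).mul h3)
  have h2 := hasSum_integral_of_summable_integral_norm (μ := haar)
    (F := fun (i : ℕ × ℕ) h => (heatCoeff t i : ℂ) *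
      (diagCoeff i.1 i.2 (emb (h⁻¹ * g)) * wave x y p s (emb h)))
    (fun i => integrable_of_continuous (hcont i)) ?_
  · rw [← h2.tsum_eq, tsum_eq_single (p, s)]
    · have h3 := dimension_mul_integral_diagCoeff_mul_wave x y p s p s g
      rw [if_pos rfl] at h3
      rw [integral_const_mul, heatCoeff, ← h3]
      push_cast
      ring
    · intro i hi
      have h3 := dimension_mul_integral_diagCoeff_mul_wave x y i.1 i.2 p s g
      rw [if_neg hi] at h3
      rw [integral_const_mul, heatCoeff]
      push_cast
      linear_combination (Complex.exp (-(t * eigenvalue i))) * h3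
  · refine (hc.mul_right C).of_nonneg_of_le (fun i => integral_nonneg fun _ => norm_nonneg _)
      fun i => ?_
    have h3 : ∀ h, ‖(heatCoeff t i : ℂ) * (diagCoeff i.1 i.2 (emb (h⁻¹ * g)) *
        wave x y p s (emb h))‖ ≤ |heatCoeff t i| * C := by
      intro h
      rw [norm_mul, norm_mul, Complex.norm_real, Real.norm_eq_abs]
      refine mul_le_mul_of_nonneg_left ?_ (abs_nonneg _)
      exact (mul_le_of_le_one_left (norm_nonneg _) (norm_diagCoeff_emb_le _ _ _)).trans
        (hC h trivial)
    refine (integral_mono (integrable_of_continuous (hcont i).norm) (integrable_const _) h3).trans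
      (le_of_eq ?_)
    simp

end SubellipticSU2

namespace SubellipticSU2

/-! ### Density of the coherent functions -/

/-- A coherent function as a continuous function on `SU(2)`. -/
noncomputable def waveMap (x y : ℂ) (p s : ℕ) : C(SU2, ℂ) :=
  ⟨fun g => wave x y p s (emb g), continuous_wave x y p s⟩

/-- A matrix entry as a continuous function on `SU(2)`. -/
def entry (i j : Fin 2) : C(SU2, ℂ) := ⟨fun g => emb g i j, continuous_emb_apply i j⟩

/-- The span of the coherent functions. -/
noncomputable def waveSpan : Submodule ℂ C(SU2, ℂ) :=
  Submodule.span ℂ (Set.range fun q : (ℂ × ℂ) × (ℕ × ℕ) => waveMap q.1.1 q.1.2 q.2.1 q.2.2)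

theorem waveMap_mem (x y : ℂ) (p s : ℕ) : waveMap x y p s ∈ waveSpan :=
  Submodule.subset_span ⟨((x, y), (p, s)), rfl⟩

theorem sum_add_eq_one (p s : ℕ) (f : ℕ → ℕ → ℂ) (hp : p = 0 → f 1 0 = 0)
    (hs : s = 0 → f 0 1 = 0) :
    (∑ i ∈ Finset.range (p + 1), ∑ j ∈ Finset.range (s + 1), if i + j = 1 then f i j else 0) =
      f 1 0 + f 0 1 := by
  have h0 : ∀ i j, ¬(i + 1 + 1 + j = 1) := fun i j => by omega
  have h1 : ∀ j, ¬(0 + (j + 1 + 1) = 1) := fun j => by omega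
  have h2 : ∀ j, ¬(0 + 1 + (j + 1) = 1) := fun j => by omega
  rcases p with _ | p <;> rcases s with _ | s
  · simp [hp rfl, hs rfl]
  · simp [Finset.sum_range_succ', hp rfl]
  · simp [hs rfl]
  · simp [Finset.sum_range_succ', h0]

/-- The polarization of a coherent function. -/
noncomputable def polarization (x y x' y' : ℂ) (p s : ℕ) : C(SU2, ℂ) :=
  ((p + s + 2 : ℕ) : ℂ)⁻¹ • ∑ l ∈ Finset.range (p + s + 2),
    (rootOfUnity (p + s + 2) ^ l) ^ (p + s + 2 - 1) •
      waveMap (rootOfUnity (p + s + 2) ^ l * x' + x) (rootOfUnity (p + s + 2) ^ l * y' + y) p s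

theorem polarization_mem (x y x' y' : ℂ) (p s : ℕ) : polarization x y x' y' p s ∈ waveSpan :=
  Submodule.smul_mem _ _ (Submodule.sum_mem _ fun _ _ =>
    Submodule.smul_mem _ _ (waveMap_mem _ _ _ _))

/-- The average extracts the coefficient of `z` in the wave at `(x, y) + z (x', y')`, that is, its
derivative in the direction `(x', y')`. -/
theorem polarization_apply (x y x' y' : ℂ) (p s : ℕ) (g : SU2) :
    polarization x y x' y' p s g =
      p * columnForm x' y' 0 (emb g) * wave x y (p - 1) s (emb g) +
      s * columnForm x' y' 1 (emb g) * wave x y p (s - 1) (emb g) := by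
  have hN : ((p + s + 2 : ℕ) : ℂ) ≠ 0 := Nat.cast_ne_zero.2 (by omega)
  have h := sum_rootOfUnity_wave (columnForm x' y' 0 (emb g)) (columnForm x' y' 1 (emb g))
    (columnForm x y 0 (emb g)) (columnForm x y 1 (emb g)) (p := p) (s := s) (k := 1)
    (N := p + s + 2) (by omega) (by omega)
  rw [sum_add_eq_one p s (fun i j => (p.choose i * s.choose j : ℂ) *
    (columnForm x' y' 0 (emb g) ^ i * columnForm x y 0 (emb g) ^ (p - i) *
    (columnForm x' y' 1 (emb g) ^ j * columnForm x y 1 (emb g) ^ (s - j))))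
    (by rintro rfl; simp) (by rintro rfl; simp)] at h
  have e : polarization x y x' y' p s g = ((p + s + 2 : ℕ) : ℂ)⁻¹ *
      ∑ l ∈ Finset.range (p + s + 2), (rootOfUnity (p + s + 2) ^ l) ^ (p + s + 2 - 1) *
        ((rootOfUnity (p + s + 2) ^ l * columnForm x' y' 0 (emb g) + columnForm x y 0 (emb g)) ^ p *
        (rootOfUnity (p + s + 2) ^ l * columnForm x' y' 1 (emb g) +
          columnForm x y 1 (emb g)) ^ s) := by
    simp only [polarization, ContinuousMap.smul_apply, ContinuousMap.sum_apply, smul_eq_mul]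
    congr 1
    refine Finset.sum_congr rfl fun l _ => ?_
    have e2 : ∀ j, columnForm (rootOfUnity (p + s + 2) ^ l * x' + x)
        (rootOfUnity (p + s + 2) ^ l * y' + y) j (emb g) =
        rootOfUnity (p + s + 2) ^ l * columnForm x' y' j (emb g) + columnForm x y j (emb g) :=
      fun j => by simp only [columnForm_apply]; ring
    simp only [waveMap, wave, ContinuousMap.coe_mk, e2]
  rw [e, h, inv_mul_cancel_left₀ hN]
  simp only [wave, pow_one, pow_zero, Nat.choose_one_right, Nat.choose_zero_right, Nat.cast_one,
    Nat.sub_zero]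
  ring

theorem columnForm_swap (x y x' y' : ℂ) (g : SU2) :
    columnForm x y 0 (emb g) * columnForm x' y' 1 (emb g) =
      columnForm x' y' 0 (emb g) * columnForm x y 1 (emb g) + (x * y' - x' * y) := by
  linear_combination columnForm_det x y x' y' g

theorem entry_eq_columnForm (i j : Fin 2) (g : SU2) :
    entry i j g = columnForm (![1, 0] i) (![0, 1] i) j (emb g) := by
  fin_cases i <;> simp [entry, columnForm_apply]

/-- A Clebsch-Gordan step. Polarizing a wave of degree `p + s + 1` gives two products; the
determinant identity `columnForm_swap` turns one into the other up to a wave of lower degree, so the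
entry times the wave appears with total coefficient `p + s + 1`. -/
theorem entry_mul_waveMap_mem (i j : Fin 2) (x y : ℂ) (p s : ℕ) :
    entry i j * waveMap x y p s ∈ waveSpan := by
  set x' : ℂ := ![1, 0] i
  set y' : ℂ := ![0, 1] i
  have hn : (p + s + 1 : ℂ) ≠ 0 := by exact_mod_cast (Nat.succ_ne_zero (p + s))
  have key : ∃ q ∈ waveSpan, (p + s + 1 : ℂ) • (entry i j * waveMap x y p s) = q := by
    refine ⟨_, ?_, rfl⟩
    fin_cases j
    · have : (p + s + 1 : ℂ) • (entry i 0 * waveMap x y p s) =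
          polarization x y x' y' (p + 1) s - (s * (x * y' - x' * y)) • waveMap x y p (s - 1) := by
        ext g
        simp only [ContinuousMap.smul_apply, ContinuousMap.mul_apply, ContinuousMap.sub_apply,
          smul_eq_mul, polarization_apply, entry_eq_columnForm]
        have h := columnForm_swap x y x' y' g
        rcases s with _ | s <;>
          simp only [waveMap, wave, ContinuousMap.coe_mk, Nat.add_sub_cancel] <;> push_cast
        · ring
        · linear_combination (-(s + 1) * columnForm x y 0 (emb g) ^ p *
            columnForm x y 1 (emb g) ^ s) * h
      exact this ▸ Submodule.sub_mem _ (polarization_mem _ _ _ _ _ _)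
        (Submodule.smul_mem _ _ (waveMap_mem _ _ _ _))
    · have : (p + s + 1 : ℂ) • (entry i 1 * waveMap x y p s) =
          polarization x y x' y' p (s + 1) + (p * (x * y' - x' * y)) • waveMap x y (p - 1) s := by
        ext g
        simp only [ContinuousMap.smul_apply, ContinuousMap.mul_apply, ContinuousMap.add_apply,
          smul_eq_mul, polarization_apply, entry_eq_columnForm]
        have h := columnForm_swap x y x' y' g
        rcases p with _ | p <;>
          simp only [waveMap, wave, ContinuousMap.coe_mk, Nat.add_sub_cancel] <;> push_cast
        · ring
        · linear_combination ((p + 1) * columnForm x y 0 (emb g) ^ p *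
            columnForm x y 1 (emb g) ^ s) * h
      exact this ▸ Submodule.add_mem _ (polarization_mem _ _ _ _ _ _)
        (Submodule.smul_mem _ _ (waveMap_mem _ _ _ _))
  obtain ⟨q, hq, h⟩ := key
  have : entry i j * waveMap x y p s = (p + s + 1 : ℂ)⁻¹ • q := by
    rw [← h, inv_smul_smul₀ hn]
  rw [this]
  exact Submodule.smul_mem _ _ hq

theorem entry_mul_mem (i j : Fin 2) {f : C(SU2, ℂ)} (hf : f ∈ waveSpan) :
    entry i j * f ∈ waveSpan := by
  induction hf using Submodule.span_induction with
  | mem f hf =>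
    obtain ⟨q, rfl⟩ := hf
    exact entry_mul_waveMap_mem _ _ _ _ _ _
  | zero => rw [mul_zero]; exact Submodule.zero_mem _
  | add f h _ _ hf hh => rw [mul_add]; exact Submodule.add_mem _ hf hh
  | smul c f _ hf => rw [mul_smul_comm]; exact Submodule.smul_mem _ _ hf

/-- The entries of the matrices in `SU(2)`. -/
def entries : Set C(SU2, ℂ) := Set.range fun q : Fin 2 × Fin 2 => entry q.1 q.2

theorem star_entry (i j : Fin 2) :
    star (entry i j) = entry (1 - i) (1 - j) ∨ star (entry i j) = -entry (1 - i) (1 - j) := by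
  fin_cases i <;> fin_cases j
  · exact Or.inl (ContinuousMap.ext fun g => (emb_one_one g).symm)
  · refine Or.inr (ContinuousMap.ext fun g => ?_)
    have := emb_one_zero g
    change star (emb g 0 1) = -emb g 1 0
    rw [this, neg_neg]
  · refine Or.inr (ContinuousMap.ext fun g => ?_)
    have := emb_one_zero g
    change star (emb g 1 0) = -emb g 0 1
    rw [this, star_neg, star_star]
  · refine Or.inl (ContinuousMap.ext fun g => ?_)
    change star (emb g 1 1) = emb g 0 0
    rw [emb_one_one, star_star]

theorem mul_mem_of_mem_adjoin {f h : C(SU2, ℂ)} (hf : f ∈ StarAlgebra.adjoin ℂ entries)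
    (hh : h ∈ waveSpan) : f * h ∈ waveSpan := by
  have hf' : f ∈ Algebra.adjoin ℂ (entries ∪ star entries) := hf
  induction hf' using Algebra.adjoin_induction generalizing h with
  | mem f hf =>
    rename_i hmem
    rcases hmem with ⟨q, rfl⟩ | ⟨q, hq⟩
    · exact entry_mul_mem _ _ hh
    · have : f = star (entry q.1 q.2) := by
        have h2 : star f = entry q.1 q.2 := hq.symm
        rw [← h2, star_star]
      rcases star_entry q.1 q.2 with h2 | h2 <;> rw [this, h2]
      · exact entry_mul_mem _ _ hh
      · rw [neg_mul]; exact Submodule.neg_mem _ (entry_mul_mem _ _ hh)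
  | algebraMap c =>
    rw [← Algebra.smul_def]
    exact Submodule.smul_mem _ _ hh
  | add f₁ f₂ _ _ h₁ h₂ =>
    rw [add_mul]
    exact Submodule.add_mem _ (h₁ ‹_› hh) (h₂ ‹_› hh)
  | mul f₁ f₂ _ _ h₁ h₂ =>
    rw [mul_assoc]
    exact h₁ ‹_› (h₂ ‹_› hh)

/-- Stone-Weierstrass for the star algebra generated by the entries. That algebra lies in
`waveSpan`, because the span contains `1` and is stable under multiplication by entries and their
conjugates. -/
theorem exists_mem_waveSpan_near {f : SU2 → ℝ} (hf : Continuous f) {ε : ℝ} (hε : 0 < ε) :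
    ∃ φ ∈ waveSpan, ∀ g, |f g - (φ g).re| < ε := by
  have hsep : (StarAlgebra.adjoin ℂ entries).SeparatesPoints := by
    intro g h hgh
    have : ∃ i j, emb g i j ≠ emb h i j := by
      by_contra! hh
      exact hgh (emb_injective (by ext i j; exact hh i j))
    obtain ⟨i, j, hij⟩ := this
    exact ⟨entry i j, ⟨entry i j, StarAlgebra.subset_adjoin ℂ _ ⟨(i, j), rfl⟩, rfl⟩, hij⟩
  have htop := ContinuousMap.starSubalgebra_topologicalClosure_eq_top_of_separatesPoints _ hsep
  set F : C(SU2, ℂ) := ⟨fun g => (f g : ℂ), Complex.continuous_ofReal.comp hf⟩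
  have hF : F ∈ closure (StarAlgebra.adjoin ℂ entries : Set C(SU2, ℂ)) := by
    have : F ∈ (StarAlgebra.adjoin ℂ entries).topologicalClosure := by rw [htop]; trivial
    exact this
  obtain ⟨φ, hφ, hd⟩ := Metric.mem_closure_iff.1 hF ε hε
  refine ⟨φ, ?_, fun g => ?_⟩
  · have h1 : (1 : C(SU2, ℂ)) ∈ waveSpan := by
      have : (1 : C(SU2, ℂ)) = waveMap 0 0 0 0 := by ext g; simp [waveMap, wave]
      rw [this]; exact waveMap_mem _ _ _ _
    simpa using mul_mem_of_mem_adjoin hφ h1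
  · have h1 := (ContinuousMap.dist_apply_le_dist g).trans_lt hd
    rw [dist_eq_norm] at h1
    have h2 := Complex.abs_re_le_norm (F g - φ g)
    rw [Complex.sub_re] at h2
    exact h2.trans_lt h1

/-! ### The heat flow -/

theorem tendstoUniformly_congr {β : Type} [UniformSpace β] {F F' : ℝ → SU2 → β} {f : SU2 → β} {l : Filter ℝ}
    (h : TendstoUniformly F f l) (he : ∀ᶠ t in l, ∀ g, F t g = F' t g) :
    TendstoUniformly F' f l := by
  intro u hu
  filter_upwards [h u hu, he] with t h1 h2 g
  rw [← h2]
  exact h1 g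

/-- Convolution with the heat kernel. -/
noncomputable def conv (t : ℝ) (f : SU2 → ℝ) (g : SU2) : ℝ := ∫ h, kernel t (h⁻¹ * g) * f h ∂haar

/-- The heat flow with initial datum `f`. -/
noncomputable def heatFlow (f : SU2 → ℝ) (t : ℝ) : SU2 → ℝ := if t ≤ 0 then f else conv t f

theorem heatFlow_of_pos (f : SU2 → ℝ) {t : ℝ} (ht : 0 < t) : heatFlow f t = conv t f :=
  if_neg ht.not_ge

theorem continuous_kernel_inv_mul {t : ℝ} (ht : 0 < t) (g : SU2) :
    Continuous fun h => kernel t (h⁻¹ * g) :=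
  (isSmooth_kernel ht).continuous.comp (continuous_inv.mul continuous_const)

theorem integrable_kernel_mul {t : ℝ} (ht : 0 < t) (g : SU2) {f : SU2 → ℝ} (hf : Continuous f) :
    Integrable (fun h => kernel t (h⁻¹ * g) * f h) haar :=
  integrable_of_continuous ((continuous_kernel_inv_mul ht g).mul hf)

theorem isSmooth_conv {t : ℝ} (ht : 0 < t) {f : SU2 → ℝ} (hf : Continuous f) :
    IsSmooth (conv t f) := (isSmooth_kernel ht).convolution hf

theorem conv_sub {t : ℝ} (ht : 0 < t) {f h : SU2 → ℝ} (hf : Continuous f) (hh : Continuous h)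
    (g : SU2) : conv t (fun x => f x - h x) g = conv t f g - conv t h g := by
  simp only [conv, mul_sub]
  exact integral_sub (integrable_kernel_mul ht g hf) (integrable_kernel_mul ht g hh)

theorem hasDerivAt_conv {t : ℝ} (ht : 0 < t) {f : SU2 → ℝ} (hf : Continuous f) (g : SU2) :
    HasDerivAt (fun s => conv s f g) (sublaplacian (conv t f) g) t := by
  have e : sublaplacian (conv t f) g = ∫ h, sublaplacian (kernel t) (h⁻¹ * g) * f h ∂haar :=
    sublaplacian_convolution (isSmooth_kernel ht) hf g
  rw [e]
  have hcont : Continuous fun h => sublaplacian (kernel t) (h⁻¹ * g) * f h :=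
    ((isSmooth_kernel ht).sublaplacian.continuous.comp (continuous_inv.mul continuous_const)).mul hf
  refine (hasDerivAt_integral_of_dominated_loc_of_deriv_le (μ := haar)
    (F := fun s h => kernel s (h⁻¹ * g) * f h)
    (F' := fun s h => sublaplacian (kernel s) (h⁻¹ * g) * f h)
    (bound := fun h => (∑' i, eigenvalue i * heatCoeff (t / 2) i) * ‖f h‖)
    (Ioi_mem_nhds (half_lt_self ht)) ?_ (integrable_kernel_mul ht g hf)
    hcont.aestronglyMeasurable (Eventually.of_forall fun h s hs => ?_)
    ((integrable_of_continuous hf.norm).const_mul _)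
    (Eventually.of_forall fun h s hs => ?_)).2
  · filter_upwards [Ioi_mem_nhds ht] with s hs using
      (integrable_kernel_mul hs g hf).aestronglyMeasurable
  · rw [norm_mul]
    exact mul_le_mul_of_nonneg_right (abs_sublaplacian_kernel_le (half_pos ht) (le_of_lt hs) _)
      (norm_nonneg _)
  · exact (hasDerivAt_kernel ((half_pos ht).trans hs) _).mul_const _

theorem continuousAt_conv {t : ℝ} (ht : 0 < t) {f : SU2 → ℝ} (hf : Continuous f) (g : SU2) :
    ContinuousAt (fun q : ℝ × SU2 => conv q.1 f q.2) (t, g) := by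
  have hm : Set.Ioi (t / 2) ×ˢ (Set.univ : Set SU2) ∈ 𝓝 (t, g) :=
    (isOpen_Ioi.prod isOpen_univ).mem_nhds ⟨half_lt_self ht, trivial⟩
  refine continuousAt_of_dominated (bound := fun h => (∑' i, heatCoeff (t / 2) i) * ‖f h‖)
    ?_ ?_ ((integrable_of_continuous hf.norm).const_mul _) (Eventually.of_forall fun h => ?_)
  · filter_upwards [hm] with q hq using
      (integrable_kernel_mul ((half_pos ht).trans hq.1) q.2 hf).aestronglyMeasurable
  · filter_upwards [hm] with q hq
    refine Eventually.of_forall fun h => ?_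
    rw [norm_mul]
    exact mul_le_mul_of_nonneg_right (abs_kernel_le (half_pos ht) (le_of_lt hq.1) _)
      (norm_nonneg _)
  · have h1 : ContinuousAt (fun q : ℝ × SU2 => kernel q.1 q.2) (t, h⁻¹ * g) :=
      continuousOn_kernel.continuousAt ((isOpen_Ioi.prod isOpen_univ).mem_nhds ⟨ht, trivial⟩)
    have h2 : ContinuousAt (fun q : ℝ × SU2 => (q.1, h⁻¹ * q.2)) (t, g) := by fun_prop
    exact (ContinuousAt.comp (f := fun q : ℝ × SU2 => (q.1, h⁻¹ * q.2)) h1 h2).mul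
      continuousAt_const

/-- Only joint continuity at time zero needs the hypothesis: uniform convergence controls the time
variable and continuity of `f` the space variable. -/
theorem isHeatSolution_heatFlow_of_tendstoUniformly {f : SU2 → ℝ} (hf : Continuous f)
    (h : TendstoUniformly (fun t => conv t f) f (𝓝[>] 0)) : IsHeatSolution f (heatFlow f) := by
  refine ⟨if_pos le_rfl, ?_, fun t ht => ?_, fun t ht g => ?_⟩
  · rintro ⟨t, g⟩ ⟨ht, -⟩
    rcases (show 0 ≤ t from ht).eq_or_lt with rfl | hpos
    · refine ContinuousWithinAt.mono_of_mem_nhdsWithin ?_ self_mem_nhdsWithin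
      rw [ContinuousWithinAt, show heatFlow f (0, g).1 (0, g).2 = f g by simp [heatFlow]]
      rw [Metric.tendsto_nhds]
      intro ε hε
      have h1 := Metric.tendstoUniformly_iff.1 h (ε / 2) (half_pos hε)
      obtain ⟨δ, hδ, hδ'⟩ := mem_nhdsGT_iff_exists_Ioo_subset.1 h1
      have h2 := Metric.tendsto_nhds.1 (hf.tendsto g) (ε / 2) (half_pos hε)
      have h3 : ∀ᶠ q : ℝ × SU2 in 𝓝 ((0 : ℝ), g), q.1 < δ ∧ dist (f q.2) (f g) < ε / 2 :=
        (continuous_fst.continuousAt.eventually (Iio_mem_nhds hδ)).and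
          ((continuous_snd.tendsto ((0 : ℝ), g)).eventually h2)
      filter_upwards [mem_nhdsWithin_of_mem_nhds h3, self_mem_nhdsWithin] with q hq hq0
      rcases (show 0 ≤ q.1 from hq0.1).eq_or_lt with h0 | h0
      · rw [heatFlow, if_pos h0.ge]
        linarith [hq.2]
      · rw [heatFlow_of_pos f h0]
        have h4 : dist (f q.2) (conv q.1 f q.2) < ε / 2 := hδ' ⟨h0, hq.1⟩ q.2
        rw [dist_comm] at h4
        linarith [dist_triangle (conv q.1 f q.2) (f q.2) (f g), hq.2]
    · have h1 := continuousAt_conv hpos hf g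
      refine (h1.congr ?_).continuousWithinAt
      filter_upwards [(isOpen_Ioi.prod isOpen_univ).mem_nhds
        (show (t, g) ∈ Set.Ioi (0 : ℝ) ×ˢ (Set.univ : Set SU2) from ⟨hpos, trivial⟩)] with q hq
      rw [heatFlow_of_pos f hq.1]
  · rw [heatFlow_of_pos f ht]; exact isSmooth_conv ht hf
  · rw [heatFlow_of_pos f ht]
    refine (hasDerivAt_conv ht hf g).congr_of_eventuallyEq ?_
    filter_upwards [Ioi_mem_nhds ht] with s hs
    rw [heatFlow_of_pos f hs]

theorem continuous_re_apply (φ : C(SU2, ℂ)) : Continuous fun g => (φ g).re :=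
  Complex.continuous_re.comp φ.continuous

theorem re_integral_kernel_mul {t : ℝ} (ht : 0 < t) (φ : C(SU2, ℂ)) (g : SU2) :
    (∫ h, (kernel t (h⁻¹ * g) : ℂ) * φ h ∂haar).re = conv t (fun g => (φ g).re) g := by
  have hi : Integrable (fun h => (kernel t (h⁻¹ * g) : ℂ) * φ h) haar :=
    integrable_of_continuous ((Complex.continuous_ofReal.comp
      (continuous_kernel_inv_mul ht g)).mul φ.continuous)
  refine (integral_re hi).symm.trans ?_
  simp [conv]

theorem tendstoUniformly_integral_kernel_mul {φ : C(SU2, ℂ)} (hφ : φ ∈ waveSpan) :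
    TendstoUniformly (fun t g => ∫ h, (kernel t (h⁻¹ * g) : ℂ) * φ h ∂haar) φ (𝓝[>] 0) := by
  have hi : ∀ {t : ℝ}, 0 < t → ∀ (φ : C(SU2, ℂ)) g,
      Integrable (fun h => (kernel t (h⁻¹ * g) : ℂ) * φ h) haar := fun ht φ g =>
    integrable_of_continuous ((Complex.continuous_ofReal.comp
      (continuous_kernel_inv_mul ht g)).mul φ.continuous)
  induction hφ using Submodule.span_induction with
  | mem φ hφ =>
    obtain ⟨⟨⟨x, y⟩, ⟨p, s⟩⟩, rfl⟩ := hφ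
    obtain ⟨C, hC⟩ := isCompact_univ.exists_bound_of_continuousOn
      (continuous_wave x y p s).continuousOn
    have hC0 : 0 ≤ C := (norm_nonneg _).trans (hC 1 trivial)
    have h1 : Tendsto (fun t : ℝ => |1 - Real.exp (-(t * eigenvalue (p, s)))| * C) (𝓝[>] 0)
        (𝓝 0) := by
      have : Continuous fun t : ℝ => |1 - Real.exp (-(t * eigenvalue (p, s)))| * C := by fun_prop
      have h2 := this.tendsto 0
      simp only [zero_mul, neg_zero, Real.exp_zero, sub_self, abs_zero] at h2
      exact h2.mono_left nhdsWithin_le_nhds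
    rw [Metric.tendstoUniformly_iff]
    intro ε hε
    filter_upwards [h1.eventually (Iio_mem_nhds hε), self_mem_nhdsWithin] with t ht ht0 g
    refine lt_of_le_of_lt ?_ ht
    have h3 := integral_kernel_mul_wave ht0 x y p s g
    simp only [waveMap, ContinuousMap.coe_mk]
    rw [h3, dist_eq_norm, ← one_sub_mul, norm_mul, ← Complex.ofReal_one, ← Complex.ofReal_sub,
      Complex.norm_real, Real.norm_eq_abs]
    exact mul_le_mul_of_nonneg_left (hC g trivial) (abs_nonneg _)
  | zero =>
    rw [Metric.tendstoUniformly_iff]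
    intro ε hε
    exact Eventually.of_forall fun t g => by simpa using hε
  | add φ ψ _ _ h1 h2 =>
    refine tendstoUniformly_congr (h1.add h2) ?_
    filter_upwards [self_mem_nhdsWithin] with t ht g
    simp only [ContinuousMap.add_apply, mul_add, Pi.add_apply]
    exact (integral_add (hi ht φ g) (hi ht ψ g)).symm
  | smul c φ _ h1 =>
    have := (uniformContinuous_const_smul (M := ℂ) (X := ℂ) c).comp_tendstoUniformly h1
    refine tendstoUniformly_congr this ?_
    filter_upwards with t g
    simp only [Function.comp, ContinuousMap.smul_apply, smul_eq_mul, mul_left_comm _ c]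
    exact (integral_const_mul c _).symm

theorem isHeatSolution_re {φ : C(SU2, ℂ)} (hφ : φ ∈ waveSpan) :
    IsHeatSolution (fun g => (φ g).re) (heatFlow fun g => (φ g).re) := by
  refine isHeatSolution_heatFlow_of_tendstoUniformly (continuous_re_apply φ) ?_
  refine tendstoUniformly_congr (Complex.reCLM.uniformContinuous.comp_tendstoUniformly
    (tendstoUniformly_integral_kernel_mul hφ)) ?_
  filter_upwards [self_mem_nhdsWithin] with t ht g
  exact re_integral_kernel_mul ht φ g

/-- On the real parts of `waveSpan` the convolution is a genuine heat solution, so the maximum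
principle applies. The constant `K` bounds the kernel at the fixed time `t`; an approximation within
`ε / (K + 1)` then costs `ε` in all. -/
theorem abs_conv_le {t : ℝ} (ht : 0 < t) {f : SU2 → ℝ} (hf : Continuous f) {M : ℝ}
    (hM : ∀ g, |f g| ≤ M) (g : SU2) : |conv t f g| ≤ M := by
  set K := ∑' i, heatCoeff t i with hK
  have hK0 : 0 ≤ K := (abs_nonneg _).trans (abs_kernel_le ht le_rfl 1)
  refine le_of_forall_pos_le_add fun ε hε => ?_
  obtain ⟨φ, hφ, hd⟩ := exists_mem_waveSpan_near hf (ε := ε / (K + 1)) (by positivity)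
  have hφc := continuous_re_apply φ
  have h1 : |conv t (fun g => (φ g).re) g| ≤ M + ε / (K + 1) := by
    have := (isHeatSolution_re hφ).abs_le (M := M + ε / (K + 1)) (fun g => by
      have h2 := abs_le.1 (hd g).le
      have h3 := abs_le.1 (hM g)
      exact abs_le.2 ⟨by linarith, by linarith⟩) ht.le g
    rwa [heatFlow_of_pos _ ht] at this
  have h2 : |conv t (fun g => f g - (φ g).re) g| ≤ K * (ε / (K + 1)) := by
    have h3 : ∀ h, ‖kernel t (h⁻¹ * g) * (f h - (φ h).re)‖ ≤ K * (ε / (K + 1)) := fun h => by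
      rw [norm_mul]
      exact mul_le_mul (abs_kernel_le ht le_rfl _) (hd h).le (norm_nonneg _) hK0
    have h4 := norm_integral_le_of_norm_le_const (μ := haar) (Eventually.of_forall h3)
    simpa [conv] using h4
  rw [conv_sub ht hf hφc] at h2
  have h5 : K * (ε / (K + 1)) + ε / (K + 1) = ε := by field_simp
  have h6 := abs_le.1 h1
  have h7 := abs_le.1 h2
  exact abs_le.2 ⟨by linarith, by linarith⟩

/-- Three-epsilon argument. It relies on the contraction bound, which is uniform in `t`, rather than
on the time-dependent bound of the kernel. -/
theorem tendstoUniformly_conv {f : SU2 → ℝ} (hf : Continuous f) :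
    TendstoUniformly (fun t => conv t f) f (𝓝[>] 0) := by
  rw [Metric.tendstoUniformly_iff]
  intro ε hε
  obtain ⟨φ, hφ, hd⟩ := exists_mem_waveSpan_near hf (ε := ε / 3) (by positivity)
  have hφc := continuous_re_apply φ
  have h1 := Metric.tendstoUniformly_iff.1 (tendstoUniformly_integral_kernel_mul hφ) (ε / 3)
    (by positivity)
  filter_upwards [h1, self_mem_nhdsWithin] with t ht ht0 g
  have h2 := (Complex.abs_re_le_norm _).trans_lt (by simpa only [dist_eq_norm] using ht g)
  rw [Complex.sub_re, re_integral_kernel_mul ht0] at h2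
  have h3 := abs_conv_le (f := fun g => f g - (φ g).re) ht0 (hf.sub hφc) (fun g => (hd g).le) g
  rw [conv_sub ht0 hf hφc] at h3
  have h4 := hd g
  rw [Real.dist_eq]
  rw [abs_lt] at h2 h4 ⊢
  rw [abs_le] at h3
  exact ⟨by linarith, by linarith⟩

theorem isHeatSolution_heatFlow {f : SU2 → ℝ} (hf : IsSmooth f) :
    IsHeatSolution f (heatFlow f) :=
  isHeatSolution_heatFlow_of_tendstoUniformly hf.continuous (tendstoUniformly_conv hf.continuous)

theorem isHeatSolution_heatSemigroup {f : SU2 → ℝ} (hf : IsSmooth f) :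
    IsHeatSolution f fun t => heatSemigroup t f :=
  Classical.epsilon_spec (p := IsHeatSolution f) ⟨_, isHeatSolution_heatFlow hf⟩

theorem heatSemigroup_eq_conv {f : SU2 → ℝ} (hf : IsSmooth f) {t : ℝ} (ht : 0 < t) :
    heatSemigroup t f = conv t f := by
  rw [← heatFlow_of_pos f ht]
  exact (isHeatSolution_heatSemigroup hf).unique (isHeatSolution_heatFlow hf) ht.le

end SubellipticSU2

namespace SubellipticSU2

/-! ### The heat kernel -/

theorem kernel_inv (t : ℝ) (g : SU2) : kernel t g⁻¹ = kernel t g := diagSeries_inv _ g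

theorem conv_one (t : ℝ) (f : SU2 → ℝ) : conv t f 1 = ∫ h, kernel t h * f h ∂haar := by
  simp only [conv, mul_one, kernel_inv]

theorem isHeatKernel_kernel {t : ℝ} (ht : 0 < t) : IsHeatKernel t (kernel t) :=
  ⟨isSmooth_kernel ht, fun f hf => by rw [heatSemigroup_eq_conv hf ht, conv_one]⟩

theorem eq_zero_of_integral_sq_eq_zero {f : SU2 → ℝ} (hf : Continuous f)
    (h : ∫ g, f g ^ 2 ∂haar = 0) : f = 0 := by
  have h1 := (integral_eq_zero_iff_of_nonneg (fun g => sq_nonneg (f g))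
    (integrable_of_continuous (hf.pow 2))).1 h
  have h2 := (Continuous.ae_eq_iff_eq haar (hf.pow 2) continuous_const).1 h1
  funext g
  exact pow_eq_zero_iff two_ne_zero |>.1 (congrFun h2 g)

/-- Testing both densities against their own smooth difference gives it zero `L²` norm. -/
theorem IsHeatKernel.unique {t : ℝ} {p q : SU2 → ℝ} (hp : IsHeatKernel t p)
    (hq : IsHeatKernel t q) : p = q := by
  have hs := hp.1.sub hq.1
  have h1 := (hp.2 _ hs).symm.trans (hq.2 _ hs)
  have h2 : ∫ g, (p g - q g) ^ 2 ∂haar = 0 := by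
    have h3 := integral_sub (integrable_of_continuous (hp.1.mul hs).continuous)
      (integrable_of_continuous (hq.1.mul hs).continuous)
    rw [h1, sub_self] at h3
    rw [← h3]
    refine integral_congr_ae (Eventually.of_forall fun g => ?_)
    simp only; ring
  have h3 := eq_zero_of_integral_sq_eq_zero hs.continuous h2
  funext g
  exact sub_eq_zero.1 (congrFun h3 g)

theorem isHeatKernel_heatKernel {t : ℝ} (ht : 0 < t) : IsHeatKernel t (heatKernel t) :=
  Classical.epsilon_spec (p := IsHeatKernel t) ⟨_, isHeatKernel_kernel ht⟩

theorem heatKernel_eq_kernel {t : ℝ} (ht : 0 < t) : heatKernel t = kernel t :=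
  (isHeatKernel_heatKernel ht).unique (isHeatKernel_kernel ht)

/-! ### Spectral expansion of the norm and energy of the kernel. -/

theorem integral_kernel_mul_diagCoeff {t : ℝ} (ht : 0 < t) (i : ℕ × ℕ) :
    ∫ h, kernel t h * (diagCoeff i.1 i.2 (emb h)).re ∂haar = Real.exp (-(t * eigenvalue i)) := by
  obtain ⟨p, s⟩ := i
  have hk : Continuous fun h => (kernel t (h⁻¹ * 1) : ℂ) :=
    Complex.continuous_ofReal.comp (continuous_kernel_inv_mul ht 1)
  have h1 : ∫ h, (kernel t (h⁻¹ * 1) : ℂ) * diagCoeff p s (emb h) ∂haar =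
      Real.exp (-(t * eigenvalue (p, s))) * diagCoeff p s (emb 1) := by
    rw [diagCoeff_eq_sum]
    simp only [Finset.mul_sum]
    rw [integral_finsetSum]
    · refine Finset.sum_congr rfl fun l _ => ?_
      have h2 := integral_kernel_mul_wave ht (rootOfUnity (p + s + 1) ^ l) 1 p s 1
      simp only [mul_left_comm (Complex.ofReal _)]
      rw [integral_const_mul, integral_const_mul, h2]
    · intro l _
      exact integrable_of_continuous (hk.mul (continuous_const.mul
        (continuous_const.mul (continuous_wave _ _ _ _))))
  rw [diagCoeff_emb_one, mul_one] at h1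
  have h2 : Continuous fun h => diagCoeff p s (emb h) :=
    (isEigenfunction_diagCoeff p s).1.continuous.comp continuous_emb
  have h3 := (integral_re (integrable_of_continuous (hk.mul h2))).trans (congrArg Complex.re h1)
  rw [Complex.ofReal_re] at h3
  rw [← h3]
  refine integral_congr_ae (Eventually.of_forall fun h => ?_)
  simp [kernel_inv]

theorem integral_kernel_mul_diagSeries {t : ℝ} (ht : 0 < t) {c : ℕ × ℕ → ℝ}
    (hc : Summable fun i => |c i|) :
    ∫ h, kernel t h * diagSeries c h ∂haar = ∑' i, c i * Real.exp (-(t * eigenvalue i)) := by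
  have hk := (isSmooth_kernel ht).continuous
  obtain ⟨C, hC⟩ := isCompact_univ.exists_bound_of_continuousOn hk.continuousOn
  have hcont : ∀ i : ℕ × ℕ, Continuous fun h =>
      kernel t h * (c i * (diagCoeff i.1 i.2 (emb h)).re) := fun i =>
    hk.mul (continuous_const.mul (continuous_re_diagCoeff i))
  have h1 := hasSum_integral_of_summable_integral_norm (μ := haar)
    (F := fun (i : ℕ × ℕ) h => kernel t h * (c i * (diagCoeff i.1 i.2 (emb h)).re))
    (fun i => integrable_of_continuous (hcont i)) ?_
  · simp only [tsum_mul_left] at h1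
    have h2 := h1.tsum_eq
    simp only [diagSeries]
    rw [← h2]
    refine tsum_congr fun i => ?_
    rw [← integral_kernel_mul_diagCoeff ht i, ← integral_const_mul]
    refine integral_congr_ae (Eventually.of_forall fun h => ?_)
    simp only; ring
  · refine (hc.mul_left C).of_nonneg_of_le (fun i => integral_nonneg fun _ => norm_nonneg _)
      fun i => ?_
    have h3 : ∀ h, ‖kernel t h * (c i * (diagCoeff i.1 i.2 (emb h)).re)‖ ≤ C * |c i| := by
      intro h
      rw [norm_mul]
      exact mul_le_mul (hC h trivial) (norm_mul_re_diagCoeff_le _ i h) (norm_nonneg _)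
        ((norm_nonneg _).trans (hC h trivial))
    refine (integral_mono (integrable_of_continuous (hcont i).norm) (integrable_const _) h3).trans
      (le_of_eq ?_)
    simp

theorem heatCoeff_mul_exp (t : ℝ) (i : ℕ × ℕ) :
    heatCoeff t i * Real.exp (-(t * eigenvalue i)) = heatCoeff (2 * t) i := by
  rw [heatCoeff, heatCoeff, mul_assoc, ← Real.exp_add]
  ring_nf

theorem diagSeries_one (c : ℕ × ℕ → ℝ) : diagSeries c 1 = ∑' i, c i := by
  simp [diagSeries, diagCoeff_emb_one]

/-- The semigroup law at the identity: pairing `pₜ` with itself multiplies each coefficient by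
another factor `exp (-t eigenvalue)`. -/
theorem integral_kernel_sq {t : ℝ} (ht : 0 < t) :
    ∫ h, kernel t h ^ 2 ∂haar = kernel (2 * t) 1 := by
  have h := integral_kernel_mul_diagSeries ht (summable_abs_heatCoeff ht)
  simp only [heatCoeff_mul_exp] at h
  have e : kernel (2 * t) 1 = ∑' i, heatCoeff (2 * t) i := diagSeries_one _
  rw [e, ← h]
  simp only [sq]; rfl

theorem integral_kernel_mul_sublaplacian {t : ℝ} (ht : 0 < t) :
    ∫ h, kernel t h * sublaplacian (kernel t) h ∂haar =
      -∑' i, eigenvalue i * heatCoeff (2 * t) i := by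
  have h := integral_kernel_mul_diagSeries ht (c := fun i => -eigenvalue i * heatCoeff t i)
    (by simpa only [abs_neg_eigenvalue_mul_heatCoeff] using summable_eigenvalue_mul_heatCoeff ht)
  rw [funext (sublaplacian_kernel ht), h, ← tsum_neg]
  refine tsum_congr fun i => ?_
  rw [← heatCoeff_mul_exp]; ring

theorem hasDerivAt_integral_heatKernel_sq {t : ℝ} (ht : 0 < t) :
    HasDerivAt (fun s => ∫ g, heatKernel s g ^ 2 ∂haar)
      (-(2 * ∑' i, eigenvalue i * heatCoeff (2 * t) i)) t := by
  have h1 := hasDerivAt_kernel (t := 2 * t) (by linarith) 1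
  rw [sublaplacian_kernel (by linarith), diagSeries_one] at h1
  have h2 := h1.comp t ((hasDerivAt_id t).const_mul 2)
  refine (h2.congr_of_eventuallyEq ?_).congr_deriv ?_
  · filter_upwards [Ioi_mem_nhds ht] with s hs
    rw [heatKernel_eq_kernel hs, integral_kernel_sq hs]; rfl
  · simp only [neg_mul, tsum_neg]; ring

theorem gradConst_eq {t : ℝ} (ht : 0 < t) :
    gradConst t = (∑' i, eigenvalue i * heatCoeff (2 * t) i) / 2 := by
  rw [gradConst, (hasDerivAt_integral_heatKernel_sq ht).deriv]; ring

theorem gradConst_pos {t : ℝ} (ht : 0 < t) : 0 < gradConst t := by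
  rw [gradConst_eq ht]
  refine half_pos ((summable_eigenvalue_mul_heatCoeff (by linarith)).tsum_pos
    (fun i => mul_nonneg (eigenvalue_nonneg i) (heatCoeff_pos _ i).le) (1, 0) ?_)
  exact mul_pos (by norm_num [eigenvalue]) (heatCoeff_pos _ _)

/-! ### Rotation symmetry of the heat kernel -/

/-- The eighth root of unity `exp (i π / 4)`. -/
noncomputable def eighthRoot : ℂ := Complex.exp ((Real.pi / 4 : ℝ) * Complex.I)

theorem norm_eighthRoot : ‖eighthRoot‖ = 1 := Complex.norm_exp_ofReal_mul_I _

theorem eighthRoot_sq : eighthRoot * eighthRoot = Complex.I := by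
  rw [eighthRoot, ← Complex.exp_add, ← add_mul, ← Complex.ofReal_add]
  rw [show Real.pi / 4 + Real.pi / 4 = Real.pi / 2 by ring]
  push_cast
  exact Complex.exp_pi_div_two_mul_I

theorem star_eighthRoot_sq : star eighthRoot * star eighthRoot = -Complex.I := by
  rw [← star_mul', eighthRoot_sq]; simp

/-- The diagonal element that rotates `X` to `Y`. -/
noncomputable def rotation : SU2 := diagonal eighthRoot norm_eighthRoot

theorem emb_rotation_conj (g : SU2) : emb (rotation * g * rotation⁻¹) =
    ![![emb g 0 0, Complex.I * emb g 0 1], ![-Complex.I * emb g 1 0, emb g 1 1]] := by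
  have h0 := star_mul_self_of_norm_eq_one norm_eighthRoot
  have h1 := eighthRoot_sq
  have h2 := star_eighthRoot_sq
  ext i j
  simp only [emb_mul, emb_inv, rotation, emb_diagonal]
  fin_cases i <;> fin_cases j <;>
    simp only [Fin.zero_eta, Fin.mk_one, Matrix.cons_val_zero, Matrix.cons_val_one, star_zero,
      star_star, zero_mul, mul_zero, add_zero, zero_add]
  · linear_combination (emb g 0 0) * h0
  · linear_combination (emb g 0 1) * h1
  · linear_combination (emb g 1 0) * h2
  · linear_combination (emb g 1 1) * h0

/-- Conjugation multiplies `b` by `I` and `c` by `-I`, while the diagonal coefficients depend only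
on `a`, `d` and the product `b c`. -/
theorem kernel_rotation_conj (t : ℝ) (g : SU2) :
    kernel t (rotation * g * rotation⁻¹) = kernel t g := by
  refine diagSeries_congr_emb ?_ ?_ _
  · rw [emb_rotation_conj]; rfl
  · have := Complex.I_mul_I
    rw [emb_rotation_conj]
    simp only [Matrix.cons_val_zero, Matrix.cons_val_one]
    linear_combination (-(emb g 0 1 * emb g 1 0)) * this

theorem emb_expX (s : ℝ) : emb (expX s) = ![![(Real.cos s : ℂ), (Real.sin s : ℂ)],
    ![-(Real.sin s : ℂ), (Real.cos s : ℂ)]] := exp_smul_pauliX s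

theorem emb_expY (s : ℝ) : emb (expY s) = ![![(Real.cos s : ℂ), (Real.sin s : ℂ) * Complex.I],
    ![(Real.sin s : ℂ) * Complex.I, (Real.cos s : ℂ)]] := exp_smul_pauliY s

theorem rotation_expX (s : ℝ) : rotation * expX s * rotation⁻¹ = expY s := by
  apply emb_injective
  rw [emb_rotation_conj, emb_expX, emb_expY]
  simp [mul_comm]

theorem rotation_expY (s : ℝ) : rotation * expY (-s) * rotation⁻¹ = expX s := by
  apply emb_injective
  rw [emb_rotation_conj, emb_expX, emb_expY]
  have hI := Complex.I_mul_I
  ext i j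
  fin_cases i <;> fin_cases j <;> simp
  · linear_combination (-Complex.sin s) * hI
  · linear_combination (Complex.sin s) * hI

theorem fieldY_kernel_rotation (t : ℝ) (g : SU2) :
    fieldY (kernel t) (rotation * g * rotation⁻¹) = fieldX (kernel t) g := by
  rw [fieldX, fieldY]
  congr 1
  funext s
  rw [← rotation_expX, ← kernel_rotation_conj t (g * expX s)]
  congr 1
  group

theorem fieldX_kernel_rotation (t : ℝ) (g : SU2) :
    fieldX (kernel t) (rotation * g * rotation⁻¹) = -fieldY (kernel t) g := by
  rw [fieldX, fieldY]
  have h : (fun s => kernel t (rotation * g * rotation⁻¹ * expX s)) =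
      fun s => (fun s => kernel t (g * expY s)) (-s) := by
    funext s
    simp only
    rw [← rotation_expY, ← kernel_rotation_conj t (g * expY (-s))]
    congr 1
    group
  rw [h]
  exact (deriv_comp_neg (fun s => kernel t (g * expY s)) 0).trans (by rw [neg_zero])

theorem integral_rotation_conj (F : SU2 → ℝ) :
    ∫ g, F (rotation * g * rotation⁻¹) ∂haar = ∫ g, F g ∂haar := by
  rw [integral_mul_left_eq_self (fun g => F (g * rotation⁻¹)) rotation,
    integral_mul_right_eq_self]

/-- The quarter turn sends `(X, Y)` to `(-Y, X)` on the kernel, so this integral equals its own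
negative. -/
theorem integral_fieldX_mul_fieldY_kernel (t : ℝ) :
    ∫ g, fieldX (kernel t) g * fieldY (kernel t) g ∂haar = 0 := by
  have h := integral_rotation_conj fun g => fieldX (kernel t) g * fieldY (kernel t) g
  simp only [fieldX_kernel_rotation, fieldY_kernel_rotation] at h
  have h2 : ∫ g, -fieldY (kernel t) g * fieldX (kernel t) g ∂haar =
      -∫ g, fieldX (kernel t) g * fieldY (kernel t) g ∂haar := by
    rw [← integral_neg]
    refine integral_congr_ae (Eventually.of_forall fun g => ?_)
    simp only; ring
  rw [h2] at h
  linarith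

theorem integral_fieldX_sq_kernel (t : ℝ) :
    ∫ g, fieldX (kernel t) g ^ 2 ∂haar = ∫ g, fieldY (kernel t) g ^ 2 ∂haar := by
  have h := integral_rotation_conj fun g => fieldY (kernel t) g ^ 2
  simpa only [fieldY_kernel_rotation] using h

/-- The two fields share the Dirichlet energy of the kernel equally, and that energy is `-∫ pₜ ℒ
pₜ`. -/
theorem integral_fieldX_sq_kernel_eq_gradConst {t : ℝ} (ht : 0 < t) :
    ∫ g, fieldX (kernel t) g ^ 2 ∂haar = gradConst t := by
  have hk := isSmooth_kernel ht
  have h := integral_mul_sublaplacian_self hk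
  have c1 := hk.fieldX.continuous
  have c2 := hk.fieldY.continuous
  have i1 : Integrable (fun g => fieldX (kernel t) g ^ 2) haar := integrable_of_continuous (c1.pow 2)
  have i2 : Integrable (fun g => fieldY (kernel t) g ^ 2) haar := integrable_of_continuous (c2.pow 2)
  rw [integral_add i1 i2, ← integral_fieldX_sq_kernel, integral_kernel_mul_sublaplacian ht, neg_neg] at h
  rw [gradConst_eq ht]
  linarith

/-! ### The gradient bound -/

/-- Bessel's inequality for an orthogonal pair of equal norm, obtained from the squared residual of
the projection scaled by `a`. Cauchy-Schwarz on each term separately would lose a factor two. -/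
theorem sq_integral_add_sq_integral_le {φ₁ φ₂ ψ : SU2 → ℝ} (h₁ : Continuous φ₁)
    (h₂ : Continuous φ₂) (hψ : Continuous ψ) {a : ℝ} (ha : 0 < a)
    (e₁ : ∫ h, φ₁ h ^ 2 ∂haar = a) (e₂ : ∫ h, φ₂ h ^ 2 ∂haar = a)
    (e₁₂ : ∫ h, φ₁ h * φ₂ h ∂haar = 0) :
    (∫ h, φ₁ h * ψ h ∂haar) ^ 2 + (∫ h, φ₂ h * ψ h ∂haar) ^ 2 ≤ a * ∫ h, ψ h ^ 2 ∂haar := by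
  set A := ∫ h, φ₁ h * ψ h ∂haar
  set B := ∫ h, φ₂ h * ψ h ∂haar
  have h0 : 0 ≤ ∫ h, (a * ψ h - A * φ₁ h - B * φ₂ h) ^ 2 ∂haar :=
    integral_nonneg fun h => sq_nonneg _
  have e : ∀ h, (a * ψ h - A * φ₁ h - B * φ₂ h) ^ 2 = a ^ 2 * ψ h ^ 2 + A ^ 2 * φ₁ h ^ 2 +
      B ^ 2 * φ₂ h ^ 2 + -2 * a * A * (φ₁ h * ψ h) + -2 * a * B * (φ₂ h * ψ h) +
      2 * A * B * (φ₁ h * φ₂ h) := fun h => by ring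
  rw [integral_congr_ae (Eventually.of_forall e), integral_add, integral_add, integral_add,
    integral_add, integral_add] at h0
  rotate_left
  iterate 10 exact integrable_of_continuous (by fun_prop)
  simp only [integral_const_mul] at h0
  rw [e₁, e₂, e₁₂] at h0
  have h1 : 0 ≤ a * (a * ∫ h, ψ h ^ 2 ∂haar - (A ^ 2 + B ^ 2)) := by
    refine h0.trans (le_of_eq ?_)
    ring
  have := nonneg_of_mul_nonneg_right h1 ha
  linarith

theorem integral_inv_mul (F : SU2 → ℝ) (g : SU2) :
    ∫ h, F (h⁻¹ * g) ∂haar = ∫ h, F h ∂haar := by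
  rw [integral_inv_eq_self (fun h => F (h * g)) haar, integral_mul_right_eq_self]

/-- A derivative of the kernel has integral zero, so any constant may be subtracted from `f`. Taking
its mean brings in the variance. -/
theorem fieldAlong_conv {γ : ℝ → SU2} {R : Mat →L[ℂ] Mat} (hd : IsDirection γ R) {t : ℝ}
    (ht : 0 < t) {f : SU2 → ℝ} (hf : Continuous f) (g : SU2) (c : ℝ) :
    fieldAlong γ (conv t f) g = ∫ h, fieldAlong γ (kernel t) (h⁻¹ * g) * (f h - c) ∂haar := by
  have hk := isSmooth_kernel ht
  have hc : Continuous fun h => fieldAlong γ (kernel t) (h⁻¹ * g) :=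
    (hk.fieldAlong hd).1.continuous.comp (continuous_inv.mul continuous_const)
  simp only [mul_sub]
  have i1 : Integrable (fun h => fieldAlong γ (kernel t) (h⁻¹ * g) * f h) haar :=
    integrable_of_continuous (hc.mul hf)
  rw [integral_sub i1 ((integrable_of_continuous hc).mul_const c), integral_mul_const,
    integral_inv_mul, integral_fieldAlong hd hk, zero_mul, sub_zero]
  exact fieldAlong_convolution hd hk hf g

theorem carreDuChamp_conv_le {t : ℝ} (ht : 0 < t) {f : SU2 → ℝ} (hf : Continuous f) (g : SU2) :
    carreDuChamp (conv t f) (conv t f) g ≤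
      gradConst t * ((∫ h, f h ^ 2 ∂haar) - (∫ h, f h ∂haar) ^ 2) := by
  have hk := isSmooth_kernel ht
  have hcm : Continuous fun h : SU2 => h⁻¹ * g := continuous_inv.mul continuous_const
  set c := ∫ h, f h ∂haar with hc
  have hvar : ∫ h, (f h - c) ^ 2 ∂haar = (∫ h, f h ^ 2 ∂haar) - c ^ 2 := by
    have e : ∀ h, (f h - c) ^ 2 = f h ^ 2 - 2 * c * f h + c ^ 2 := fun h => by ring
    rw [integral_congr_ae (Eventually.of_forall e), integral_add, integral_sub, integral_const_mul,
      ← hc]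
    · simp; ring
    all_goals exact integrable_of_continuous (by fun_prop)
  rw [carreDuChamp_self (isSmooth_conv ht hf), ← hvar, fieldX_eq, fieldY_eq,
    fieldAlong_conv isDirection_expX ht hf g c, fieldAlong_conv isDirection_expY ht hf g c]
  have h1 := integral_fieldX_sq_kernel_eq_gradConst ht
  refine sq_integral_add_sq_integral_le (hk.fieldX.continuous.comp hcm)
    (hk.fieldY.continuous.comp hcm) (hf.sub continuous_const) (gradConst_pos ht) ?_ ?_ ?_
  · exact (integral_inv_mul (fun h => fieldX (kernel t) h ^ 2) g).trans h1
  · exact (integral_inv_mul (fun h => fieldY (kernel t) h ^ 2) g).trans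
      ((integral_fieldX_sq_kernel t).symm.trans h1)
  · exact (integral_inv_mul (fun h => fieldX (kernel t) h * fieldY (kernel t) h) g).trans
      (integral_fieldX_mul_fieldY_kernel t)

end SubellipticSU2

namespace SubellipticSU2

/-! ### The constant of the gradient bound -/

/-- The general term of the spectral expansion of `2 A(t)`. -/
noncomputable def gradTerm (t : ℝ) (i : ℕ × ℕ) : ℝ := eigenvalue i * heatCoeff (2 * t) i

theorem gradTerm_nonneg (t : ℝ) (i : ℕ × ℕ) : 0 ≤ gradTerm t i :=
  mul_nonneg (eigenvalue_nonneg i) (heatCoeff_pos _ i).le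

theorem summable_gradTerm {t : ℝ} (ht : 0 < t) : Summable (gradTerm t) :=
  summable_eigenvalue_mul_heatCoeff (by linarith)

theorem gradConst_eq_tsum {t : ℝ} (ht : 0 < t) : gradConst t = (∑' i, gradTerm t i) / 2 :=
  gradConst_eq ht

theorem gradConst_strictAntiOn : StrictAntiOn gradConst (Set.Ioi 0) := by
  intro s hs t ht hst
  have hs : 0 < s := hs
  have ht : 0 < t := ht
  rw [gradConst_eq_tsum hs, gradConst_eq_tsum ht]
  refine div_lt_div_of_pos_right ?_ two_pos
  refine Summable.tsum_lt_tsum (i := (1, 0)) (fun i => ?_) ?_ (summable_gradTerm ht)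
    (summable_gradTerm hs)
  · exact mul_le_mul_of_nonneg_left (heatCoeff_anti (by linarith) i) (eigenvalue_nonneg i)
  · have h : eigenvalue (1, 0) = 2 := by simp [eigenvalue]
    rw [gradTerm, gradTerm, heatCoeff, heatCoeff, h]
    refine mul_lt_mul_of_pos_left (mul_lt_mul_of_pos_left ?_ (dimension_pos _)) two_pos
    exact Real.exp_lt_exp.2 (by linarith)

/-! ### Large time -/

theorem eigenvalue_cases (i : ℕ × ℕ) :
    i = (0, 0) ∨ i = (1, 0) ∨ i = (0, 1) ∨ 4 ≤ eigenvalue i := by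
  obtain ⟨p, s⟩ := i
  have key : 2 ≤ p + s → (4 : ℝ) ≤ eigenvalue (p, s) := fun h => by
    have h' : (2 : ℝ) ≤ p + s := by exact_mod_cast h
    have := two_mul_le_eigenvalue (p, s)
    simp only at this
    linarith
  rcases Nat.lt_or_ge (p + s) 2 with h | h
  · have : (p = 0 ∧ s = 0) ∨ (p = 1 ∧ s = 0) ∨ (p = 0 ∧ s = 1) := by omega
    rcases this with ⟨rfl, rfl⟩ | ⟨rfl, rfl⟩ | ⟨rfl, rfl⟩ <;> simp
  · exact Or.inr (Or.inr (Or.inr (key h)))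

theorem gradTerm_mul_exp (t : ℝ) (i : ℕ × ℕ) : gradTerm t i * Real.exp (4 * t) =
    eigenvalue i * dimension i * Real.exp (-(2 * t * (eigenvalue i - 2))) := by
  rw [gradTerm, heatCoeff, mul_assoc, mul_assoc, ← Real.exp_add, mul_assoc]
  ring_nf

theorem tendsto_gradTerm_mul_exp (i : ℕ × ℕ) :
    Tendsto (fun t => gradTerm t i * Real.exp (4 * t)) atTop
      (𝓝 (if i ∈ ({(1, 0), (0, 1)} : Finset (ℕ × ℕ)) then 4 else 0)) := by
  simp only [gradTerm_mul_exp]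
  rcases eigenvalue_cases i with rfl | rfl | rfl | h
  · simp [eigenvalue]
  · have h : eigenvalue (1, 0) = 2 := by simp [eigenvalue]
    have h' : dimension (1, 0) = 2 := by norm_num [dimension]
    norm_num [h, h']
  · have h : eigenvalue (0, 1) = 2 := by simp [eigenvalue]
    have h' : dimension (0, 1) = 2 := by norm_num [dimension]
    norm_num [h, h']
  · rw [if_neg]
    · rw [← mul_zero (eigenvalue i * dimension i)]
      refine Tendsto.const_mul _ (Real.tendsto_exp_neg_atTop_nhds_zero.comp ?_)
      exact (tendsto_id.const_mul_atTop two_pos).atTop_mul_const (by linarith)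
    · intro hi
      simp only [Finset.mem_insert, Finset.mem_singleton] at hi
      rcases hi with rfl | rfl <;> norm_num [eigenvalue] at h

/-- After scaling, the exponent is `-2 t (eigenvalue - 2)`, which decreases in `t` except at `(0,
0)`, where the term is zero. The value at `t = 1` thus dominates. -/
theorem gradTerm_mul_exp_le {t : ℝ} (ht : 1 ≤ t) (i : ℕ × ℕ) :
    gradTerm t i * Real.exp (4 * t) ≤ gradTerm 1 i * Real.exp (4 * 1) := by
  rw [gradTerm_mul_exp, gradTerm_mul_exp]
  have h0 := mul_nonneg (eigenvalue_nonneg i) (dimension_pos i).le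
  rcases eigenvalue_cases i with rfl | h
  · simp [eigenvalue]
  · have h2 : 2 ≤ eigenvalue i := by
      rcases h with rfl | rfl | h
      · simp [eigenvalue]
      · simp [eigenvalue]
      · linarith
    refine mul_le_mul_of_nonneg_left (Real.exp_le_exp.2 ?_) h0
    nlinarith

theorem tendsto_gradConst_mul_exp :
    Tendsto (fun t => gradConst t * Real.exp (4 * t)) atTop (𝓝 4) := by
  have h : Tendsto (fun t => ∑' i, gradTerm t i * Real.exp (4 * t)) atTop
      (𝓝 (∑' i, if i ∈ ({(1, 0), (0, 1)} : Finset (ℕ × ℕ)) then (4 : ℝ) else 0)) := by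
    refine tendsto_tsum_of_dominated_convergence
      ((summable_gradTerm one_pos).mul_right (Real.exp (4 * 1))) tendsto_gradTerm_mul_exp ?_
    filter_upwards [eventually_ge_atTop 1] with t ht i
    rw [Real.norm_of_nonneg (mul_nonneg (gradTerm_nonneg t i) (Real.exp_pos _).le)]
    exact gradTerm_mul_exp_le ht i
  rw [tsum_eq_sum (s := {(1, 0), (0, 1)}) fun i hi => if_neg hi,
    Finset.sum_congr rfl fun i hi => if_pos hi] at h
  have h2 := h.div_const 2
  norm_num at h2
  refine h2.congr' ?_
  filter_upwards [eventually_gt_atTop 0] with t ht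
  rw [gradConst_eq_tsum ht, tsum_mul_right]
  ring

theorem gradConst_isEquivalent_atTop :
    gradConst ~[atTop] fun t : ℝ => 4 * Real.exp (-(4 * t)) := by
  rw [isEquivalent_iff_tendsto_one (Eventually.of_forall fun t => by positivity)]
  have h := tendsto_gradConst_mul_exp.div_const 4
  rw [div_self four_ne_zero] at h
  refine h.congr fun t => ?_
  simp only [Pi.div_apply]
  rw [Real.exp_neg]
  field_simp

/-! ### Small time -/

theorem cosh_eq_exp_neg_add (w : ℝ) : Real.cosh w = Real.exp (-w) + Real.sinh w := by
  rw [← Real.cosh_sub_sinh]; ring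

theorem exp_neg_mul_exp_neg_add (w : ℝ) :
    Real.exp (-w) * (Real.exp (-w) + 2 * Real.sinh w) = 1 := by
  rw [← Real.cosh_sub_sinh]
  linear_combination Real.cosh_sq w

theorem one_sub_exp_neg_two_mul (w : ℝ) :
    1 - Real.exp (-(2 * w)) = 2 * Real.exp (-w) * Real.sinh w := by
  have h : Real.exp (-(2 * w)) = Real.exp (-w) ^ 2 := by
    rw [← Real.exp_nat_mul]; congr 1; push_cast; ring
  rw [h]
  linear_combination -exp_neg_mul_exp_neg_add w

/-- A geometric-type series in `exp (-2 w)`, using `2 p + 1 = 2 (p + 1) - 1`. With `y = exp (-w)`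
and `D = sinh w`, the closed form follows from the single relation `y (y + 2 D) = 1`. -/
theorem hasSum_odd_mul_exp {w : ℝ} (hw : 0 < w) :
    HasSum (fun p : ℕ => (2 * p + 1 : ℝ) * Real.exp (-(w * (2 * p + 1))))
      (Real.cosh w / (2 * Real.sinh w ^ 2)) := by
  have hy : ‖Real.exp (-(2 * w))‖ < 1 := by
    rw [Real.norm_of_nonneg (Real.exp_pos _).le, Real.exp_lt_one_iff]; linarith
  have h1 := hasSum_choose_mul_geometric_of_norm_lt_one 1 hy
  have h0 := hasSum_geometric_of_norm_lt_one hy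
  have h := ((h1.mul_left 2).sub h0).mul_left (Real.exp (-w))
  have hne : 1 - Real.exp (-(2 * w)) ≠ 0 := by
    rw [Real.norm_of_nonneg (Real.exp_pos _).le] at hy; linarith
  convert! h using 1
  · funext p
    rw [Nat.choose_one_right, ← Real.exp_nat_mul, show -(w * (2 * p + 1)) = -w + p * -(2 * w) by ring,
      Real.exp_add]
    push_cast
    ring
  · rw [one_sub_exp_neg_two_mul] at hne ⊢
    have hD : Real.sinh w ≠ 0 := right_ne_zero_of_mul hne
    have h := exp_neg_mul_exp_neg_add w
    rw [cosh_eq_exp_neg_add]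
    have hy : Real.exp (-w) ≠ 0 := (Real.exp_pos _).ne'
    generalize Real.exp (-w) = y at *
    generalize Real.sinh w = D at *
    field_simp
    linear_combination (4 * y * D ^ 2) * h

theorem hasSum_odd_sq_mul_exp {w : ℝ} (hw : 0 < w) :
    HasSum (fun p : ℕ => (2 * p + 1 : ℝ) ^ 2 * Real.exp (-(w * (2 * p + 1))))
      ((2 + Real.sinh w ^ 2) / (2 * Real.sinh w ^ 3)) := by
  have hy : ‖Real.exp (-(2 * w))‖ < 1 := by
    rw [Real.norm_of_nonneg (Real.exp_pos _).le, Real.exp_lt_one_iff]; linarith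
  have h2 := hasSum_choose_mul_geometric_of_norm_lt_one 2 hy
  have h1 := hasSum_choose_mul_geometric_of_norm_lt_one 1 hy
  have h0 := hasSum_geometric_of_norm_lt_one hy
  -- In binomials, `(2 p + 1) ^ 2 = 8 C(p + 2, 2) - 8 C(p + 1, 1) + 1`.
  have h := (((h2.mul_left 8).sub (h1.mul_left 8)).add h0).mul_left (Real.exp (-w))
  have hne : 1 - Real.exp (-(2 * w)) ≠ 0 := by
    rw [Real.norm_of_nonneg (Real.exp_pos _).le] at hy; linarith
  convert! h using 1
  · funext p
    rw [Nat.choose_one_right, Nat.cast_choose_two, ← Real.exp_nat_mul,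
      show -(w * (2 * p + 1)) = -w + p * -(2 * w) by ring, Real.exp_add]
    push_cast
    ring
  · rw [one_sub_exp_neg_two_mul] at hne ⊢
    have hD : Real.sinh w ≠ 0 := right_ne_zero_of_mul hne
    have h := exp_neg_mul_exp_neg_add w
    have hy : Real.exp (-w) ≠ 0 := (Real.exp_pos _).ne'
    generalize Real.exp (-w) = y at *
    generalize Real.sinh w = D at *
    field_simp
    linear_combination (64 * D ^ 5 * y ^ 3) * h

theorem cube_div_six_le_sinh {w : ℝ} (hw : 0 ≤ w) : w ^ 3 / 6 ≤ Real.sinh w := by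
  have h := le_hasSum (Real.hasSum_sinh w) 1 fun i _ => by positivity
  norm_num [Nat.factorial] at h
  linarith

theorem tendsto_div_sinh : Tendsto (fun w => w / Real.sinh w) (𝓝[>] 0) (𝓝 1) := by
  have h : Tendsto (fun w : ℝ => w⁻¹ * Real.sinh w) (𝓝[>] 0) (𝓝 1) := by
    have h := (Real.hasDerivAt_sinh 0).tendsto_slope_zero_right
    simpa using h
  refine (by simpa using h.inv₀ one_ne_zero : Tendsto _ _ _).congr fun w => ?_
  rw [div_eq_mul_inv, mul_comm]

theorem tendsto_sq_mul_odd_sum :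
    Tendsto (fun w => w ^ 2 * (Real.cosh w / (2 * Real.sinh w ^ 2))) (𝓝[>] 0) (𝓝 (1 / 2)) := by
  have hc : Tendsto Real.cosh (𝓝[>] 0) (𝓝 1) := by
    simpa using (Real.continuous_cosh.tendsto 0).mono_left nhdsWithin_le_nhds
  have h := ((tendsto_div_sinh.pow 2).mul hc).div_const 2
  rw [one_pow, one_mul] at h
  refine h.congr fun w => ?_
  ring

theorem tendsto_cube_mul_odd_sq_sum :
    Tendsto (fun w => w ^ 3 * ((2 + Real.sinh w ^ 2) / (2 * Real.sinh w ^ 3))) (𝓝[>] 0)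
      (𝓝 1) := by
  have hc : Tendsto Real.sinh (𝓝[>] 0) (𝓝 0) := by
    simpa using (Real.continuous_sinh.tendsto 0).mono_left nhdsWithin_le_nhds
  have h := ((tendsto_div_sinh.pow 3).mul ((hc.pow 2).const_add 2)).div_const 2
  norm_num at h
  refine h.congr fun w => ?_
  ring

theorem sq_mul_odd_sum_le {w : ℝ} (hw : 0 < w) :
    w ^ 2 * (Real.cosh w / (2 * Real.sinh w ^ 2)) ≤ 3 := by
  have h1 : w ≤ Real.sinh w := Real.self_le_sinh_iff.2 hw.le
  have h3 := cube_div_six_le_sinh hw.le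
  have hs := hw.trans_le h1
  have hc : Real.cosh w ≤ 1 + Real.sinh w := by
    rw [cosh_eq_exp_neg_add]
    gcongr
    exact Real.exp_le_one_iff.2 (by linarith)
  rw [mul_div_assoc', div_le_iff₀ (by positivity)]
  have hw2 : w ^ 2 ≤ 4 * Real.sinh w := by nlinarith [sq_nonneg (w - 1)]
  nlinarith [mul_le_mul_of_nonneg_left hc (sq_nonneg w), mul_le_mul_of_nonneg_right hw2 hs.le,
    pow_le_pow_left₀ hw.le h1 2]

theorem cube_mul_odd_sq_sum_le {w : ℝ} (hw : 0 < w) :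
    w ^ 3 * ((2 + Real.sinh w ^ 2) / (2 * Real.sinh w ^ 3)) ≤ 4 := by
  have h1 : w ≤ Real.sinh w := Real.self_le_sinh_iff.2 hw.le
  have h3 := cube_div_six_le_sinh hw.le
  have hs := hw.trans_le h1
  rw [mul_div_assoc', div_le_iff₀ (by positivity)]
  nlinarith [pow_le_pow_left₀ hw.le h1 3, mul_le_mul_of_nonneg_right h3 (sq_nonneg (Real.sinh w))]

/-- The sum over `p` of `(2 p + 1) λ exp (-2 t λ)`, where `λ = (2 s + 1) (2 p + 1) - 1`. -/
noncomputable def rowSum (t : ℝ) (s : ℕ) : ℝ :=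
  Real.exp (2 * t) * ((2 * s + 1) *
    ((2 + Real.sinh (2 * t * (2 * s + 1)) ^ 2) / (2 * Real.sinh (2 * t * (2 * s + 1)) ^ 3)) -
    Real.cosh (2 * t * (2 * s + 1)) / (2 * Real.sinh (2 * t * (2 * s + 1)) ^ 2))

theorem hasSum_rowSum {t : ℝ} (ht : 0 < t) (s : ℕ) :
    HasSum (fun p : ℕ => (2 * p + 1 : ℝ) * eigenvalue (s, p) *
      Real.exp (-(2 * t * eigenvalue (s, p)))) (rowSum t s) := by
  have hw : 0 < 2 * t * (2 * s + 1) := by positivity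
  have h := (((hasSum_odd_sq_mul_exp hw).mul_left (2 * s + 1 : ℝ)).sub
    (hasSum_odd_mul_exp hw)).mul_left (Real.exp (2 * t))
  refine h.congr_fun ?_
  intro p
  have e : Real.exp (-(2 * t * eigenvalue (s, p))) =
      Real.exp (2 * t) * Real.exp (-(2 * t * (2 * s + 1) * (2 * p + 1))) := by
    rw [← Real.exp_add, eigenvalue]
    congr 1
    simp only
    ring
  rw [e, eigenvalue]
  simp only
  ring

/-- Twice the dimension is `(2 p + 1) + (2 s + 1)`, and the two halves are exchanged by the symmetry
of the eigenvalue. Keeping only one of them leaves an inner sum in closed form. -/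
theorem tsum_gradTerm {t : ℝ} (ht : 0 < t) : ∑' i, gradTerm t i = ∑' s, rowSum t s := by
  set F : ℕ × ℕ → ℝ := fun i => (2 * i.2 + 1) * eigenvalue i * Real.exp (-(2 * t * eigenvalue i))
  have hG := summable_gradTerm ht
  have hF : Summable F := by
    refine (hG.mul_left 2).of_nonneg_of_le (fun i => ?_) fun i => ?_
    · exact mul_nonneg (mul_nonneg (by positivity) (eigenvalue_nonneg i)) (Real.exp_pos _).le
    · have h : (2 * i.2 + 1 : ℝ) ≤ 2 * dimension i := by
        rw [dimension]
        have : (0 : ℝ) ≤ i.1 := Nat.cast_nonneg _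
        linarith
      have := mul_le_mul_of_nonneg_right h
        (mul_nonneg (eigenvalue_nonneg i) (Real.exp_pos (-(2 * t * eigenvalue i))).le)
      simp only [F, gradTerm, heatCoeff]
      linarith
  have hF' : Summable fun i : ℕ × ℕ => F i.swap := (Equiv.prodComm ℕ ℕ).summable_iff.2 hF
  have hsw : ∑' i : ℕ × ℕ, F i.swap = ∑' i, F i := (Equiv.prodComm ℕ ℕ).tsum_eq F
  have h : ∀ i, 2 * gradTerm t i = F i + F i.swap := fun i => by
    simp only [F, gradTerm, heatCoeff, dimension, eigenvalue_swap, Prod.snd_swap]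
    ring
  have h2 : 2 * ∑' i, gradTerm t i = 2 * ∑' i, F i := by
    rw [← tsum_mul_left, tsum_congr h, hF.tsum_add hF', hsw, two_mul]
  rw [mul_left_cancel₀ two_ne_zero h2, hF.tsum_prod]
  exact tsum_congr fun s => (hasSum_rowSum ht s).tsum_eq

/-- In terms of `w = 2 t (2 s + 1)`, both parts become functions of `w` bounded on `(0, ∞)`, with
the summable weight `1 / (2 s + 1) ^ 2` in front. The `cosh` part keeps a spare factor `t` and so
does not contribute to the limit. -/
theorem cube_mul_rowSum (t : ℝ) (s : ℕ) : t ^ 3 * rowSum t s = Real.exp (2 * t) *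
    ((2 * t * (2 * s + 1)) ^ 3 * ((2 + Real.sinh (2 * t * (2 * s + 1)) ^ 2) /
      (2 * Real.sinh (2 * t * (2 * s + 1)) ^ 3)) / 8 - t * ((2 * t * (2 * s + 1)) ^ 2 *
      (Real.cosh (2 * t * (2 * s + 1)) / (2 * Real.sinh (2 * t * (2 * s + 1)) ^ 2))) / 4) /
    (2 * s + 1) ^ 2 := by
  have : (2 * s + 1 : ℝ) ≠ 0 := by positivity
  rw [rowSum]
  generalize (2 + Real.sinh (2 * t * (2 * s + 1)) ^ 2) /
    (2 * Real.sinh (2 * t * (2 * s + 1)) ^ 3) = a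
  generalize Real.cosh (2 * t * (2 * s + 1)) / (2 * Real.sinh (2 * t * (2 * s + 1)) ^ 2) = b
  field_simp
  ring

theorem tendsto_cube_mul_rowSum (s : ℕ) :
    Tendsto (fun t => t ^ 3 * rowSum t s) (𝓝[>] 0) (𝓝 (1 / 8 / (2 * s + 1) ^ 2)) := by
  simp only [cube_mul_rowSum]
  have hw : Tendsto (fun t : ℝ => 2 * t * (2 * s + 1)) (𝓝[>] 0) (𝓝[>] 0) := by
    refine tendsto_nhdsWithin_iff.2 ⟨?_, ?_⟩
    · have : Continuous fun t : ℝ => 2 * t * (2 * s + 1) := by fun_prop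
      simpa using (this.tendsto 0).mono_left nhdsWithin_le_nhds
    · filter_upwards [self_mem_nhdsWithin] with t ht
      have ht : 0 < t := ht
      simp only [Set.mem_Ioi]
      positivity
  have h1 := tendsto_cube_mul_odd_sq_sum.comp hw
  have h2 := tendsto_sq_mul_odd_sum.comp hw
  have he : Tendsto (fun t : ℝ => Real.exp (2 * t)) (𝓝[>] 0) (𝓝 1) := by
    have : Continuous fun t : ℝ => Real.exp (2 * t) := by fun_prop
    simpa using (this.tendsto 0).mono_left nhdsWithin_le_nhds
  have hid : Tendsto (fun t : ℝ => t) (𝓝[>] 0) (𝓝 0) := tendsto_id.mono_left nhdsWithin_le_nhds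
  have h := (he.mul ((h1.div_const 8).sub ((hid.mul h2).div_const 4))).div_const
    ((2 * s + 1 : ℝ) ^ 2)
  simpa using h

theorem abs_cube_mul_rowSum_le {t : ℝ} (ht : 0 < t) (ht1 : t ≤ 1) (s : ℕ) :
    ‖t ^ 3 * rowSum t s‖ ≤ Real.exp 2 * 2 * (1 / (2 * s + 1 : ℝ) ^ 2) := by
  have hw : 0 < 2 * t * (2 * s + 1) := by positivity
  have h1 := cube_mul_odd_sq_sum_le hw
  have h2 := sq_mul_odd_sum_le hw
  have hs := Real.sinh_pos_iff.2 hw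
  have hc := Real.cosh_pos (2 * t * (2 * s + 1))
  have h1' : 0 ≤ (2 * t * (2 * s + 1)) ^ 3 * ((2 + Real.sinh (2 * t * (2 * s + 1)) ^ 2) /
      (2 * Real.sinh (2 * t * (2 * s + 1)) ^ 3)) := by positivity
  have h2' : 0 ≤ (2 * t * (2 * s + 1)) ^ 2 *
      (Real.cosh (2 * t * (2 * s + 1)) / (2 * Real.sinh (2 * t * (2 * s + 1)) ^ 2)) := by
    positivity
  rw [cube_mul_rowSum, norm_div, norm_mul, Real.norm_of_nonneg (Real.exp_pos _).le,
    Real.norm_of_nonneg (by positivity : (0 : ℝ) ≤ (2 * s + 1) ^ 2), ← mul_one_div]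
  refine mul_le_mul_of_nonneg_right ?_ (by positivity)
  refine mul_le_mul (Real.exp_le_exp.2 (by linarith)) ?_ (norm_nonneg _) (Real.exp_pos _).le
  rw [Real.norm_eq_abs, abs_le]
  have h3 := mul_le_mul ht1 h2 h2' zero_le_one
  have h3' := mul_nonneg ht.le h2'
  constructor <;> linarith

/-- Even squares account for a quarter of `π² / 6`. -/
theorem hasSum_one_div_odd_sq :
    HasSum (fun s : ℕ => 1 / (2 * s + 1 : ℝ) ^ 2) (Real.pi ^ 2 / 8) := by
  set f : ℕ → ℝ := fun n => 1 / (n : ℝ) ^ 2 with hf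
  have h : HasSum f (Real.pi ^ 2 / 6) := hasSum_zeta_two
  have he : HasSum (fun n => f (2 * n)) (Real.pi ^ 2 / 24) := by
    have h4 := h.mul_left (1 / 4)
    rw [show 1 / 4 * (Real.pi ^ 2 / 6) = Real.pi ^ 2 / 24 by ring] at h4
    refine h4.congr_fun fun n => ?_
    simp only [hf]
    push_cast
    ring
  have ho : Summable fun n => f (2 * n + 1) :=
    h.summable.comp_injective (i := fun n : ℕ => 2 * n + 1) fun a b hab => by
      simp only at hab; omega
  have h2 := (he.even_add_odd ho.hasSum).unique h
  have h3 := ho.hasSum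
  rw [show ∑' n, f (2 * n + 1) = Real.pi ^ 2 / 8 by linarith] at h3
  simpa [hf] using h3

/-- Dominated convergence over `s` gives `(1 / 8) (π² / 8) = π² / 64` for the series, and `A` is
half of it. -/
theorem tendsto_cube_mul_gradConst :
    Tendsto (fun t => t ^ 3 * gradConst t) (𝓝[>] 0) (𝓝 (Real.pi ^ 2 / 128)) := by
  have h : Tendsto (fun t => ∑' s, t ^ 3 * rowSum t s) (𝓝[>] 0)
      (𝓝 (∑' s : ℕ, 1 / 8 / (2 * s + 1 : ℝ) ^ 2)) := by
    refine tendsto_tsum_of_dominated_convergence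
      (hasSum_one_div_odd_sq.summable.mul_left (Real.exp 2 * 2)) tendsto_cube_mul_rowSum ?_
    filter_upwards [Ioc_mem_nhdsGT (zero_lt_one (α := ℝ))] with t ht s
    exact abs_cube_mul_rowSum_le ht.1 ht.2 s
  have e : ∑' s : ℕ, 1 / 8 / (2 * s + 1 : ℝ) ^ 2 = Real.pi ^ 2 / 64 := by
    rw [tsum_congr fun s : ℕ => (mul_one_div (1 / 8 : ℝ) ((2 * s + 1 : ℝ) ^ 2)).symm,
      tsum_mul_left, hasSum_one_div_odd_sq.tsum_eq]
    ring
  rw [e] at h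
  have h2 := h.div_const 2
  rw [div_div, show (64 * 2 : ℝ) = 128 by norm_num] at h2
  refine h2.congr' ?_
  filter_upwards [self_mem_nhdsWithin] with t ht
  rw [gradConst_eq_tsum ht, tsum_gradTerm ht, tsum_mul_left]
  ring

theorem gradConst_isEquivalent_zero :
    gradConst ~[𝓝[>] 0] fun t : ℝ => Real.pi ^ 2 / (128 * t ^ 3) := by
  have hne : ∀ᶠ t : ℝ in 𝓝[>] 0, Real.pi ^ 2 / (128 * t ^ 3) ≠ 0 := by
    filter_upwards [self_mem_nhdsWithin] with t ht
    have ht : 0 < t := ht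
    positivity
  rw [isEquivalent_iff_tendsto_one hne]
  have h := tendsto_cube_mul_gradConst.div_const (Real.pi ^ 2 / 128)
  rw [div_self (by positivity)] at h
  refine h.congr' ?_
  filter_upwards [self_mem_nhdsWithin] with t ht
  have ht : 0 < t := ht
  simp only [Pi.div_apply]
  field_simp

end SubellipticSU2

/-! ### Assembly of the theorem. -/

theorem mainTheorem8 :
    (∀ f : SubellipticSU2.SU2 → ℝ, SubellipticSU2.IsSmooth f →
      SubellipticSU2.IsHeatSolution f (fun t => SubellipticSU2.heatSemigroup t f) ∧
      ∀ u : ℝ → SubellipticSU2.SU2 → ℝ, SubellipticSU2.IsHeatSolution f u →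
        ∀ t : ℝ, 0 ≤ t → u t = SubellipticSU2.heatSemigroup t f) ∧
    (∀ t : ℝ, 0 < t →
      SubellipticSU2.IsHeatKernel t (SubellipticSU2.heatKernel t) ∧
      ∀ p : SubellipticSU2.SU2 → ℝ, SubellipticSU2.IsHeatKernel t p →
        p = SubellipticSU2.heatKernel t) ∧
    (∀ t : ℝ, 0 < t →
      DifferentiableAt ℝ
        (fun s : ℝ => ∫ g, SubellipticSU2.heatKernel s g ^ 2 ∂SubellipticSU2.haar) t) ∧
    (∀ f : SubellipticSU2.SU2 → ℝ, SubellipticSU2.IsSmooth f →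
      ∀ t : ℝ, 0 < t → ∀ g : SubellipticSU2.SU2,
        SubellipticSU2.carreDuChamp (SubellipticSU2.heatSemigroup t f)
            (SubellipticSU2.heatSemigroup t f) g ≤
          SubellipticSU2.gradConst t *
            ((∫ h, f h ^ 2 ∂SubellipticSU2.haar) - (∫ h, f h ∂SubellipticSU2.haar) ^ 2)) ∧
    StrictAntiOn SubellipticSU2.gradConst (Set.Ioi 0) ∧
    Asymptotics.IsEquivalent (𝓝[>] 0) SubellipticSU2.gradConst
      (fun t : ℝ => Real.pi ^ 2 / (128 * t ^ 3)) ∧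
    Asymptotics.IsEquivalent atTop SubellipticSU2.gradConst
      (fun t : ℝ => 4 * Real.exp (-(4 * t))) := by
  refine ⟨fun f hf => ?_, fun t ht => ?_, fun t ht => ?_, fun f hf t ht g => ?_,
    SubellipticSU2.gradConst_strictAntiOn, SubellipticSU2.gradConst_isEquivalent_zero,
    SubellipticSU2.gradConst_isEquivalent_atTop⟩
  · have h := SubellipticSU2.isHeatSolution_heatSemigroup hf
    exact ⟨h, fun u hu t ht => hu.unique h ht⟩
  · have h := SubellipticSU2.isHeatKernel_heatKernel ht
    exact ⟨h, fun p hp => hp.unique h⟩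
  · exact (SubellipticSU2.hasDerivAt_integral_heatKernel_sq ht).differentiableAt
  · rw [SubellipticSU2.heatSemigroup_eq_conv hf ht]
    exact SubellipticSU2.carreDuChamp_conv_le ht hf.continuous g
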